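/- Let $n\ge 1$, $\mathbb T=\mathbb R/2\pi\mathbb Z$, $\nu\in\mathbb N^n$ (a vector of nonnegative integers) and $V\in C^\infty(\mathbb T\times\mathbb T^n;\mathbb R^n)$, and put $$\langle V\rangle_\nu(x):=\frac1{2\pi}\int_0^{2\pi}V(\tau,x-\tau\nu)\,d\tau ,\qquad x\in\mathbb T^n .$$ For $\varepsilon\ge 0$ consider the transport equation $$\partial_t u=(\nu+\varepsilon V(t,x))\cdot\nabla_x u+\frac{\varepsilon}{2}\,\mathrm{div}_x(V(t,x))\,u,\qquad x\in\mathbb T^n,\ t\in\mathbb R. \tag{1}$$ For a distribution $u\in\mathcal D'(\mathbb T^n)$ with Fourier coefficients $\hat u(k)$, $k\in\mathbb Z^n$, and a symbol $a(x,\xi)$ that is $2\pi\mathbb Z^n$-periodic in $x$, the Weyl quantization $\operatorname{Op^w}(a)u$ is the distribution whose $m$-th Fourier coefficient is $\sum_{k}\hat a\big(m-k,\tfrac{m+k}2\big)\hat u(k)$, where $\hat a(j,\xi)$ is the $j$-th Fourier coefficient of $x\mapsto a(x,\xi)$. A solution of (1), or of (2) below, is a curve $t\in\mathbb R\mapsto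 u(t)\in\mathcal D'(\mathbb T^n)$ that satisfies the equation after pairing with every test function in $C^\infty(\mathbb T^n)$. $\mathcal H^\sigma$ is the usual Sobolev space on $\mathbb T^n$. There exists $\varepsilon_0>0$ and, for every $0\le\varepsilon\le\varepsilon_0$, there exist invertible linear maps $\Phi_\varepsilon(t):\mathcal D'(\mathbb T^n)\to\mathcal D'(\mathbb T^n)$, $t\in\mathbb R$, and a vector field $W_{\nu,\varepsilon}\in C^\infty(\mathbb T\times\mathbb T^n;\mathbb R^n)$, all of whose $C^m$ seminorms are bounded uniformly in $\varepsilon\in[0,\varepsilon_0]$, such that: 1. $t\mapsto\Phi_\varepsilon(t)$ is $2\pi$-periodic; 2. for every real $\sigma\ge 0$ there is $C_\sigma>0$ such that, for all $0\le\varepsilon\le\varepsilon_0$ and all $t\in\mathbb R$, $$\|\Phi_\varepsilon(t)\|_{\mathcal H^\sigma\to\mathcal H^\sigma}+\|\Phi_\varepsilon(t)^{-1}\|_{\mathcal H^\sigma\to\mathcal H^\sigma}\le C_\sigma ;$$ 3. $C_\sigma$ can be chosen bounded for $\sigma$ in any compact interval of $[0,\infty)$; 4. for every solution $u_\varepsilon$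 of (1), the function $v_\varepsilon$ defined by $u_\varepsilon(t)=\Phi_\varepsilon(t)v_\varepsilon(t)$ solves $$\partial_t v_\varepsilon=\operatorname{Op^w}\!\big(i\,\xi\cdot(\varepsilon\langle V\rangle_\nu(x)+\varepsilon^2W_{\nu,\varepsilon}(t,x))\big)v_\varepsilon . \tag{2}$$ -/

import Mathlib

open scoped ContDiff ENNReal

noncomputable section

namespace TorusTransport

/-- The translate `x + 2πk` of a point `x ∈ ℝⁿ` by an element of the lattice `2πℤⁿ`. -/
def shift {n : ℕ} (x : Fin n → ℝ) (k : Fin n → ℤ) : Fin n → ℝ :=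
  fun j => x j + 2 * Real.pi * (k j : ℝ)

theorem shift_eq {n : ℕ} (x : Fin n → ℝ) (k : Fin n → ℤ) : shift x k = x + shift 0 k := by
  funext j
  simp [shift]

/-- `C^∞(𝕋ⁿ; ℂ)`, `𝕋 = ℝ/2πℤ`: the algebra of smooth `2πℤⁿ`-periodic functions on `ℝⁿ`. -/
def TestFn (n : ℕ) : Subalgebra ℂ ((Fin n → ℝ) → ℂ) where
  carrier := {f | ContDiff ℝ ∞ f ∧ ∀ (k : Fin n → ℤ) (x : Fin n → ℝ), f (shift x k) = f x}
  mul_mem' := by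
    rintro f g ⟨hf, hf'⟩ ⟨hg, hg'⟩
    exact ⟨hf.mul hg, fun k x => by simp [hf' k x, hg' k x]⟩
  add_mem' := by
    rintro f g ⟨hf, hf'⟩ ⟨hg, hg'⟩
    exact ⟨hf.add hg, fun k x => by simp [hf' k x, hg' k x]⟩
  algebraMap_mem' := fun c => ⟨contDiff_const, fun _ _ => rfl⟩

theorem fderiv_shift {n : ℕ} (f : TestFn n) (k : Fin n → ℤ) (x : Fin n → ℝ) :
    fderiv ℝ (f : (Fin n → ℝ) → ℂ) (shift x k) = fderiv ℝ (f : (Fin n → ℝ) → ℂ) x := by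
  have h : (fun y => (f : (Fin n → ℝ) → ℂ) (y + shift 0 k)) = f := by
    funext y
    rw [← f.2.2 k y, ← shift_eq]
  have h2 := fderiv_comp_add_right (𝕜 := ℝ) (f := (f : (Fin n → ℝ) → ℂ)) (x := x) (shift 0 k)
  rw [h] at h2
  rw [h2, ← shift_eq]

/-- The partial derivative `∂ⱼ` on `C^∞(𝕋ⁿ; ℂ)`. -/
def partialFn {n : ℕ} (j : Fin n) : TestFn n →ₗ[ℂ] TestFn n where
  toFun f := ⟨fun x => fderiv ℝ (f : (Fin n → ℝ) → ℂ) x (Pi.single j 1),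
    (f.2.1.fderiv_right (m := ∞) (by simp)).clm_apply contDiff_const,
    fun k x => by
      change fderiv ℝ _ (shift x k) _ = _
      rw [fderiv_shift]⟩
  map_add' f g := by
    ext x
    have hf := (f.2.1.differentiable (by simp)) x
    have hg := (g.2.1.differentiable (by simp)) x
    change fderiv ℝ ((f : (Fin n → ℝ) → ℂ) + (g : (Fin n → ℝ) → ℂ)) x (Pi.single j 1) = _
    rw [fderiv_add hf hg]
    rfl
  map_smul' c f := by
    ext x
    have hf := (f.2.1.differentiable (by simp)) x
    change fderiv ℝ (c • (f : (Fin n → ℝ) → ℂ)) x (Pi.single j 1) = _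
    rw [fderiv_const_smul hf c]
    rfl

/-- The character `e_k(x) = e^{i k·x}`, `k ∈ ℤⁿ`. -/
def character {n : ℕ} (k : Fin n → ℤ) : TestFn n :=
  ⟨fun x => Complex.exp (Complex.I * ∑ j, (k j : ℂ) * (x j : ℂ)), by
    constructor
    · have h : ∀ j : Fin n, ContDiff ℝ ∞ (fun x : Fin n → ℝ => ((x j : ℝ) : ℂ)) := fun j =>
        Complex.ofRealCLM.contDiff.comp (contDiff_apply ℝ ℝ j)
      exact (contDiff_const.mul (ContDiff.sum fun j _ => contDiff_const.mul (h j))).cexp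
    · intro l x
      have h : Complex.I * ∑ j, (k j : ℂ) * ((shift x l j : ℝ) : ℂ)
          = Complex.I * ∑ j, (k j : ℂ) * (x j : ℂ)
            + ((∑ j, k j * l j : ℤ) : ℂ) * (2 * Real.pi * Complex.I) := by
        simp only [shift]
        push_cast
        rw [Finset.mul_sum, Finset.mul_sum, Finset.sum_mul, ← Finset.sum_add_distrib]
        exact Finset.sum_congr rfl fun j _ => by ring
      change Complex.exp _ = Complex.exp _
      rw [h, Complex.exp_add, Complex.exp_int_mul_two_pi_mul_I, mul_one]⟩

/-- `𝒟'(𝕋ⁿ)`: the linear functionals on `C^∞(𝕋ⁿ; ℂ)` that are continuous for its Fréchet topology,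
that is, bounded by some `C^N` norm. -/
def Distr (n : ℕ) : Submodule ℂ (TestFn n →ₗ[ℂ] ℂ) where
  carrier := {u | ∃ (C : ℝ) (N : ℕ), ∀ (φ : TestFn n) (B : ℝ),
    (∀ i ≤ N, ∀ x, ‖iteratedFDeriv ℝ i (φ : (Fin n → ℝ) → ℂ) x‖ ≤ B) → ‖u φ‖ ≤ C * B}
  zero_mem' := ⟨0, 0, fun φ B _ => by simp⟩
  add_mem' := by
    rintro u v ⟨C, N, h⟩ ⟨C', N', h'⟩
    refine ⟨C + C', max N N', fun φ B hB => ?_⟩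
    have h1 := h φ B fun i hi => hB i (hi.trans (le_max_left _ _))
    have h2 := h' φ B fun i hi => hB i (hi.trans (le_max_right _ _))
    calc ‖(u + v) φ‖ ≤ ‖u φ‖ + ‖v φ‖ := norm_add_le _ _
      _ ≤ (C + C') * B := by linarith
  smul_mem' := by
    rintro c u ⟨C, N, h⟩
    refine ⟨‖c‖ * C, N, fun φ B hB => ?_⟩
    have h1 := h φ B hB
    calc ‖(c • u) φ‖ = ‖c‖ * ‖u φ‖ := norm_mul c (u φ)
      _ ≤ ‖c‖ * (C * B) := by gcongr
      _ = ‖c‖ * C * B := by ring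

theorem partialFn_bound {n : ℕ} (j : Fin n) (φ : TestFn n) (i : ℕ) (x : Fin n → ℝ) :
    ‖iteratedFDeriv ℝ i (partialFn j φ : (Fin n → ℝ) → ℂ) x‖
      ≤ ‖iteratedFDeriv ℝ (i + 1) (φ : (Fin n → ℝ) → ℂ) x‖ := by
  have h := (φ.2.1.fderiv_right (m := ∞) (by simp)).contDiffAt (x := x)
  have h2 := norm_iteratedFDeriv_clm_apply_const (𝕜 := ℝ)
    (c := (Pi.single j 1 : Fin n → ℝ)) (n := i) h (by exact_mod_cast le_top)
  rw [norm_iteratedFDeriv_fderiv] at h2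
  have h3 : ‖(Pi.single j 1 : Fin n → ℝ)‖ = 1 := by rw [Pi.norm_single, norm_one]
  rw [h3, one_mul] at h2
  exact h2

theorem exists_deriv_bound {n : ℕ} (a : TestFn n) (i : ℕ) :
    ∃ A : ℝ, ∀ x, ‖iteratedFDeriv ℝ i (a : (Fin n → ℝ) → ℂ) x‖ ≤ A := by
  have hc : Continuous fun x => iteratedFDeriv ℝ i (a : (Fin n → ℝ) → ℂ) x :=
    a.2.1.continuous_iteratedFDeriv (by exact_mod_cast le_top)
  obtain ⟨A, hA⟩ := (isCompact_Icc (a := (0 : Fin n → ℝ))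
    (b := fun _ => 2 * Real.pi)).exists_bound_of_continuousOn hc.continuousOn
  refine ⟨A, fun x => ?_⟩
  have hp : (0 : ℝ) < 2 * Real.pi := by positivity
  let k : Fin n → ℤ := fun j => - toIcoDiv hp 0 (x j)
  have hk : shift x k ∈ Set.Icc (0 : Fin n → ℝ) (fun _ => 2 * Real.pi) := by
    have hj : ∀ j, shift x k j = toIcoMod hp 0 (x j) := fun j => by
      simp only [shift, k, toIcoMod, zsmul_eq_mul]
      push_cast
      ring
    constructor
    · intro j
      rw [hj]
      exact (toIcoMod_mem_Ico hp 0 (x j)).1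
    · intro j
      rw [hj]
      have := (toIcoMod_mem_Ico hp 0 (x j)).2
      simp only [zero_add] at this
      exact this.le
  have h : (fun y => (a : (Fin n → ℝ) → ℂ) (y + shift 0 k)) = a := by
    funext y
    rw [← a.2.2 k y, ← shift_eq]
  have h2 := iteratedFDeriv_comp_add_right (𝕜 := ℝ) (f := (a : (Fin n → ℝ) → ℂ)) i (shift 0 k) x
  rw [h] at h2
  rw [h2, ← shift_eq]
  exact hA _ hk

theorem mul_bound {n : ℕ} (a : TestFn n) (N : ℕ) :
    ∃ A : ℝ, ∀ (φ : TestFn n) (B : ℝ),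
      (∀ i ≤ N, ∀ x, ‖iteratedFDeriv ℝ i (φ : (Fin n → ℝ) → ℂ) x‖ ≤ B) →
      ∀ i ≤ N, ∀ x, ‖iteratedFDeriv ℝ i ((a * φ : TestFn n) : (Fin n → ℝ) → ℂ) x‖ ≤ A * B := by
  choose D hD using exists_deriv_bound a
  have hD0 : ∀ i, 0 ≤ D i := fun i => (norm_nonneg _).trans (hD i 0)
  refine ⟨2 ^ N * ∑ i ∈ Finset.range (N + 1), D i, fun φ B hB i hi x => ?_⟩
  have hB0 : 0 ≤ B := (norm_nonneg _).trans (hB 0 (Nat.zero_le _) 0)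
  have hS0 : 0 ≤ ∑ i ∈ Finset.range (N + 1), D i := Finset.sum_nonneg fun i _ => hD0 i
  have h := norm_iteratedFDeriv_mul_le (𝕜 := ℝ) a.2.1 φ.2.1 x (n := i) (by exact_mod_cast le_top)
  refine h.trans ?_
  calc _ ≤ ∑ m ∈ Finset.range (i + 1),
        (i.choose m : ℝ) * (∑ i ∈ Finset.range (N + 1), D i) * B := by
        refine Finset.sum_le_sum fun m hm => ?_
        have hm' : m ≤ i := Nat.lt_succ_iff.mp (Finset.mem_range.mp hm)
        have h1 : D m ≤ ∑ i ∈ Finset.range (N + 1), D i :=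
          Finset.single_le_sum (fun i _ => hD0 i) (Finset.mem_range.mpr (by omega))
        have h2 := (hD m x).trans h1
        have h3 := hB (i - m) (by omega) x
        gcongr
    _ = 2 ^ i * (∑ i ∈ Finset.range (N + 1), D i) * B := by
        rw [← Finset.sum_mul, ← Finset.sum_mul]
        congr 2
        exact_mod_cast Nat.sum_range_choose i
    _ ≤ 2 ^ N * (∑ i ∈ Finset.range (N + 1), D i) * B := by
        gcongr
        norm_num

/-- Multiplication of a distribution by a smooth function: `⟨a u, φ⟩ = ⟨u, a φ⟩`. -/
def mulDistr {n : ℕ} (a : TestFn n) (u : Distr n) : Distr n :=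
  ⟨(u : TestFn n →ₗ[ℂ] ℂ) ∘ₗ LinearMap.mulLeft ℂ a, by
    obtain ⟨C, N, h⟩ := u.2
    obtain ⟨A, hA⟩ := mul_bound a N
    refine ⟨C * A, N, fun φ B hB => ?_⟩
    have := h (a * φ) (A * B) (hA φ B hB)
    rw [mul_assoc]
    exact this⟩

/-- Partial derivative of a distribution: `⟨∂ⱼ u, φ⟩ = -⟨u, ∂ⱼ φ⟩`. -/
def partialDistr {n : ℕ} (j : Fin n) (u : Distr n) : Distr n :=
  ⟨-((u : TestFn n →ₗ[ℂ] ℂ) ∘ₗ partialFn j), by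
    obtain ⟨C, N, h⟩ := u.2
    refine ⟨C, N + 1, fun φ B hB => ?_⟩
    have := h (partialFn j φ) B fun i hi x =>
      (partialFn_bound j φ i x).trans (hB (i + 1) (by omega) x)
    simpa using this⟩

/-- Fourier coefficients `û(k) = (2π)⁻ⁿ ⟨u, e_{-k}⟩`, so that `u = ∑ₖ û(k) e_k`. -/
def fourierDistr {n : ℕ} (u : Distr n) (k : Fin n → ℤ) : ℂ :=
  ((2 * Real.pi : ℝ) ^ n : ℂ)⁻¹ * (u : TestFn n →ₗ[ℂ] ℂ) (character (-k))

/-- The Sobolev norm `‖(1-Δ)^{σ/2} u‖_{L²(𝕋ⁿ)} = ((2π)ⁿ ∑ₖ (1+|k|²)^σ |û(k)|²)^{1/2}`, with the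
value `∞` when `u ∉ H^σ(𝕋ⁿ)`. -/
def sobolevNorm {n : ℕ} (σ : ℝ) (u : Distr n) : ℝ≥0∞ :=
  (ENNReal.ofReal ((2 * Real.pi) ^ n) * ∑' k : Fin n → ℤ,
    ENNReal.ofReal ((1 + ∑ j, (k j : ℝ) ^ 2) ^ σ * ‖fourierDistr u k‖ ^ 2)) ^ (1 / 2 : ℝ)

/-- The operator norm `H^σ(𝕋ⁿ) → H^σ(𝕋ⁿ)` (`∞` when the map is not bounded on `H^σ`). -/
def sobolevOpNorm {n : ℕ} (σ : ℝ) (T : Distr n →ₗ[ℂ] Distr n) : ℝ≥0∞ :=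
  ⨆ (u : Distr n) (_ : sobolevNorm σ u ≤ 1), sobolevNorm σ (T u)

/-- `C^∞(𝕋 × 𝕋ⁿ; ℝⁿ)`: smooth time-periodic vector fields on the torus, with arguments `(t, x)`. -/
structure TorusField (n : ℕ) where
  toFun : ℝ × (Fin n → ℝ) → (Fin n → ℝ)
  smooth : ContDiff ℝ ∞ toFun
  periodic : ∀ (l : ℤ) (k : Fin n → ℤ) (t : ℝ) (x : Fin n → ℝ),
    toFun (t + 2 * Real.pi * (l : ℝ), shift x k) = toFun (t, x)

/-- The `j`-th component `V_j(t, ·)` as an element of `C^∞(𝕋ⁿ; ℂ)`. -/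
def TorusField.component {n : ℕ} (V : TorusField n) (t : ℝ) (j : Fin n) : TestFn n :=
  ⟨fun x => ((V.toFun (t, x) j : ℝ) : ℂ), by
    constructor
    · exact Complex.ofRealCLM.contDiff.comp
        ((contDiff_apply ℝ ℝ j).comp (V.smooth.comp (contDiff_const.prodMk contDiff_id)))
    · intro k x
      have h := V.periodic 0 k t x
      simp only [Int.cast_zero, mul_zero, add_zero] at h
      simp only [h]⟩

/-- The spatial divergence `div V(t, ·) = ∑ⱼ ∂ⱼ V_j(t, ·)`. -/
def TorusField.div {n : ℕ} (V : TorusField n) (t : ℝ) : TestFn n :=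
  ∑ j, partialFn j (V.component t j)

/-- The resonant average `⟨V⟩_ν(x) = (2π)⁻¹ ∫₀^{2π} V(τ, x - τν) dτ`. -/
def resonantAverage {n : ℕ} (ν : Fin n → ℕ) (V : TorusField n) (x : Fin n → ℝ) : Fin n → ℝ :=
  fun j => (2 * Real.pi)⁻¹ *
    ∫ τ in (0 : ℝ)..(2 * Real.pi), V.toFun (τ, fun l => x l - τ * (ν l : ℝ)) j

/-- `(ν + ε V(t,·))·∇u + (ε/2) div(V(t,·)) u` for a distribution `u` on `𝕋ⁿ`. -/
def transportOp {n : ℕ} (ν : Fin n → ℕ) (V : TorusField n) (ε t : ℝ) (u : Distr n) : Distr n :=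
  (∑ j, ((ν j : ℂ) • partialDistr j u + (ε : ℂ) • mulDistr (V.component t j) (partialDistr j u)))
    + ((ε : ℂ) / 2) • mulDistr (V.div t) u

/-- `∂ₜ u = w` in `𝒟'(𝕋ⁿ)`: the derivative is taken after pairing with any test function. -/
def HasTimeDeriv {n : ℕ} (u w : ℝ → Distr n) : Prop :=
  ∀ (φ : TestFn n) (t : ℝ),
    HasDerivAt (fun s => (u s : TestFn n →ₗ[ℂ] ℂ) φ) ((w t : TestFn n →ₗ[ℂ] ℂ) φ) t

/-- The `j`-th Fourier coefficient in `x` of a symbol `a(x, ξ)` that is `2πℤⁿ`-periodic in `x`. -/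
def symbolFourier {n : ℕ} (a : (Fin n → ℝ) → (Fin n → ℝ) → ℂ) (j : Fin n → ℤ) (ξ : Fin n → ℝ) :
    ℂ :=
  ((2 * Real.pi : ℝ) ^ n : ℂ)⁻¹ *
    ∫ x in Set.Icc (0 : Fin n → ℝ) (fun _ => 2 * Real.pi),
      a x ξ * Complex.exp (-(Complex.I * ∑ l, (j l : ℂ) * (x l : ℂ)))

/-- `w = Op^w(a) u` on `𝕋ⁿ`. The Weyl quantization
`(2π)⁻ⁿ ∬ e^{i(x-y)·ξ} a((x+y)/2, ξ) u(y) dy dξ` of a symbol that is periodic in `x` maps `e_k` to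
`∑ₘ â(m - k, (m + k)/2) e_m`, so `w` is the distribution with
`ŵ(m) = ∑ₖ â(m - k, (m + k)/2) û(k)`. -/
def IsWeylOp {n : ℕ} (a : (Fin n → ℝ) → (Fin n → ℝ) → ℂ) (u w : Distr n) : Prop :=
  ∀ m : Fin n → ℤ,
    HasSum (fun k : Fin n → ℤ =>
      symbolFourier a (m - k) (fun l => ((m l : ℝ) + (k l : ℝ)) / 2) * fourierDistr u k)
      (fourierDistr w m)

/-- The symbol `i ξ·Y(x)` of a vector field `Y`. -/
def fieldSymbol {n : ℕ} (Y : (Fin n → ℝ) → (Fin n → ℝ)) (x ξ : Fin n → ℝ) : ℂ :=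
  Complex.I * ((∑ j, ξ j * Y x j : ℝ) : ℂ)

/-- `u` solves `∂ₜu = (ν + ε V(t,x))·∇u + (ε/2) div(V(t,x)) u` on `ℝ × 𝕋ⁿ`. -/
def IsTransportSolution {n : ℕ} (ν : Fin n → ℕ) (V : TorusField n) (ε : ℝ) (u : ℝ → Distr n) :
    Prop :=
  HasTimeDeriv u fun t => transportOp ν V ε t (u t)

/-- `v` solves `∂ₜv = Op^w(i ξ·(ε ⟨V⟩_ν(x) + ε² W(t,x))) v` on `ℝ × 𝕋ⁿ`. -/
def IsNormalFormSolution {n : ℕ} (ν : Fin n → ℕ) (V W : TorusField n) (ε : ℝ)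
    (v : ℝ → Distr n) : Prop :=
  ∃ w : ℝ → Distr n,
    (∀ t, IsWeylOp
      (fieldSymbol fun x => ε • resonantAverage ν V x + ε ^ 2 • W.toFun (t, x)) (v t) (w t)) ∧
    HasTimeDeriv v w

end TorusTransport

end

/-!
# Averaging of a transport equation on the torus

In the frame moving with the constant field `ν` the equation is driven by `ε V(t, x - tν)`, whose
time mean is `ε ⟨V⟩_ν`. The defect `⟨V⟩_ν - V(t, x - tν)` has a periodic primitive `g` in time
(`corrector`), and the diffeomorphisms `χ_t(y) = y - tν + ε g(t, y)` (`nearIdFlow`) remove it to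
first order: there is a field `Y = ε ⟨V⟩_ν + ε² W` with `Dχ Y = ∂ₜχ + (ν + ε V)(t, χ)`
(`conjugates_nearIdFlow`), where `W` is obtained by inverting `1 + ε Dg` and dividing the
difference `V(t, y - tν + ε g) - V(t, y - tν)` by `ε` (`hadamard`).

A diffeomorphism `χ` with Jacobian `J` acts on test functions by the half-density action
`A φ = J^{1/2} φ ∘ χ` (`TorusDiffeo.pull`), and `Φ` is the transpose of `A` on distributions. The
operators `b·∇ + ½ div b` are those of the infinitesimal half-density action, so `Φ` conjugates the
equation of `b = ν + ε V` to the one of `Y` (`TorusFlow.Conjugates.hasTimeDeriv`). The pointwise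
identity behind this is Liouville's formula for `∂ₜJ` (`TorusFlow.Conjugates.liouville`). It is
transferred to curves of distributions that are only weakly differentiable by a product rule
(`hasDerivAt_pairing`), which rests on the uniform boundedness principle in `C^∞`
(`distr_uniform_bound`). Comparing Fourier coefficients shows that `Y·∇ + ½ div Y` is the Weyl
quantization of `i ξ·Y` (`isWeylOp_fieldOp`).

For the Sobolev bounds, `A` is unitary on `L²` and commutes with derivatives up to coefficients
that are bounded uniformly in `ε` and `t`, which gives `H^N` for integers `N` by induction
(`dom_hsq_pull`, `dom_hsq_pull_symm`). Truncation of Fourier series extends this to distributions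
(`sobolevSq_le_of_hsq_le`), and real interpolation between `L²` and `H^N` gives `H^σ` with a
constant that depends on `⌈σ⌉` only (`sobolevSq_interpolate`).

Every uniform bound comes from compactness of the torus and of the parameter range. To have
families that are smooth in all variables, `ε` is replaced by a cutoff `η(ε)` that equals `ε` on
`[0, ε₀]` and is so small that `y ↦ y + η(ε) g(t, y)` stays a perturbation of the identity.
-/

noncomputable section

namespace TorusTransport

open MeasureTheory Set Filter Topology
open scoped NNReal Pointwise

/-! ### Integration over the torus -/

/-- The closed cube `[0, 2π]ⁿ`, over which periodic functions are integrated. -/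
abbrev cube (n : ℕ) : Set (Fin n → ℝ) := Icc (0 : Fin n → ℝ) (fun _ => 2 * Real.pi)

/-- The basis `2π eⱼ` of `ℝⁿ`, spanning the period lattice. -/
def periodBasis (n : ℕ) : Module.Basis (Fin n) ℝ (Fin n → ℝ) :=
  (Pi.basisFun ℝ (Fin n)).isUnitSMul (w := fun _ => 2 * Real.pi)
    fun _ => (isUnit_iff_ne_zero.mpr (by positivity))

theorem periodBasis_apply {n : ℕ} (j : Fin n) :
    periodBasis n j = (2 * Real.pi) • Pi.single j (1 : ℝ) := by
  simp [periodBasis, Module.Basis.isUnitSMul_apply]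

theorem sum_smul_periodBasis {n : ℕ} (k : Fin n → ℤ) :
    ∑ j, k j • periodBasis n j = shift 0 k := by
  funext i
  simp [periodBasis_apply, shift, Finset.sum_apply, Pi.single_apply, mul_comm]

/-- The period lattice `2πℤⁿ`. -/
abbrev periodLattice (n : ℕ) : AddSubgroup (Fin n → ℝ) :=
  (Submodule.span ℤ (range (periodBasis n))).toAddSubgroup

theorem exists_of_mem_periodLattice {n : ℕ} {g : Fin n → ℝ} (hg : g ∈ periodLattice n) :
    ∃ k : Fin n → ℤ, g = shift 0 k := by
  obtain ⟨k, hk⟩ := (Submodule.mem_span_range_iff_exists_fun ℤ).mp hg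
  exact ⟨k, by rw [← hk, sum_smul_periodBasis]⟩

theorem fundamentalDomain_ae_eq_cube (n : ℕ) :
    ZSpan.fundamentalDomain (periodBasis n) =ᵐ[volume] cube n := by
  have h : ZSpan.fundamentalDomain (periodBasis n)
      = Set.pi univ fun _ : Fin n => Ico (0 : ℝ) (2 * Real.pi) := by
    ext x
    have hr : ∀ i, (periodBasis n).repr x i = (2 * Real.pi)⁻¹ * x i := fun i => by
      rw [periodBasis, Module.Basis.repr_isUnitSMul]
      simp [Units.smul_def]
    simp only [ZSpan.mem_fundamentalDomain, hr, Set.mem_pi, mem_univ, true_implies, mem_Ico]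
    refine forall_congr' fun i => ?_
    have hp : (0 : ℝ) < 2 * Real.pi := by positivity
    rw [inv_mul_lt_iff₀ hp, mul_one]
    refine and_congr_left' ⟨fun h => ?_, fun h => by positivity⟩
    have h2 := mul_nonneg hp.le h
    rwa [mul_inv_cancel_left₀ hp.ne'] at h2
  rw [h]
  exact Measure.univ_pi_Ico_ae_eq_Icc (μ := fun _ : Fin n => (volume : Measure ℝ))
    (f := 0) (g := fun _ => 2 * Real.pi)

/-- A smooth diffeomorphism of `ℝⁿ` commuting with the translations of the period lattice, with
positive Jacobian: the lift of an orientation preserving diffeomorphism of the torus. -/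
structure TorusDiffeo (n : ℕ) where
  toFun : (Fin n → ℝ) → (Fin n → ℝ)
  invFun : (Fin n → ℝ) → (Fin n → ℝ)
  smooth : ContDiff ℝ ∞ toFun
  smooth_inv : ContDiff ℝ ∞ invFun
  left_inv : Function.LeftInverse invFun toFun
  right_inv : Function.RightInverse invFun toFun
  map_shift : ∀ k x, toFun (shift x k) = shift (toFun x) k
  det_pos : ∀ x, 0 < (fderiv ℝ toFun x).det

theorem TorusDiffeo.inv_shift {n : ℕ} (χ : TorusDiffeo n) (k : Fin n → ℤ) (x : Fin n → ℝ) :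
    χ.invFun (shift x k) = shift (χ.invFun x) k := by
  apply χ.left_inv.injective
  rw [χ.right_inv, χ.map_shift, χ.right_inv]

/-- Change of variables on the torus: a diffeomorphism maps a fundamental domain of the period
lattice to a fundamental domain. -/
theorem TorusDiffeo.integral_comp {n : ℕ} (χ : TorusDiffeo n) (f : (Fin n → ℝ) → ℂ)
    (hf : ∀ (k : Fin n → ℤ) x, f (shift x k) = f x) :
    ∫ x in cube n, ((fderiv ℝ χ.toFun x).det : ℂ) * f (χ.toFun x) = ∫ x in cube n, f x := by
  have hfd := ZSpan.isAddFundamentalDomain' (periodBasis n) volume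
  set D := ZSpan.fundamentalDomain (periodBasis n) with hD
  let e : (Fin n → ℝ) ≃ (Fin n → ℝ) := ⟨χ.toFun, χ.invFun, χ.left_inv, χ.right_inv⟩
  have hq : Measure.QuasiMeasurePreserving e.symm (volume : Measure (Fin n → ℝ)) volume := by
    refine ⟨χ.smooth_inv.continuous.measurable, ?_⟩
    refine Measure.AbsolutelyContinuous.mk fun s hs h0 => ?_
    have hm : Measurable e.symm := χ.smooth_inv.continuous.measurable
    rw [Measure.map_apply hm hs]
    have : (e.symm ⁻¹' s) = χ.toFun '' s := (e.image_eq_preimage_symm s).symm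
    rw [this]
    exact addHaar_image_eq_zero_of_differentiableOn_of_addHaar_eq_zero _
      (χ.smooth.differentiable (by simp)).differentiableOn h0
  have himg : IsAddFundamentalDomain (periodLattice n) (χ.toFun '' D) volume := by
    refine hfd.image_of_equiv e hq (Equiv.refl _) fun g x => ?_
    obtain ⟨k, hk⟩ := exists_of_mem_periodLattice g.2
    change χ.toFun (g.1 + x) = g.1 + χ.toFun x
    rw [hk, add_comm, ← shift_eq, χ.map_shift, shift_eq, add_comm]
  have hinv : ∀ (g : periodLattice n) (x : Fin n → ℝ), f (g +ᵥ x) = f x := fun g x => by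
    obtain ⟨k, hk⟩ := exists_of_mem_periodLattice g.2
    change f (g.1 + x) = f x
    rw [hk, add_comm, ← shift_eq, hf]
  have : Countable (periodLattice n) :=
    inferInstanceAs (Countable (Submodule.span ℤ (range (periodBasis n))))
  have h1 := hfd.setIntegral_eq himg hinv
  have h2 := integral_image_eq_integral_abs_det_fderiv_smul volume
    (ZSpan.fundamentalDomain_measurableSet (periodBasis n))
    (f' := fderiv ℝ χ.toFun) (f := χ.toFun)
    (fun x _ => ((χ.smooth.differentiable (by simp)) x).hasFDerivAt.hasFDerivWithinAt)
    (χ.left_inv.injective.injOn) f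
  rw [← setIntegral_congr_set (fundamentalDomain_ae_eq_cube n),
    ← setIntegral_congr_set (fundamentalDomain_ae_eq_cube n), ← hD, h1, h2]
  refine integral_congr_ae (Filter.Eventually.of_forall fun x => ?_)
  simp only [abs_of_pos (χ.det_pos x)]
  rw [Complex.real_smul]

/-- Translations of the torus. -/
def TorusDiffeo.translate {n : ℕ} (a : Fin n → ℝ) : TorusDiffeo n where
  toFun x := x + a
  invFun x := x - a
  smooth := contDiff_id.add contDiff_const
  smooth_inv := contDiff_id.sub contDiff_const
  left_inv x := by simp
  right_inv x := by simp
  map_shift k x := by rw [shift_eq, shift_eq (x + a)]; abel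
  det_pos x := by
    have : fderiv ℝ (fun x : Fin n → ℝ => x + a) x = ContinuousLinearMap.id ℝ _ := by
      rw [fderiv_add_const, fderiv_fun_id]
    rw [this]; simp [ContinuousLinearMap.det]

theorem integral_cube_translate {n : ℕ} (a : Fin n → ℝ) (f : (Fin n → ℝ) → ℂ)
    (hf : ∀ (k : Fin n → ℤ) x, f (shift x k) = f x) :
    ∫ x in cube n, f (x + a) = ∫ x in cube n, f x := by
  rw [← (TorusDiffeo.translate a).integral_comp f hf]
  have : ∀ x, fderiv ℝ (fun x : Fin n → ℝ => x + a) x = ContinuousLinearMap.id ℝ _ := fun x => by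
    rw [fderiv_add_const, fderiv_fun_id]
  simp [TorusDiffeo.translate, this, ContinuousLinearMap.det]

theorem testFn_continuous {n : ℕ} (φ : TestFn n) : Continuous φ.1 := φ.2.1.continuous

theorem testFn_integrableOn {n : ℕ} (φ : TestFn n) : IntegrableOn φ.1 (cube n) :=
  (testFn_continuous φ).continuousOn.integrableOn_compact isCompact_Icc

/-- The integral of a smooth function over the torus. -/
def torusIntegral {n : ℕ} : TestFn n →ₗ[ℂ] ℂ where
  toFun φ := ∫ x in cube n, φ.1 x
  map_add' φ ψ := integral_add (testFn_integrableOn φ) (testFn_integrableOn ψ)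
  map_smul' c _ := integral_const_mul c _

theorem torusIntegral_apply {n : ℕ} (φ : TestFn n) : torusIntegral φ = ∫ x in cube n, φ.1 x := rfl

theorem volume_cube (n : ℕ) : volume (cube n) = ENNReal.ofReal ((2 * Real.pi) ^ n) := by
  rw [Real.volume_Icc_pi]
  simp [ENNReal.ofReal_pow, Real.pi_pos.le]

theorem norm_torusIntegral_le {n : ℕ} (φ : TestFn n) {B : ℝ} (h : ∀ x, ‖φ.1 x‖ ≤ B) :
    ‖torusIntegral φ‖ ≤ (2 * Real.pi) ^ n * B := by
  have := norm_setIntegral_le_of_norm_le_const (μ := volume) (s := cube n)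
    (f := φ.1) (C := B) (by rw [volume_cube]; exact ENNReal.ofReal_lt_top)
    (fun x _ => h x)
  rw [measureReal_def, volume_cube, ENNReal.toReal_ofReal (by positivity)] at this
  rw [torusIntegral_apply, mul_comm]
  exact this

theorem hasDerivAt_line {n : ℕ} (φ : TestFn n) (j : Fin n) (x : Fin n → ℝ) (s : ℝ) :
    HasDerivAt (fun s : ℝ => φ.1 (x + s • Pi.single j (1 : ℝ)))
      ((partialFn j φ).1 (x + s • Pi.single j (1 : ℝ))) s := by
  have h1 := (φ.2.1.differentiable (by simp) (x + s • Pi.single j (1 : ℝ))).hasFDerivAt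
  have h2 : HasDerivAt (fun s : ℝ => x + s • Pi.single j (1 : ℝ)) (Pi.single j (1 : ℝ)) s := by
    simpa using ((hasDerivAt_id s).smul_const (Pi.single j (1 : ℝ) : Fin n → ℝ)).const_add x
  exact h1.comp_hasDerivAt s h2

theorem exists_sup_bound {n : ℕ} (φ : TestFn n) : ∃ A : ℝ, ∀ x, ‖φ.1 x‖ ≤ A := by
  obtain ⟨A, hA⟩ := exists_deriv_bound φ 0
  exact ⟨A, fun x => by simpa using hA x⟩

theorem torusIntegral_partialFn {n : ℕ} (j : Fin n) (φ : TestFn n) :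
    torusIntegral (partialFn j φ) = 0 := by
  obtain ⟨A, hA⟩ := exists_sup_bound (partialFn j φ)
  have hc : ∀ ψ : TestFn n, ∀ s : ℝ,
      Continuous fun x => ψ.1 (x + s • Pi.single j (1 : ℝ)) := fun ψ s =>
    (testFn_continuous ψ).comp (continuous_id.add continuous_const)
  have hint : Integrable (fun _ : Fin n → ℝ => A) (volume.restrict (cube n)) := by
    have : volume (cube n) ≠ ⊤ := by rw [volume_cube]; exact ENNReal.ofReal_ne_top
    exact integrableOn_const this
  have hb : ∀ᵐ x ∂(volume.restrict (cube n)), ∀ s ∈ (univ : Set ℝ),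
      ‖(partialFn j φ).1 (x + s • Pi.single j (1 : ℝ))‖ ≤ A :=
    Filter.Eventually.of_forall fun x s _ => hA _
  have hd : ∀ᵐ x ∂(volume.restrict (cube n)), ∀ s ∈ (univ : Set ℝ),
      HasDerivAt (fun s : ℝ => φ.1 (x + s • Pi.single j (1 : ℝ)))
        ((partialFn j φ).1 (x + s • Pi.single j (1 : ℝ))) s :=
    Filter.Eventually.of_forall fun x s _ => hasDerivAt_line φ j x s
  have hi : Integrable (fun x => φ.1 (x + (0 : ℝ) • Pi.single j (1 : ℝ)))
      (volume.restrict (cube n)) :=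
    (hc φ 0).continuousOn.integrableOn_compact isCompact_Icc
  have h : HasDerivAt (fun s : ℝ => ∫ x in cube n, φ.1 (x + s • Pi.single j (1 : ℝ)))
      (∫ x in cube n, (partialFn j φ).1 (x + (0 : ℝ) • Pi.single j (1 : ℝ))) 0 :=
    (hasDerivAt_integral_of_dominated_loc_of_deriv_le Filter.univ_mem
      (Filter.Eventually.of_forall fun s => (hc φ s).aestronglyMeasurable) hi
      (hc (partialFn j φ) 0).aestronglyMeasurable hb hint hd).2
  have hconst : (fun s : ℝ => ∫ x in cube n, φ.1 (x + s • Pi.single j (1 : ℝ)))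
      = fun _ => ∫ x in cube n, φ.1 x :=
    funext fun s => integral_cube_translate _ _ φ.2.2
  rw [hconst, integral_cube_translate _ _ (partialFn j φ).2.2] at h
  have h0 := h.unique (hasDerivAt_const (0 : ℝ) (∫ x in cube n, φ.1 x))
  rw [torusIntegral_apply, h0]

/-! ### Fourier coefficients -/

/-- The `k`-th Fourier coefficient of a smooth function on the torus. -/
def coeff {n : ℕ} (k : Fin n → ℤ) : TestFn n →ₗ[ℂ] ℂ :=
  (((2 * Real.pi : ℝ) ^ n : ℂ)⁻¹ • torusIntegral) ∘ₗ LinearMap.mulLeft ℂ (character (-k))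

theorem coeff_apply {n : ℕ} (k : Fin n → ℤ) (φ : TestFn n) :
    coeff k φ = ((2 * Real.pi : ℝ) ^ n : ℂ)⁻¹ * torusIntegral (character (-k) * φ) := rfl

theorem two_pi_pow_ne_zero (n : ℕ) : ((2 * Real.pi : ℝ) ^ n : ℂ) ≠ 0 := by
  have := Real.pi_ne_zero
  exact_mod_cast pow_ne_zero n (mul_ne_zero two_ne_zero this)

theorem character_apply {n : ℕ} (k : Fin n → ℤ) (x : Fin n → ℝ) :
    (character k).1 x = Complex.exp (Complex.I * ∑ j, (k j : ℂ) * (x j : ℂ)) := rfl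

theorem norm_character {n : ℕ} (k : Fin n → ℤ) (x : Fin n → ℝ) : ‖(character k).1 x‖ = 1 := by
  have : Complex.I * ∑ j, (k j : ℂ) * (x j : ℂ) = ((∑ j, (k j : ℝ) * x j : ℝ) : ℂ) * Complex.I := by
    push_cast; ring
  rw [character_apply, this, Complex.norm_exp_ofReal_mul_I]

theorem character_add {n : ℕ} (k l : Fin n → ℤ) :
    character (k + l) = character k * character l := by
  apply Subtype.ext
  funext x
  change Complex.exp _ = Complex.exp _ * Complex.exp _
  rw [← Complex.exp_add, ← mul_add, ← Finset.sum_add_distrib]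
  simp [add_mul]

theorem character_zero {n : ℕ} : character (0 : Fin n → ℤ) = 1 := by
  apply Subtype.ext
  funext x
  change Complex.exp _ = 1
  simp

theorem partialFn_apply {n : ℕ} (j : Fin n) (φ : TestFn n) (x : Fin n → ℝ) :
    (partialFn j φ).1 x = fderiv ℝ φ.1 x (Pi.single j 1) := rfl

theorem partialFn_mul {n : ℕ} (j : Fin n) (a φ : TestFn n) :
    partialFn j (a * φ) = partialFn j a * φ + a * partialFn j φ := by
  apply Subtype.ext
  funext x
  have ha := a.2.1.differentiable (by simp) x
  have hφ := φ.2.1.differentiable (by simp) x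
  change fderiv ℝ (a.1 * φ.1) x (Pi.single j 1) = fderiv ℝ a.1 x (Pi.single j 1) * φ.1 x +
    a.1 x * fderiv ℝ φ.1 x (Pi.single j 1)
  rw [fderiv_mul ha hφ]
  simp only [_root_.add_apply, _root_.smul_apply, smul_eq_mul]
  ring

/-- The linear form `x ↦ i k·x`. -/
def characterForm {n : ℕ} (k : Fin n → ℤ) : (Fin n → ℝ) →L[ℝ] ℂ :=
  ∑ j, (Complex.I * (k j : ℂ)) •
    (Complex.ofRealCLM.comp (ContinuousLinearMap.proj (R := ℝ) (φ := fun _ : Fin n => ℝ) j))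

theorem characterForm_apply {n : ℕ} (k : Fin n → ℤ) (x : Fin n → ℝ) :
    characterForm k x = Complex.I * ∑ j, (k j : ℂ) * (x j : ℂ) := by
  simp [characterForm, Finset.mul_sum, mul_assoc]

theorem fderiv_character {n : ℕ} (k : Fin n → ℤ) (x : Fin n → ℝ) :
    fderiv ℝ (character k).1 x = (character k).1 x • characterForm k := by
  have h : (character k).1 = fun x => Complex.exp (characterForm k x) := by
    funext x; rw [characterForm_apply]; rfl
  rw [h]
  exact ((characterForm k).hasFDerivAt.cexp).fderiv

theorem partialFn_character {n : ℕ} (j : Fin n) (k : Fin n → ℤ) :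
    partialFn j (character k) = (Complex.I * (k j : ℂ)) • character k := by
  apply Subtype.ext
  funext x
  change fderiv ℝ (character k).1 x (Pi.single j 1) = (Complex.I * (k j : ℂ)) * (character k).1 x
  rw [fderiv_character, smul_apply, characterForm_apply, smul_eq_mul, mul_comm]
  congr 2
  rw [Finset.sum_eq_single j] <;> simp +contextual

theorem coeff_partialFn {n : ℕ} (k : Fin n → ℤ) (j : Fin n) (φ : TestFn n) :
    coeff k (partialFn j φ) = Complex.I * (k j : ℂ) * coeff k φ := by
  have h := torusIntegral_partialFn j (character (-k) * φ)
  rw [partialFn_mul, map_add, partialFn_character, smul_mul_assoc, map_smul, smul_eq_mul] at h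
  simp only [coeff_apply]
  rw [eq_neg_of_add_eq_zero_right h]
  simp
  ring

theorem norm_coeff_le {n : ℕ} (k : Fin n → ℤ) (φ : TestFn n) {B : ℝ} (h : ∀ x, ‖φ.1 x‖ ≤ B) :
    ‖coeff k φ‖ ≤ B := by
  have h1 := norm_torusIntegral_le (character (-k) * φ) (B := B) fun x => by
    change ‖(character (-k)).1 x * φ.1 x‖ ≤ B
    rw [norm_mul, norm_character, one_mul]; exact h x
  have h2 : (0 : ℝ) < (2 * Real.pi) ^ n := by positivity
  rw [coeff_apply, norm_mul, norm_inv]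
  have h3 : ‖((2 * Real.pi : ℝ) ^ n : ℂ)‖ = (2 * Real.pi) ^ n := by
    rw [norm_pow]; simp [abs_of_pos Real.pi_pos]
  rw [h3, inv_mul_le_iff₀ h2]
  exact h1

/-- The weight `1 + |k|²`. -/
def weight {n : ℕ} (k : Fin n → ℤ) : ℝ := 1 + ∑ j, (k j : ℝ) ^ 2

theorem one_le_weight {n : ℕ} (k : Fin n → ℤ) : 1 ≤ weight k :=
  le_add_of_nonneg_right (Finset.sum_nonneg fun _ _ => sq_nonneg _)

theorem weight_pos {n : ℕ} (k : Fin n → ℤ) : 0 < weight k := one_pos.trans_le (one_le_weight k)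

/-- `1 - Δ` on smooth functions. -/
def bessel {n : ℕ} : TestFn n →ₗ[ℂ] TestFn n :=
  LinearMap.id - ∑ j, partialFn j ∘ₗ partialFn j

theorem coeff_bessel {n : ℕ} (k : Fin n → ℤ) (φ : TestFn n) :
    coeff k (bessel φ) = (weight k : ℂ) * coeff k φ := by
  simp only [bessel, LinearMap.sub_apply, LinearMap.id_apply, LinearMap.sum_apply,
    LinearMap.comp_apply, map_sub, map_sum, coeff_partialFn, weight]
  push_cast
  rw [add_mul, one_mul, sub_eq_add_neg, ← Finset.sum_neg_distrib, Finset.sum_mul]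
  congr 1
  refine Finset.sum_congr rfl fun j _ => ?_
  linear_combination (-(k j : ℂ) ^ 2 * coeff k φ) * Complex.I_sq

/-- `φ` is bounded by `B` in the norm of `C^N`. -/
def NormLE {n : ℕ} (N : ℕ) (φ : TestFn n) (B : ℝ) : Prop :=
  ∀ i ≤ N, ∀ x, ‖iteratedFDeriv ℝ i φ.1 x‖ ≤ B

theorem exists_normLE {n : ℕ} (N : ℕ) (φ : TestFn n) : ∃ B, 0 ≤ B ∧ NormLE N φ B := by
  choose D hD using exists_deriv_bound φ
  have hD0 : ∀ i, 0 ≤ D i := fun i => (norm_nonneg _).trans (hD i 0)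
  refine ⟨∑ i ∈ Finset.range (N + 1), D i, Finset.sum_nonneg fun i _ => hD0 i,
    fun i hi x => (hD i x).trans ?_⟩
  exact Finset.single_le_sum (fun i _ => hD0 i) (Finset.mem_range.mpr (by omega))

theorem NormLE.nonneg {n N : ℕ} {φ : TestFn n} {B : ℝ} (h : NormLE N φ B) : 0 ≤ B :=
  (norm_nonneg _).trans (h 0 (Nat.zero_le _) 0)

theorem NormLE.mono {n N N' : ℕ} {φ : TestFn n} {B B' : ℝ} (h : NormLE N φ B) (hN : N' ≤ N)
    (hB : B ≤ B') : NormLE N' φ B' := fun i hi x => (h i (hi.trans hN) x).trans hB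

theorem NormLE.sup {n N : ℕ} {φ : TestFn n} {B : ℝ} (h : NormLE N φ B) (x : Fin n → ℝ) :
    ‖φ.1 x‖ ≤ B := by simpa using h 0 (Nat.zero_le _) x

theorem NormLE.zero {n N : ℕ} : NormLE N (0 : TestFn n) 0 := fun i _ x => by
  change ‖iteratedFDeriv ℝ i (0 : (Fin n → ℝ) → ℂ) x‖ ≤ 0
  simp

theorem NormLE.add {n N : ℕ} {φ ψ : TestFn n} {B B' : ℝ} (h : NormLE N φ B) (h' : NormLE N ψ B') :
    NormLE N (φ + ψ) (B + B') := fun i hi x => by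
  have := iteratedFDeriv_add (φ.2.1.of_le (m := i) (by exact_mod_cast le_top))
    (ψ.2.1.of_le (m := i) (by exact_mod_cast le_top))
  change ‖iteratedFDeriv ℝ i (φ.1 + ψ.1) x‖ ≤ B + B'
  rw [this]
  exact (norm_add_le _ _).trans (add_le_add (h i hi x) (h' i hi x))

theorem NormLE.smul {n N : ℕ} {φ : TestFn n} {B : ℝ} (h : NormLE N φ B) (c : ℂ) :
    NormLE N (c • φ) (‖c‖ * B) := fun i hi x => by
  change ‖iteratedFDeriv ℝ i (c • φ.1) x‖ ≤ _
  rw [iteratedFDeriv_const_smul_apply (φ.2.1.contDiffAt.of_le (by exact_mod_cast le_top)),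
    norm_smul]
  exact mul_le_mul_of_nonneg_left (h i hi x) (norm_nonneg _)

theorem NormLE.sum {n N : ℕ} {ι : Type*} {φ : ι → TestFn n} {B : ι → ℝ} (s : Finset ι)
    (h : ∀ i ∈ s, NormLE N (φ i) (B i)) : NormLE N (∑ i ∈ s, φ i) (∑ i ∈ s, B i) := by
  classical
  induction s using Finset.induction_on with
  | empty => simpa using NormLE.zero
  | insert a s ha ih =>
    rw [Finset.sum_insert ha, Finset.sum_insert ha]
    exact (h a (Finset.mem_insert_self _ _)).add
      (ih fun i hi => h i (Finset.mem_insert_of_mem hi))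

theorem NormLE.partialFn {n N : ℕ} {φ : TestFn n} {B : ℝ} (h : NormLE (N + 1) φ B) (j : Fin n) :
    NormLE N (partialFn j φ) B :=
  fun i hi x => (partialFn_bound j φ i x).trans (h (i + 1) (by omega) x)

theorem NormLE.bessel {n N : ℕ} {φ : TestFn n} {B : ℝ} (h : NormLE (N + 2) φ B) :
    NormLE N (bessel φ) ((1 + n) * B) := by
  have h1 : NormLE N (∑ j : Fin n, TorusTransport.partialFn j (TorusTransport.partialFn j φ))
      (∑ _j : Fin n, B) := NormLE.sum _ fun j _ => (h.partialFn j).partialFn j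
  have h2 := (h.mono (Nat.le_add_right N 2) le_rfl).add (h1.smul (-1))
  have h3 : TorusTransport.bessel φ
      = φ + (-1 : ℂ) • ∑ j : Fin n, TorusTransport.partialFn j (TorusTransport.partialFn j φ) := by
    simp [TorusTransport.bessel, sub_eq_add_neg]
  rw [h3]
  refine h2.mono le_rfl (le_of_eq ?_)
  simp
  ring

/-- Fourier coefficients decay faster than any power. -/
theorem norm_coeff_le_weight {n : ℕ} (N : ℕ) (φ : TestFn n) {B : ℝ} (h : NormLE (2 * N) φ B)
    (k : Fin n → ℤ) : ‖coeff k φ‖ ≤ (1 + n) ^ N * B * (weight k ^ N)⁻¹ := by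
  induction N generalizing φ B with
  | zero => simpa using norm_coeff_le k φ h.sup
  | succ N ih =>
    have h1 := ih (bessel φ) (NormLE.bessel (N := 2 * N) (by simpa [mul_add] using h))
    rw [coeff_bessel, norm_mul, Complex.norm_real, Real.norm_of_nonneg (weight_pos k).le] at h1
    have h2 := weight_pos k
    rw [← le_div_iff₀' h2] at h1
    refine h1.trans (le_of_eq ?_)
    rw [pow_succ (weight k), mul_inv, pow_succ]
    ring

/-! ### Fourier inversion -/

theorem summable_pi_prod {f : ℤ → ℝ} (hf : Summable f) (h0 : ∀ m, 0 ≤ f m) (n : ℕ) :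
    Summable fun k : Fin n → ℤ => ∏ j, f (k j) := by
  induction n with
  | zero => exact (hasSum_fintype _).summable
  | succ n ih =>
    rw [← (Fin.consEquiv fun _ : Fin (n + 1) => ℤ).summable_iff]
    refine (hf.mul_of_nonneg ih h0 fun k => Finset.prod_nonneg fun j _ => h0 _).congr fun p => ?_
    simp [Fin.prod_univ_succ, Fin.consEquiv]

theorem summable_inv_weight (n : ℕ) : Summable fun k : Fin n → ℤ => (weight k ^ n)⁻¹ := by
  have h1 : Summable fun m : ℤ => (1 + (m : ℝ) ^ 2)⁻¹ := by
    have h2 : Summable fun m : ℤ => 1 / (m : ℝ) ^ 2 :=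
      Real.summable_one_div_int_pow.mpr one_lt_two
    refine Summable.of_norm_bounded_eventually h2 ?_
    filter_upwards [(Set.finite_singleton (0 : ℤ)).compl_mem_cofinite] with m hm
    have hm0 : (0 : ℝ) < (m : ℝ) ^ 2 := by
      have : (m : ℝ) ≠ 0 := by exact_mod_cast hm
      positivity
    rw [Real.norm_of_nonneg (by positivity), one_div]
    exact inv_anti₀ hm0 (by linarith)
  refine Summable.of_nonneg_of_le (fun k => by have := weight_pos k; positivity) (fun k => ?_)
    (summable_pi_prod h1 (fun m => by positivity) n)
  rw [Finset.prod_inv_distrib]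
  refine inv_anti₀ (Finset.prod_pos fun j _ => by positivity) ?_
  calc ∏ j, (1 + (k j : ℝ) ^ 2) ≤ ∏ _j : Fin n, weight k :=
        Finset.prod_le_prod (fun j _ => by positivity) fun j _ => by
          have := Finset.single_le_sum (f := fun j => (k j : ℝ) ^ 2) (fun i _ => sq_nonneg _)
            (Finset.mem_univ j)
          simpa [weight] using this
    _ = weight k ^ n := by simp

theorem coeff_character {n : ℕ} (k l : Fin n → ℤ) :
    coeff k (character l) = if k = l then 1 else 0 := by
  split_ifs with h
  · subst h
    have h1 : torusIntegral (1 : TestFn n) = ((2 * Real.pi : ℝ) ^ n : ℂ) := by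
      change ∫ x in cube n, (1 : ℂ) = _
      rw [setIntegral_const, measureReal_def, volume_cube, ENNReal.toReal_ofReal (by positivity)]
      simp
    rw [coeff_apply, ← character_add, neg_add_cancel, character_zero, h1,
      inv_mul_cancel₀ (two_pi_pow_ne_zero n)]
  · obtain ⟨j, hj⟩ := Function.ne_iff.mp h
    have h1 := coeff_partialFn k j (character l)
    rw [partialFn_character, map_smul, smul_eq_mul] at h1
    have h2 : Complex.I * ((l j : ℂ) - k j) * coeff k (character l) = 0 := by linear_combination h1
    have h3 : Complex.I * ((l j : ℂ) - k j) ≠ 0 :=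
      mul_ne_zero Complex.I_ne_zero (sub_ne_zero.mpr (by exact_mod_cast hj.symm))
    exact (mul_eq_zero.mp h2).resolve_left h3

theorem summable_norm_coeff {n : ℕ} (φ : TestFn n) : Summable fun k => ‖coeff k φ‖ := by
  obtain ⟨B, -, hB⟩ := exists_normLE (2 * n) φ
  exact Summable.of_nonneg_of_le (fun k => norm_nonneg _) (norm_coeff_le_weight n φ hB)
    ((summable_inv_weight n).mul_left _)

/-- The projection of `ℝⁿ` to the torus `(ℝ/ℤ)ⁿ`. -/
def torusProj {n : ℕ} (x : Fin n → ℝ) : UnitAddTorus (Fin n) := fun i => (x i : UnitAddCircle)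

theorem torusProj_isQuotientMap (n : ℕ) : IsQuotientMap (torusProj (n := n)) := by
  have h : IsOpenQuotientMap (Pi.map fun (_ : Fin n) (x : ℝ) => (x : UnitAddCircle)) :=
    IsOpenQuotientMap.piMap fun _ => QuotientAddGroup.isOpenQuotientMap_mk
  exact h.isQuotientMap

theorem exists_lift {n : ℕ} (φ : TestFn n) :
    ∃ F : C(UnitAddTorus (Fin n), ℂ), ∀ x, F (torusProj x) = φ.1 ((2 * Real.pi) • x) := by
  have hper : ∀ x y : Fin n → ℝ, torusProj x = torusProj y →
      φ.1 ((2 * Real.pi) • x) = φ.1 ((2 * Real.pi) • y) := fun x y h => by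
    have : ∀ i, ∃ m : ℤ, x i = y i + m := fun i => by
      have hi : (x i : UnitAddCircle) = (y i : UnitAddCircle) := congrFun h i
      obtain ⟨m, hm⟩ := AddSubgroup.mem_zmultiples_iff.mp (QuotientAddGroup.eq.mp hi)
      rw [zsmul_eq_mul, mul_one] at hm
      exact ⟨-m, by push_cast; linarith⟩
    choose m hm using this
    have h2 : (2 * Real.pi) • x = shift ((2 * Real.pi) • y) m := by
      funext i
      simp [shift, hm i, mul_add]
    rw [h2, φ.2.2]
  let f : C(Fin n → ℝ, ℂ) := ⟨fun x => φ.1 ((2 * Real.pi) • x),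
    (testFn_continuous φ).comp (continuous_const_smul _)⟩
  refine ⟨⟨Function.extend torusProj f 0, ?_⟩, ?_⟩
  · rw [(torusProj_isQuotientMap n).continuous_iff]
    have : Function.extend torusProj f 0 ∘ torusProj = f := by
      funext x
      exact Function.FactorsThrough.extend_apply (fun x y h => hper x y h) _ x
    rw [this]
    exact f.continuous
  · exact fun x => Function.FactorsThrough.extend_apply (fun x y h => hper x y h) _ x

theorem mFourier_torusProj {n : ℕ} (k : Fin n → ℤ) (x : Fin n → ℝ) :
    UnitAddTorus.mFourier k (torusProj x) = (character k).1 ((2 * Real.pi) • x) := by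
  change ∏ i, fourier (k i) (x i : UnitAddCircle) = _
  simp only [fourier_coe_apply, ← Complex.exp_sum, character_apply]
  congr 1
  rw [Finset.mul_sum]
  refine Finset.sum_congr rfl fun j _ => ?_
  simp
  ring

theorem hasSum_coeff_mul_character {n : ℕ} (φ : TestFn n) (x : Fin n → ℝ) :
    HasSum (fun k => coeff k φ * (character k).1 x) (φ.1 x) := by
  obtain ⟨F, hF⟩ := exists_lift φ
  have hp : (0 : ℝ) < 2 * Real.pi := by positivity
  have hc : ∀ k, UnitAddTorus.mFourierCoeff F k = coeff k φ := fun k => by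
    rw [UnitAddTorus.mFourierCoeff_eq_integral F k 0]
    have h1 : ∀ y : Fin n → ℝ,
        UnitAddTorus.mFourier (-k) (fun i => (y i : UnitAddCircle)) •
          F (fun i => (y i : UnitAddCircle))
        = (character (-k) * φ).1 ((2 * Real.pi) • y) := fun y => by
      have h2 : F (fun i => (y i : UnitAddCircle)) = _ := hF y
      have h3 : UnitAddTorus.mFourier (-k) (fun i => (y i : UnitAddCircle)) = _ :=
        mFourier_torusProj (-k) y
      rw [h2, h3]; rfl
    refine (integral_congr_ae (Eventually.of_forall h1)).trans ?_
    rw [Measure.setIntegral_comp_smul _ _ _ hp.ne', coeff_apply, torusIntegral_apply]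
    have h3 : ((2 * Real.pi) • {x : Fin n → ℝ | ∀ i, x i ∈ Ioc ((0 : Fin n → ℝ) i)
        ((0 : Fin n → ℝ) i + 1)}) = Set.pi univ fun _ : Fin n => Ioc (0 : ℝ) (2 * Real.pi) := by
      ext y
      rw [Set.mem_smul_set_iff_inv_smul_mem₀ hp.ne']
      simp only [Pi.zero_apply, zero_add, mem_ofPred_eq, Pi.smul_apply, smul_eq_mul, mem_Ioc,
        Set.mem_pi, mem_univ, true_implies]
      refine forall_congr' fun i => ?_
      rw [inv_mul_le_iff₀ hp, mul_one, mul_pos_iff_of_pos_left (inv_pos.mpr hp)]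
    have h4 : (Set.pi univ fun _ : Fin n => Ioc (0 : ℝ) (2 * Real.pi)) =ᵐ[volume] cube n :=
      Measure.univ_pi_Ioc_ae_eq_Icc (μ := fun _ : Fin n => (volume : Measure ℝ))
        (f := 0) (g := fun _ => 2 * Real.pi)
    rw [h3, setIntegral_congr_set h4]
    rw [abs_of_pos (by positivity), Complex.real_smul]
    simp
  have hs : Summable (UnitAddTorus.mFourierCoeff F) := by
    have : UnitAddTorus.mFourierCoeff F = fun k => coeff k φ := funext hc
    rw [this]
    exact (summable_norm_coeff φ).of_norm
  have h := UnitAddTorus.hasSum_mFourier_series_apply_of_summable hs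
    (torusProj ((2 * Real.pi)⁻¹ • x))
  simp only [hc, mFourier_torusProj, hF, smul_inv_smul₀ hp.ne', smul_eq_mul] at h
  exact h

/-! ### Fourier expansion of distributions -/

theorem norm_characterForm_le {n : ℕ} (k : Fin n → ℤ) : ‖characterForm k‖ ≤ n * weight k := by
  refine ContinuousLinearMap.opNorm_le_bound _ (by have := weight_pos k; positivity) fun x => ?_
  rw [characterForm_apply, norm_mul, Complex.norm_I, one_mul]
  calc ‖∑ j, (k j : ℂ) * (x j : ℂ)‖ ≤ ∑ _j : Fin n, weight k * ‖x‖ := by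
        refine norm_sum_le_of_le _ fun j _ => ?_
        rw [norm_mul]
        have h1 : ‖(k j : ℂ)‖ ≤ weight k := by
          have h2 := Finset.single_le_sum (f := fun j => (k j : ℝ) ^ 2) (fun i _ => sq_nonneg _)
            (Finset.mem_univ j)
          rw [Complex.norm_intCast]
          simp only [weight]
          nlinarith [sq_nonneg (|(k j : ℝ)| - 1), sq_abs (k j : ℝ), abs_nonneg (k j : ℝ)]
        have h2 : ‖(x j : ℂ)‖ ≤ ‖x‖ := by
          rw [Complex.norm_real]; exact norm_le_pi_norm x j
        exact mul_le_mul h1 h2 (norm_nonneg _) (weight_pos k).le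
    _ = n * weight k * ‖x‖ := by simp [mul_assoc]

theorem norm_iteratedFDeriv_character_le {n : ℕ} (k : Fin n → ℤ) (i : ℕ) (x : Fin n → ℝ) :
    ‖iteratedFDeriv ℝ i (character k).1 x‖ ≤ (n * weight k) ^ i := by
  induction i generalizing x with
  | zero => simpa using (norm_character k x).le
  | succ i ih =>
    rw [← norm_iteratedFDeriv_fderiv]
    have h1 : fderiv ℝ (character k).1
        = (ContinuousLinearMap.toSpanSingleton ℂ (characterForm k)).restrictScalars ℝ ∘
          (character k).1 := by
      funext x; rw [fderiv_character]; rfl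
    rw [h1]
    refine (ContinuousLinearMap.norm_iteratedFDeriv_comp_left _ (character k).2.1.contDiffAt
      (by exact_mod_cast le_top)).trans ?_
    rw [ContinuousLinearMap.norm_restrictScalars, ContinuousLinearMap.norm_toSpanSingleton,
      pow_succ, mul_comm]
    exact mul_le_mul (ih x) (norm_characterForm_le k) (norm_nonneg _)
      (by have := weight_pos k; positivity)

theorem normLE_character {n : ℕ} (k : Fin n → ℤ) (N : ℕ) :
    NormLE N (character k) ((1 + n) ^ N * weight k ^ N) := fun i hi x => by
  have h0 := one_le_weight k
  refine (norm_iteratedFDeriv_character_le k i x).trans ?_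
  rw [← mul_pow]
  calc ((n : ℝ) * weight k) ^ i ≤ ((1 + n) * weight k) ^ i := by gcongr; linarith
    _ ≤ ((1 + n) * weight k) ^ N := by
      refine pow_le_pow_right₀ ?_ hi
      have : (0 : ℝ) ≤ n := Nat.cast_nonneg n
      nlinarith

theorem summable_norm_coeff_mul_weight {n : ℕ} (φ : TestFn n) (N : ℕ) :
    Summable fun k => ‖coeff k φ‖ * ((1 + n) ^ N * weight k ^ N) := by
  obtain ⟨B, hB0, hB⟩ := exists_normLE (2 * (n + N)) φ
  refine Summable.of_nonneg_of_le (fun k => by have := weight_pos k; positivity) (fun k => ?_)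
    ((summable_inv_weight n).mul_left ((1 + n) ^ (n + N) * B * (1 + n) ^ N))
  have h := norm_coeff_le_weight (n + N) φ hB k
  have h0 := weight_pos k
  calc ‖coeff k φ‖ * ((1 + n) ^ N * weight k ^ N)
      ≤ ((1 + n) ^ (n + N) * B * (weight k ^ (n + N))⁻¹) * ((1 + n) ^ N * weight k ^ N) := by
        gcongr
    _ = (1 + n) ^ (n + N) * B * (1 + n) ^ N * (weight k ^ n)⁻¹ := by
        rw [pow_add (weight k)]
        field_simp

theorem normLE_sub_partial_sum {n : ℕ} (φ : TestFn n) (N : ℕ) (s : Finset (Fin n → ℤ)) :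
    NormLE N (φ - ∑ k ∈ s, coeff k φ • character k)
      (∑' k : {k // k ∉ s}, ‖coeff k.1 φ‖ * ((1 + n) ^ N * weight k.1 ^ N)) := by
  intro i hi x
  have hsum := fun i : ℕ => (summable_norm_coeff_mul_weight φ i).subtype (· ∉ s)
  have hb : ∀ (i : ℕ) (k : Fin n → ℤ) (x : Fin n → ℝ),
      ‖iteratedFDeriv ℝ i (coeff k φ • character k : TestFn n).1 x‖
        ≤ ‖coeff k φ‖ * ((1 + n) ^ i * weight k ^ i) := fun i k x =>
    (normLE_character k i).smul (coeff k φ) i le_rfl x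
  have heq : (φ - ∑ k ∈ s, coeff k φ • character k : TestFn n).1
      = fun x => ∑' k : {k // k ∉ s}, (coeff k.1 φ • character k.1 : TestFn n).1 x := by
    funext x
    have h1 := hasSum_coeff_mul_character φ x
    have h2 := h1.summable.sum_add_tsum_subtype_compl s
    rw [h1.tsum_eq] at h2
    have h3 : (∑ k ∈ s, coeff k φ • character k : TestFn n).1 x
        = ∑ k ∈ s, coeff k φ * (character k).1 x := by
      rw [AddSubmonoidClass.coe_finsetSum, Finset.sum_apply]
      rfl
    change φ.1 x - (∑ k ∈ s, coeff k φ • character k : TestFn n).1 x = _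
    rw [h3, ← h2, add_sub_cancel_left]
    rfl
  rw [heq, iteratedFDeriv_tsum (N := ⊤)
    (v := fun i (k : {k // k ∉ s}) => ‖coeff k.1 φ‖ * ((1 + n) ^ i * weight k.1 ^ i))
    (fun k => (coeff k.1 φ • character k.1 : TestFn n).2.1) (fun i _ => hsum i)
    (fun i k x _ => hb i k.1 x) (k := i) le_top]
  refine (tsum_of_norm_bounded (hsum i).hasSum fun k => hb i k.1 x).trans ?_
  refine (hsum i).tsum_le_tsum (fun k => ?_) (hsum N)
  have h0 := one_le_weight k.1
  have h1 : (1 : ℝ) ≤ 1 + n := by simp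
  simp only [Function.comp]
  gcongr

/-- The Fourier series of a smooth function converges in `C^∞`, hence after pairing with any
distribution. -/
theorem hasSum_distr {n : ℕ} (u : Distr n) (φ : TestFn n) :
    HasSum (fun k => coeff k φ * u.1 (character k)) (u.1 φ) := by
  obtain ⟨C, N, h⟩ := u.2
  have h1 := tendsto_tsum_compl_atTop_zero
    (fun k => ‖coeff k φ‖ * ((1 + n) ^ N * weight k ^ N))
  have h2 : Tendsto (fun s : Finset (Fin n → ℤ) =>
      u.1 φ - ∑ k ∈ s, coeff k φ * u.1 (character k)) atTop (𝓝 0) := by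
    refine squeeze_zero_norm (fun s => ?_) (by simpa using h1.const_mul C)
    have h3 := h _ _ (normLE_sub_partial_sum φ N s)
    simpa [map_sub, map_sum] using h3
  have h4 := (tendsto_const_nhds (x := u.1 φ)).sub h2
  simpa [HasSum] using h4

theorem character_pairing {n : ℕ} (u : Distr n) (k : Fin n → ℤ) :
    u.1 (character k) = ((2 * Real.pi : ℝ) ^ n : ℂ) * fourierDistr u (-k) := by
  rw [fourierDistr, neg_neg, mul_inv_cancel_left₀ (two_pi_pow_ne_zero n)]

/-- The distribution defined by a smooth function. -/
def ofTestFn {n : ℕ} : TestFn n →ₗ[ℂ] Distr n where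
  toFun f := ⟨torusIntegral ∘ₗ LinearMap.mulLeft ℂ f, by
    obtain ⟨A, hA⟩ := mul_bound f 0
    refine ⟨(2 * Real.pi) ^ n * A, 0, fun φ B hB => ?_⟩
    have h := norm_torusIntegral_le (f * φ) (B := A * B) fun x => by
      simpa using hA φ B hB 0 le_rfl x
    rw [mul_assoc]
    exact h⟩
  map_add' f g := Subtype.ext (LinearMap.ext fun φ => by
    change torusIntegral ((f + g) * φ) = torusIntegral (f * φ) + torusIntegral (g * φ)
    rw [add_mul, map_add])
  map_smul' c f := Subtype.ext (LinearMap.ext fun φ => by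
    change torusIntegral ((c • f) * φ) = c * torusIntegral (f * φ)
    rw [smul_mul_assoc, map_smul, smul_eq_mul])

theorem ofTestFn_apply {n : ℕ} (f φ : TestFn n) : (ofTestFn f).1 φ = torusIntegral (f * φ) := rfl

theorem fourierDistr_ofTestFn {n : ℕ} (f : TestFn n) (k : Fin n → ℤ) :
    fourierDistr (ofTestFn f) k = coeff k f := by
  rw [fourierDistr, ofTestFn_apply, coeff_apply, mul_comm f]

/-- The truncated Fourier series of a distribution. -/
def truncate {n : ℕ} (s : Finset (Fin n → ℤ)) (u : Distr n) : TestFn n :=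
  ∑ k ∈ s, fourierDistr u k • character k

theorem coeff_truncate {n : ℕ} (s : Finset (Fin n → ℤ)) (u : Distr n) (k : Fin n → ℤ) :
    coeff k (truncate s u) = if k ∈ s then fourierDistr u k else 0 := by
  simp [truncate, coeff_character]

theorem tendsto_truncate {n : ℕ} (u : Distr n) (φ : TestFn n) :
    Tendsto (fun s => (ofTestFn (truncate s u)).1 φ) atTop (𝓝 (u.1 φ)) := by
  have h := hasSum_distr u φ
  have h2 := (Equiv.neg (Fin n → ℤ)).hasSum_iff.mpr h
  refine h2.congr fun s => ?_
  rw [ofTestFn_apply]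
  simp only [truncate, Finset.sum_mul, map_sum]
  refine Finset.sum_congr rfl fun k _ => ?_
  simp only [Function.comp, Equiv.neg_apply, character_pairing, neg_neg, coeff_apply]
  rw [smul_mul_assoc, map_smul, smul_eq_mul]
  field_simp [two_pi_pow_ne_zero n]

/-- The distribution with given bounded Fourier coefficients. -/
theorem exists_distr_of_bounded {n : ℕ} (c : (Fin n → ℤ) → ℂ) {M : ℝ} (hc : ∀ k, ‖c k‖ ≤ M) :
    ∃ u : Distr n, ∀ k, fourierDistr u k = c k := by
  have hM : 0 ≤ M := (norm_nonneg _).trans (hc 0)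
  have hs : ∀ φ : TestFn n, Summable fun k => ‖c (-k) * coeff k φ‖ := fun φ =>
    Summable.of_nonneg_of_le (fun k => norm_nonneg _)
      (fun k => by rw [norm_mul]; exact mul_le_mul_of_nonneg_right (hc _) (norm_nonneg _))
      ((summable_norm_coeff φ).mul_left M)
  let L : TestFn n →ₗ[ℂ] ℂ :=
    { toFun := fun φ => ((2 * Real.pi : ℝ) ^ n : ℂ) * ∑' k, c (-k) * coeff k φ
      map_add' := fun φ ψ => by
        simp only [map_add, mul_add]
        rw [(hs φ).of_norm.tsum_add (hs ψ).of_norm, mul_add]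
      map_smul' := fun a φ => by
        simp only [map_smul, smul_eq_mul, RingHom.id_apply]
        rw [mul_left_comm a, ← tsum_mul_left (a := a)]
        simp only [mul_left_comm a] }
  refine ⟨⟨L, (2 * Real.pi) ^ n * (M * ((1 + n) ^ n * ∑' k : Fin n → ℤ, (weight k ^ n)⁻¹)), 2 * n,
    fun φ B hB => ?_⟩, fun k => ?_⟩
  · change ‖((2 * Real.pi : ℝ) ^ n : ℂ) * ∑' k, c (-k) * coeff k φ‖ ≤ _
    rw [norm_mul, mul_assoc]
    have h3 : ‖((2 * Real.pi : ℝ) ^ n : ℂ)‖ = (2 * Real.pi) ^ n := by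
      rw [norm_pow]; simp [abs_of_pos Real.pi_pos]
    rw [h3]
    refine mul_le_mul_of_nonneg_left ?_ (by positivity)
    have h4 : M * ((1 + n) ^ n * ∑' k : Fin n → ℤ, (weight k ^ n)⁻¹) * B
        = ∑' k : Fin n → ℤ, M * ((1 + n) ^ n * B * (weight k ^ n)⁻¹) := by
      rw [tsum_mul_left, tsum_mul_left]; ring
    rw [h4]
    refine tsum_of_norm_bounded (((summable_inv_weight n).mul_left _).mul_left M).hasSum fun k => ?_
    rw [norm_mul]
    exact mul_le_mul (hc _) (norm_coeff_le_weight n φ hB k) (norm_nonneg _) hM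
  · change _⁻¹ * (_ * ∑' l, c (-l) * coeff l (character (-k))) = c k
    rw [inv_mul_cancel_left₀ (two_pi_pow_ne_zero n), tsum_eq_single (-k)]
    · simp [coeff_character]
    · intro l hl
      simp [coeff_character, hl]

/-- The complex conjugate of a smooth function. -/
def conjFn {n : ℕ} (f : TestFn n) : TestFn n :=
  ⟨fun x => starRingEnd ℂ (f.1 x), (Complex.conjCLE.toContinuousLinearMap.contDiff).comp f.2.1,
    fun k x => by simp only [f.2.2]⟩

theorem conjFn_character {n : ℕ} (k : Fin n → ℤ) : conjFn (character k) = character (-k) := by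
  apply Subtype.ext
  funext x
  change starRingEnd ℂ (Complex.exp _) = Complex.exp _
  rw [← Complex.exp_conj]
  congr 1
  simp

theorem torusIntegral_conjFn {n : ℕ} (f : TestFn n) :
    torusIntegral (conjFn f) = starRingEnd ℂ (torusIntegral f) := integral_conj

theorem coeff_conjFn {n : ℕ} (k : Fin n → ℤ) (f : TestFn n) :
    coeff k (conjFn f) = starRingEnd ℂ (coeff (-k) f) := by
  have h : character (-k) * conjFn f = conjFn (character (- -k) * f) := by
    rw [neg_neg, ← conjFn_character]
    apply Subtype.ext
    funext x
    exact (map_mul (starRingEnd ℂ) _ _).symm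
  rw [coeff_apply, coeff_apply, h, torusIntegral_conjFn, map_mul (starRingEnd ℂ)]
  congr 1
  rw [map_inv₀, map_pow, Complex.conj_ofReal]

/-- Parseval's identity, obtained by expanding the distribution `φ ↦ ∫ φ f̄` along `φ = f`. -/
theorem hasSum_sq_coeff {n : ℕ} (f : TestFn n) :
    HasSum (fun k => ‖coeff k f‖ ^ 2)
      (((2 * Real.pi) ^ n)⁻¹ * ∫ x in cube n, ‖f.1 x‖ ^ 2) := by
  have h := (hasSum_distr (ofTestFn (conjFn f)) f).mul_left ((2 * Real.pi : ℝ) ^ n : ℂ)⁻¹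
  have h1 : (ofTestFn (conjFn f)).1 f = ((∫ x in cube n, ‖f.1 x‖ ^ 2 : ℝ) : ℂ) := by
    rw [ofTestFn_apply, torusIntegral_apply, ← integral_complex_ofReal]
    refine integral_congr_ae (Eventually.of_forall fun x => ?_)
    change starRingEnd ℂ (f.1 x) * f.1 x = _
    rw [Complex.conj_mul']
    push_cast
    rfl
  have h2 : ∀ k, ((2 * Real.pi : ℝ) ^ n : ℂ)⁻¹ *
      (coeff k f * (ofTestFn (conjFn f)).1 (character k)) = ((‖coeff k f‖ ^ 2 : ℝ) : ℂ) := by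
    intro k
    rw [character_pairing, fourierDistr_ofTestFn, coeff_conjFn, neg_neg, mul_left_comm,
      inv_mul_cancel_left₀ (two_pi_pow_ne_zero n), Complex.mul_conj']
    push_cast
    rfl
  simp only [h2, h1] at h
  have h3 : ((2 * Real.pi : ℝ) ^ n : ℂ)⁻¹ * ((∫ x in cube n, ‖f.1 x‖ ^ 2 : ℝ) : ℂ)
      = ((((2 * Real.pi) ^ n)⁻¹ * ∫ x in cube n, ‖f.1 x‖ ^ 2 : ℝ) : ℂ) := by
    push_cast; rfl
  rw [h3] at h
  exact Complex.hasSum_ofReal.mp h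

/-! ### Integer Sobolev norms of smooth functions -/

/-- `F ≤ K · G` for some finite constant `K`. -/
def Dom {α : Type*} (F G : α → ℝ≥0∞) : Prop := ∃ K : ℝ≥0, ∀ a, F a ≤ K * G a

theorem Dom.of_le {α : Type*} {F G : α → ℝ≥0∞} (h : ∀ a, F a ≤ G a) : Dom F G :=
  ⟨1, fun a => by simpa using h a⟩

theorem Dom.trans {α : Type*} {F G H : α → ℝ≥0∞} (h : Dom F G) (h' : Dom G H) : Dom F H := by
  obtain ⟨K, hK⟩ := h
  obtain ⟨K', hK'⟩ := h'
  refine ⟨K * K', fun a => (hK a).trans ?_⟩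
  rw [ENNReal.coe_mul, mul_assoc]
  gcongr
  exact hK' a

theorem Dom.add {α : Type*} {F G H : α → ℝ≥0∞} (h : Dom F H) (h' : Dom G H) :
    Dom (fun a => F a + G a) H := by
  obtain ⟨K, hK⟩ := h
  obtain ⟨K', hK'⟩ := h'
  refine ⟨K + K', fun a => ?_⟩
  rw [ENNReal.coe_add, add_mul]
  exact add_le_add (hK a) (hK' a)

theorem Dom.sum {α ι : Type*} {F : ι → α → ℝ≥0∞} {H : α → ℝ≥0∞} (s : Finset ι)
    (h : ∀ i, Dom (F i) H) : Dom (fun a => ∑ i ∈ s, F i a) H := by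
  choose K hK using h
  refine ⟨∑ i ∈ s, K i, fun a => ?_⟩
  rw [ENNReal.ofNNReal_finsetSum, Finset.sum_mul]
  exact Finset.sum_le_sum fun i _ => hK i a

theorem Dom.comp {α β : Type*} {F G : α → ℝ≥0∞} (h : Dom F G) (g : β → α) :
    Dom (fun b => F (g b)) (fun b => G (g b)) := by
  obtain ⟨K, hK⟩ := h
  exact ⟨K, fun b => hK (g b)⟩

/-- The square `∑ₖ (1+|k|²)^N |f̂(k)|²` of the Sobolev norm of integer order `N`. -/
def hsq {n : ℕ} (N : ℕ) (f : TestFn n) : ℝ≥0∞ :=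
  ∑' k : Fin n → ℤ, ENNReal.ofReal (weight k ^ N * ‖coeff k f‖ ^ 2)

/-- The inductive description of the Sobolev norms: one more derivative in `L²`. -/
theorem hsq_succ {n : ℕ} (N : ℕ) (f : TestFn n) :
    hsq (N + 1) f = hsq N f + ∑ j, hsq N (partialFn j f) := by
  simp only [hsq]
  rw [← Summable.tsum_finsetSum fun _ _ => ENNReal.summable, ← ENNReal.tsum_add]
  refine tsum_congr fun k => ?_
  have h0 := weight_pos k
  rw [← ENNReal.ofReal_sum_of_nonneg fun j _ => by positivity,
    ← ENNReal.ofReal_add (by positivity) (Finset.sum_nonneg fun j _ => by positivity)]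
  congr 1
  simp only [coeff_partialFn, norm_mul, Complex.norm_I, one_mul, mul_pow, Complex.norm_intCast,
    sq_abs]
  rw [← Finset.mul_sum, ← Finset.sum_mul, pow_succ]
  simp only [weight]
  ring

theorem hsq_mono {n : ℕ} {N N' : ℕ} (h : N ≤ N') (f : TestFn n) : hsq N f ≤ hsq N' f := by
  refine ENNReal.tsum_le_tsum fun k => ENNReal.ofReal_le_ofReal ?_
  have := one_le_weight k
  gcongr

theorem hsq_partialFn_le {n : ℕ} (N : ℕ) (j : Fin n) (f : TestFn n) :
    hsq N (partialFn j f) ≤ hsq (N + 1) f := by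
  rw [hsq_succ]
  exact (Finset.single_le_sum (f := fun j => hsq N (partialFn j f)) (fun _ _ => zero_le)
    (Finset.mem_univ j)).trans le_add_self

theorem hsq_sum_le {n : ℕ} {ι : Type*} (N : ℕ) (s : Finset ι) (f : ι → TestFn n) :
    hsq N (∑ i ∈ s, f i) ≤ s.card * ∑ i ∈ s, hsq N (f i) := by
  simp only [hsq]
  rw [← Summable.tsum_finsetSum fun _ _ => ENNReal.summable, ← ENNReal.tsum_mul_left]
  refine ENNReal.tsum_le_tsum fun k => ?_
  have h0 := weight_pos k
  rw [← ENNReal.ofReal_sum_of_nonneg fun j _ => by positivity, ← ENNReal.ofReal_natCast,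
    ← ENNReal.ofReal_mul (by positivity)]
  refine ENNReal.ofReal_le_ofReal ?_
  rw [← Finset.mul_sum, mul_left_comm, map_sum]
  refine mul_le_mul_of_nonneg_left ?_ (by positivity)
  calc ‖∑ i ∈ s, coeff k (f i)‖ ^ 2 ≤ (∑ i ∈ s, ‖coeff k (f i)‖) ^ 2 := by
        gcongr; exact norm_sum_le _ _
    _ ≤ s.card * ∑ i ∈ s, ‖coeff k (f i)‖ ^ 2 := sq_sum_le_card_mul_sum_sq

theorem hsq_add_le {n : ℕ} (N : ℕ) (f g : TestFn n) :
    hsq N (f + g) ≤ 2 * (hsq N f + hsq N g) := by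
  simpa using hsq_sum_le N Finset.univ ![f, g]

theorem Dom.hsq_sum {n : ℕ} {α ι : Type*} {N : ℕ} {s : Finset ι} {f : ι → α → TestFn n}
    {H : α → ℝ≥0∞} (h : ∀ i, Dom (fun a => hsq N (f i a)) H) :
    Dom (fun a => hsq N (∑ i ∈ s, f i a)) H :=
  Dom.trans ⟨s.card, fun a => by simpa using hsq_sum_le N s fun i => f i a⟩ (Dom.sum s h)

theorem Dom.hsq_add {n : ℕ} {α : Type*} {N : ℕ} {f g : α → TestFn n} {H : α → ℝ≥0∞}
    (h : Dom (fun a => hsq N (f a)) H) (h' : Dom (fun a => hsq N (g a)) H) :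
    Dom (fun a => hsq N (f a + g a)) H :=
  Dom.trans ⟨2, fun a => by simpa using hsq_add_le N (f a) (g a)⟩ (h.add h')

theorem hsq_zero {n : ℕ} (f : TestFn n) :
    hsq 0 f = ENNReal.ofReal (((2 * Real.pi) ^ n)⁻¹ * ∫ x in cube n, ‖f.1 x‖ ^ 2) := by
  simp only [hsq, pow_zero, one_mul]
  rw [← ENNReal.ofReal_tsum_of_nonneg (fun k => by positivity) (hasSum_sq_coeff f).summable,
    (hasSum_sq_coeff f).tsum_eq]

/-! ### Uniformly bounded families of smooth functions -/

/-- A family of smooth functions that is bounded in every `C^N` norm. -/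
def UB {n : ℕ} {ι : Type*} (b : ι → TestFn n) : Prop := ∀ N, ∃ A, ∀ p, NormLE N (b p) A

theorem UB.const {n : ℕ} {ι : Type*} (f : TestFn n) : UB fun _ : ι => f := fun N => by
  obtain ⟨B, -, hB⟩ := exists_normLE N f
  exact ⟨B, fun _ => hB⟩

theorem UB.smul {n : ℕ} {ι : Type*} {b : ι → TestFn n} (hb : UB b) (c : ℂ) :
    UB fun p => c • b p := fun N => by
  obtain ⟨A, hA⟩ := hb N
  exact ⟨‖c‖ * A, fun p => (hA p).smul c⟩

theorem UB.neg {n : ℕ} {ι : Type*} {b : ι → TestFn n} (hb : UB b) : UB fun p => -b p := by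
  simpa using hb.smul (-1)

theorem UB.sum {n : ℕ} {ι κ : Type*} {b : κ → ι → TestFn n} (s : Finset κ)
    (hb : ∀ i, UB (b i)) : UB fun p => ∑ i ∈ s, b i p := fun N => by
  choose A hA using fun i => hb i N
  exact ⟨∑ i ∈ s, A i, fun p => NormLE.sum s fun i _ => hA i p⟩

theorem UB.partialFn {n : ℕ} {ι : Type*} {b : ι → TestFn n} (hb : UB b) (j : Fin n) :
    UB fun p => partialFn j (b p) := fun N => by
  obtain ⟨A, hA⟩ := hb (N + 1)
  exact ⟨A, fun p => (hA p).partialFn j⟩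

theorem NormLE.mul {n N : ℕ} {a φ : TestFn n} {A B : ℝ} (ha : NormLE N a A) (hφ : NormLE N φ B) :
    NormLE N (a * φ) (2 ^ N * A * B) := fun i hi x => by
  have hA0 := ha.nonneg
  have hB0 := hφ.nonneg
  have h := norm_iteratedFDeriv_mul_le (𝕜 := ℝ) a.2.1 φ.2.1 x (n := i) (by exact_mod_cast le_top)
  refine h.trans ?_
  calc _ ≤ ∑ m ∈ Finset.range (i + 1), (i.choose m : ℝ) * A * B := by
        refine Finset.sum_le_sum fun m hm => ?_
        have hm' : m ≤ i := Nat.lt_succ_iff.mp (Finset.mem_range.mp hm)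
        have h2 := ha m (by omega) x
        have h3 := hφ (i - m) (by omega) x
        gcongr
    _ = 2 ^ i * A * B := by
        rw [← Finset.sum_mul, ← Finset.sum_mul]
        congr 2
        exact_mod_cast Nat.sum_range_choose i
    _ ≤ 2 ^ N * A * B := by
        gcongr
        norm_num

theorem UB.mul {n : ℕ} {ι : Type*} {b c : ι → TestFn n} (hb : UB b) (hc : UB c) :
    UB fun p => b p * c p := fun N => by
  obtain ⟨A, hA⟩ := hb N
  obtain ⟨B, hB⟩ := hc N
  exact ⟨2 ^ N * A * B, fun p => (hA p).mul (hB p)⟩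

theorem UB.prod {n : ℕ} {ι κ : Type*} {b : κ → ι → TestFn n} (s : Finset κ)
    (hb : ∀ i, UB (b i)) : UB fun p => ∏ i ∈ s, b i p := by
  classical
  induction s using Finset.induction_on with
  | empty => simpa using UB.const 1
  | insert a s ha ih =>
    simp only [Finset.prod_insert ha]
    exact (hb a).mul ih

theorem UB.det {n : ℕ} {ι : Type*} {M : ι → Matrix (Fin n) (Fin n) (TestFn n)}
    (h : ∀ i j, UB fun p => M p i j) : UB fun p => (M p).det := by
  simp only [Matrix.det_apply]
  refine UB.sum _ fun σ => ?_
  rcases Int.units_eq_one_or (Equiv.Perm.sign σ) with hs | hs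
  · simp only [hs, one_smul]
    exact UB.prod _ fun i => h _ _
  · simp only [hs, Units.neg_smul, one_smul]
    exact (UB.prod _ fun i => h _ _).neg

theorem UB.adjugate {n : ℕ} {ι : Type*} {M : ι → Matrix (Fin n) (Fin n) (TestFn n)}
    (h : ∀ i j, UB fun p => M p i j) (i j : Fin n) : UB fun p => (M p).adjugate i j := by
  simp only [Matrix.adjugate_apply]
  refine UB.det fun a b => ?_
  by_cases hab : a = j
  · subst hab
    simp only [Matrix.updateRow_self]
    exact UB.const _
  · simp only [Matrix.updateRow_ne hab]
    exact h a b

/-- Multiplication by a bounded family is uniformly bounded on every integer Sobolev space. -/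
theorem dom_hsq_mul {n : ℕ} {ι : Type*} {b : ι → TestFn n} (hb : UB b) (N : ℕ) :
    Dom (fun a : ι × TestFn n => hsq N (b a.1 * a.2)) (fun a => hsq N a.2) := by
  induction N generalizing b with
  | zero =>
    obtain ⟨A, hA⟩ := hb 0
    refine ⟨Real.toNNReal (A ^ 2), fun ⟨p, f⟩ => ?_⟩
    simp only [hsq_zero]
    rw [← ENNReal.ofReal, ← ENNReal.ofReal_mul (by positivity)]
    refine ENNReal.ofReal_le_ofReal ?_
    rw [mul_left_comm]
    refine mul_le_mul_of_nonneg_left ?_ (by positivity)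
    rw [← integral_const_mul]
    have hc : ∀ g : TestFn n, IntegrableOn (fun x => ‖g.1 x‖ ^ 2) (cube n) := fun g =>
      ((testFn_continuous g).norm.pow 2).continuousOn.integrableOn_compact isCompact_Icc
    refine integral_mono (hc _) ((hc f).const_mul _) fun x => ?_
    change ‖(b p).1 x * f.1 x‖ ^ 2 ≤ A ^ 2 * ‖f.1 x‖ ^ 2
    rw [norm_mul, mul_pow]
    have := (hA p).sup x
    gcongr
  | succ N ih =>
    simp only [hsq_succ N (_ * _), partialFn_mul]
    refine Dom.add ((ih hb).trans (Dom.of_le fun a => hsq_mono (Nat.le_succ N) _))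
      (Dom.sum _ fun j => Dom.hsq_add ?_ ?_)
    · exact (ih (hb.partialFn j)).trans (Dom.of_le fun a => hsq_mono (Nat.le_succ N) _)
    · exact ((ih hb).comp fun a : ι × TestFn n => (a.1, partialFn j a.2)).trans
        (Dom.of_le fun a => hsq_partialFn_le N j _)

/-! ### Sobolev norms of distributions -/

/-- The square `∑ₖ (1+|k|²)^σ |û(k)|²` of the Sobolev norm of a distribution. -/
def sobolevSq {n : ℕ} (σ : ℝ) (u : Distr n) : ℝ≥0∞ :=
  ∑' k : Fin n → ℤ, ENNReal.ofReal (weight k ^ σ * ‖fourierDistr u k‖ ^ 2)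

theorem sobolevNorm_eq {n : ℕ} (σ : ℝ) (u : Distr n) :
    sobolevNorm σ u
      = (ENNReal.ofReal ((2 * Real.pi) ^ n) * sobolevSq σ u) ^ (1 / 2 : ℝ) := rfl

theorem fourierDistr_add {n : ℕ} (u v : Distr n) (k : Fin n → ℤ) :
    fourierDistr (u + v) k = fourierDistr u k + fourierDistr v k := mul_add _ _ _

theorem fourierDistr_sub {n : ℕ} (u v : Distr n) (k : Fin n → ℤ) :
    fourierDistr (u - v) k = fourierDistr u k - fourierDistr v k := mul_sub _ _ _

theorem sobolevSq_truncate_le {n : ℕ} (N : ℕ) (s : Finset (Fin n → ℤ)) (u : Distr n) :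
    hsq N (truncate s u) ≤ sobolevSq N u := by
  refine ENNReal.tsum_le_tsum fun k => ENNReal.ofReal_le_ofReal ?_
  have := weight_pos k
  rw [coeff_truncate, Real.rpow_natCast]
  split_ifs
  · exact le_rfl
  · rw [norm_zero, zero_pow two_ne_zero, mul_zero]
    positivity

/-- A bound on smooth functions extends to distributions, by truncating the Fourier series and
lower semicontinuity of the norm. -/
theorem sobolevSq_le_of_hsq_le {n : ℕ} {T : Distr n → Distr n} {S R : TestFn n → TestFn n}
    (hT : ∀ u φ, (T u).1 φ = u.1 (S φ)) (hR : ∀ f, T (ofTestFn f) = ofTestFn (R f)) {N : ℕ}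
    {K : ℝ≥0∞} (hK : ∀ f, hsq N (R f) ≤ K * hsq N f) (u : Distr n) :
    sobolevSq N (T u) ≤ K * sobolevSq N u := by
  have hlim : ∀ k, Tendsto (fun s => coeff k (R (truncate s u))) atTop
      (𝓝 (fourierDistr (T u) k)) := fun k => by
    have h := (tendsto_truncate u (S (character (-k)))).const_mul
      ((2 * Real.pi : ℝ) ^ n : ℂ)⁻¹
    rw [← hT] at h
    refine h.congr fun s => ?_
    rw [← hT, hR, ← fourierDistr_ofTestFn]
    rfl
  rw [sobolevSq, ENNReal.tsum_eq_iSup_sum]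
  refine iSup_le fun F => ?_
  have h1 : Tendsto (fun s => ∑ k ∈ F, ENNReal.ofReal
      (weight k ^ (N : ℝ) * ‖coeff k (R (truncate s u))‖ ^ 2)) atTop
      (𝓝 (∑ k ∈ F, ENNReal.ofReal (weight k ^ (N : ℝ) * ‖fourierDistr (T u) k‖ ^ 2))) :=
    tendsto_finsetSum _ fun k _ =>
      (ENNReal.continuous_ofReal.tendsto _).comp (((hlim k).norm.pow 2).const_mul _)
  refine le_of_tendsto' h1 fun s => ?_
  calc _ ≤ hsq N (R (truncate s u)) := by
        simp only [Real.rpow_natCast]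
        exact ENNReal.sum_le_tsum F
    _ ≤ K * hsq N (truncate s u) := hK _
    _ ≤ K * sobolevSq N u := by gcongr; exact sobolevSq_truncate_le N s u

/-! ### Interpolation between Sobolev spaces -/

/-- The square of the `K`-functional of the couple `(L², H^N)`: the weight
`r / (1 + r)`, `r = e^x (1+|k|²)^N`, is the minimum of `|a|² + r |b|²` over `a + b = 1`. -/
def kFunctional {n : ℕ} (N : ℕ) (x : ℝ) (u : Distr n) : ℝ≥0∞ :=
  ∑' k : Fin n → ℤ, ENNReal.ofReal
    (Real.exp x * weight k ^ N / (1 + Real.exp x * weight k ^ N) * ‖fourierDistr u k‖ ^ 2)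

theorem fourierDistr_bounded_of_sobolevSq {n : ℕ} {σ : ℝ} (hσ : 0 ≤ σ) {u : Distr n}
    (h : sobolevSq σ u ≠ ⊤) : ∃ M, ∀ k, ‖fourierDistr u k‖ ≤ M := by
  refine ⟨Real.sqrt (sobolevSq σ u).toReal, fun k => Real.le_sqrt_of_sq_le ?_⟩
  have h1 : ENNReal.ofReal (weight k ^ σ * ‖fourierDistr u k‖ ^ 2) ≤ sobolevSq σ u :=
    ENNReal.le_tsum k
  have h2 := (ENNReal.ofReal_le_iff_le_toReal h).mp h1
  have h3 : 1 ≤ weight k ^ σ := Real.one_le_rpow (one_le_weight k) hσ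
  nlinarith [sq_nonneg ‖fourierDistr u k‖]

theorem kFunctional_le {n : ℕ} {T : Distr n →ₗ[ℂ] Distr n} {N : ℕ} {K : ℝ≥0∞}
    (h0 : ∀ u, sobolevSq 0 (T u) ≤ K * sobolevSq 0 u)
    (hN : ∀ u, sobolevSq N (T u) ≤ K * sobolevSq N u) (x : ℝ) {u : Distr n} {M : ℝ}
    (hu : ∀ k, ‖fourierDistr u k‖ ≤ M) : kFunctional N x (T u) ≤ K * kFunctional N x u := by
  set r : (Fin n → ℤ) → ℝ := fun k => Real.exp x * weight k ^ N with hr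
  have hr0 : ∀ k, 0 < r k := fun k => by have := weight_pos k; positivity
  obtain ⟨v, hv⟩ := exists_distr_of_bounded (fun k => ((1 + r k)⁻¹ : ℝ) * fourierDistr u k)
    (M := M) fun k => by
      rw [norm_mul, Complex.norm_real, Real.norm_of_nonneg (by have := hr0 k; positivity)]
      refine le_trans (mul_le_of_le_one_left (norm_nonneg _) ?_) (hu k)
      exact inv_le_one_of_one_le₀ (by linarith [hr0 k])
  have hsplit : ∀ a b : Distr n, kFunctional N x (a + b)
      ≤ sobolevSq 0 a + ENNReal.ofReal (Real.exp x) * sobolevSq N b := fun a b => by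
    rw [kFunctional, sobolevSq, sobolevSq, ← ENNReal.tsum_mul_left, ← ENNReal.tsum_add]
    refine ENNReal.tsum_le_tsum fun k => ?_
    have hw := weight_pos k
    rw [← ENNReal.ofReal_mul (by positivity), ← ENNReal.ofReal_add (by positivity) (by positivity)]
    refine ENNReal.ofReal_le_ofReal ?_
    rw [fourierDistr_add, Real.rpow_zero, one_mul, Real.rpow_natCast, ← mul_assoc]
    change r k / (1 + r k) * _ ≤ _ + r k * _
    have h1 := norm_add_le (fourierDistr a k) (fourierDistr b k)
    have h2 := hr0 k
    rw [div_mul_eq_mul_div, div_le_iff₀ (by positivity)]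
    calc r k * ‖fourierDistr a k + fourierDistr b k‖ ^ 2
        ≤ r k * (‖fourierDistr a k‖ + ‖fourierDistr b k‖) ^ 2 := by gcongr
      _ ≤ _ := by nlinarith [sq_nonneg (‖fourierDistr a k‖ - r k * ‖fourierDistr b k‖)]
  have hopt : sobolevSq 0 (u - v) + ENNReal.ofReal (Real.exp x) * sobolevSq N v
      = kFunctional N x u := by
    rw [kFunctional, sobolevSq, sobolevSq, ← ENNReal.tsum_mul_left, ← ENNReal.tsum_add]
    refine tsum_congr fun k => ?_
    have hw := weight_pos k
    rw [← ENNReal.ofReal_mul (by positivity), ← ENNReal.ofReal_add (by positivity) (by positivity)]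
    congr 1
    rw [fourierDistr_sub, hv, Real.rpow_zero, one_mul, Real.rpow_natCast, ← mul_assoc]
    change _ + r k * _ = r k / (1 + r k) * _
    have h2 := hr0 k
    have h3 : fourierDistr u k - ((1 + r k)⁻¹ : ℝ) * fourierDistr u k
        = ((r k / (1 + r k) : ℝ) : ℂ) * fourierDistr u k := by
      have h4 : ((r k / (1 + r k) : ℝ) : ℂ) = 1 - ((1 + r k)⁻¹ : ℝ) := by
        rw [← Complex.ofReal_one, ← Complex.ofReal_sub]
        congr 1
        field_simp
        ring
      rw [h4]; ring
    rw [h3, norm_mul, norm_mul, Complex.norm_real, Complex.norm_real,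
      Real.norm_of_nonneg (by positivity), Real.norm_of_nonneg (by positivity)]
    field_simp
    ring
  calc kFunctional N x (T u) = kFunctional N x (T (u - v) + T v) := by
        rw [← map_add, sub_add_cancel]
    _ ≤ sobolevSq 0 (T (u - v)) + ENNReal.ofReal (Real.exp x) * sobolevSq N (T v) := hsplit _ _
    _ ≤ K * sobolevSq 0 (u - v) + ENNReal.ofReal (Real.exp x) * (K * sobolevSq N v) := by
        gcongr
        · exact h0 _
        · exact hN _
    _ = K * kFunctional N x u := by rw [← hopt]; ring

/-- The constant relating the `K`-functional to the norm of exponent `θ`. -/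
def interpConst (θ : ℝ) : ℝ≥0∞ :=
  ∫⁻ x : ℝ, ENNReal.ofReal (Real.exp ((1 - θ) * x) / (1 + Real.exp x))

theorem interpConst_ne_zero (θ : ℝ) : interpConst θ ≠ 0 := by
  have hm : Measurable fun x : ℝ =>
      ENNReal.ofReal (Real.exp ((1 - θ) * x) / (1 + Real.exp x)) := by fun_prop
  rw [interpConst, Ne, lintegral_eq_zero_iff hm]
  intro h
  obtain ⟨x, hx⟩ := h.exists
  have : 0 < Real.exp ((1 - θ) * x) / (1 + Real.exp x) := by positivity
  exact (ENNReal.ofReal_pos.mpr this).ne' hx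

theorem interpConst_ne_top {θ : ℝ} (h0 : 0 < θ) (h1 : θ < 1) : interpConst θ ≠ ⊤ := by
  have hi1 : IntegrableOn (fun x : ℝ => Real.exp ((1 - θ) * x)) (Iic 0) :=
    integrableOn_exp_mul_Iic (by linarith) 0
  have hi2 : IntegrableOn (fun x : ℝ => Real.exp ((-θ) * x)) (Ioi 0) :=
    integrableOn_exp_mul_Ioi (by linarith) 0
  rw [interpConst, ← lintegral_add_compl _ (measurableSet_Iic (a := (0 : ℝ))), compl_Iic]
  refine ENNReal.add_ne_top.mpr ⟨ne_top_of_le_ne_top hi1.lintegral_lt_top.ne ?_,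
    ne_top_of_le_ne_top hi2.lintegral_lt_top.ne ?_⟩
  · refine lintegral_mono fun x => ENNReal.ofReal_le_ofReal ?_
    exact div_le_self (Real.exp_pos _).le (by linarith [Real.exp_pos x])
  · refine lintegral_mono fun x => ENNReal.ofReal_le_ofReal ?_
    rw [div_le_iff₀ (by positivity), mul_add, ← Real.exp_add]
    have h2 : -θ * x + x = (1 - θ) * x := by ring
    rw [h2]
    linarith [Real.exp_pos (-θ * x)]

theorem lintegral_kFunctional {n : ℕ} (N : ℕ) (θ : ℝ) (u : Distr n) :
    ∫⁻ x : ℝ, ENNReal.ofReal (Real.exp (-θ * x)) * kFunctional N x u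
      = interpConst θ * sobolevSq (θ * N) u := by
  simp only [kFunctional, ← ENNReal.tsum_mul_left]
  rw [lintegral_tsum fun k => by
    have : Measurable fun x : ℝ => ENNReal.ofReal (Real.exp (-θ * x)) * ENNReal.ofReal
        (Real.exp x * weight k ^ N / (1 + Real.exp x * weight k ^ N) *
          ‖fourierDistr u k‖ ^ 2) := by fun_prop
    exact this.aemeasurable]
  rw [sobolevSq, ← ENNReal.tsum_mul_left]
  refine tsum_congr fun k => ?_
  have hw := weight_pos k
  set y := Real.log (weight k ^ N) with hy
  have hwy : weight k ^ N = Real.exp y := (Real.exp_log (by positivity)).symm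
  have hwθ : weight k ^ (θ * N) = Real.exp (θ * y) := by
    rw [hy, Real.log_pow, Real.rpow_def_of_pos hw]
    congr 1; ring
  rw [interpConst, ← lintegral_add_right_eq_self
    (fun x => ENNReal.ofReal (Real.exp ((1 - θ) * x) / (1 + Real.exp x))) y,
    ← lintegral_mul_const _ (by fun_prop)]
  refine lintegral_congr fun x => ?_
  have h1 := Real.exp_pos y
  rw [← ENNReal.ofReal_mul (by positivity), ← ENNReal.ofReal_mul (by positivity)]
  congr 1
  rw [hwy, hwθ, ← Real.exp_add, ← mul_assoc, ← mul_assoc, mul_div_assoc', div_mul_eq_mul_div,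
    ← Real.exp_add]
  have h2 : Real.exp (-θ * x + (x + y)) = Real.exp ((1 - θ) * (x + y)) * Real.exp (θ * y) := by
    rw [← Real.exp_add]; ring_nf
  rw [h2]
  ring

/-- A linear map bounded on `L²` and on `H^N` with constant `K` is bounded on `H^σ`, `0 ≤ σ ≤ N`,
with the same constant: the Sobolev norm of exponent `θ N` is an integral of `K`-functionals. -/
theorem sobolevSq_interpolate {n : ℕ} {T : Distr n →ₗ[ℂ] Distr n} {N : ℕ} {K : ℝ≥0∞}
    (h0 : ∀ u, sobolevSq 0 (T u) ≤ K * sobolevSq 0 u)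
    (hN : ∀ u, sobolevSq N (T u) ≤ K * sobolevSq N u) (hK : 1 ≤ K) (hK' : K ≠ ⊤) {σ : ℝ}
    (hσ : 0 ≤ σ) (hσN : σ ≤ N) (u : Distr n) : sobolevSq σ (T u) ≤ K * sobolevSq σ u := by
  rcases hσ.eq_or_lt with rfl | hσ
  · exact h0 u
  rcases hσN.eq_or_lt with rfl | hσN
  · exact hN u
  by_cases htop : sobolevSq σ u = ⊤
  · rw [htop, ENNReal.mul_top (one_pos.trans_le hK).ne']
    exact le_top
  obtain ⟨M, hM⟩ := fourierDistr_bounded_of_sobolevSq hσ.le htop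
  have hNpos : (0 : ℝ) < N := hσ.trans hσN
  set θ := σ / N with hθ
  have hσθ : σ = θ * N := by rw [hθ]; field_simp
  have hθ0 : 0 < θ := by positivity
  have hθ1 : θ < 1 := (div_lt_one hNpos).mpr hσN
  have h1 : interpConst θ * sobolevSq σ (T u) ≤ interpConst θ * (K * sobolevSq σ u) := by
    rw [mul_left_comm, hσθ, ← lintegral_kFunctional, ← lintegral_kFunctional,
      ← lintegral_const_mul']
    · refine lintegral_mono fun x => ?_
      rw [mul_left_comm]
      gcongr
      exact kFunctional_le h0 hN x hM
    · exact hK'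
  exact (ENNReal.mul_le_mul_iff_right (interpConst_ne_zero θ) (interpConst_ne_top hθ0 hθ1)).mp h1

/-! ### Composition with a diffeomorphism of the torus -/

/-- Evaluation at a point, as a ring homomorphism. -/
def evalHom {n : ℕ} (x : Fin n → ℝ) : TestFn n →+* ℂ :=
  (Pi.evalRingHom (fun _ : Fin n → ℝ => ℂ) x).comp (TestFn n).val.toRingHom

theorem evalHom_apply {n : ℕ} (x : Fin n → ℝ) (f : TestFn n) : evalHom x f = f.1 x := rfl

theorem testFn_ext {n : ℕ} {f g : TestFn n} (h : ∀ x, f.1 x = g.1 x) : f = g :=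
  Subtype.ext (funext h)

theorem fderiv_apply_eq_sum {n : ℕ} (f : TestFn n) (x v : Fin n → ℝ) :
    fderiv ℝ f.1 x v = ∑ j, (v j : ℂ) * (partialFn j f).1 x := by
  conv_lhs => rw [pi_eq_sum_univ' v]
  rw [map_sum]
  refine Finset.sum_congr rfl fun j _ => ?_
  rw [map_smul, Complex.real_smul]
  rfl

theorem normLE_succ_of_partialFn {n N : ℕ} {f : TestFn n} {B B' : ℝ} (h0 : NormLE 0 f B)
    (h : ∀ j, NormLE N (partialFn j f) B') : NormLE (N + 1) f (B + n * B') := by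
  intro i hi x
  rcases i with _ | i
  · refine (h0 0 le_rfl x).trans (le_add_of_nonneg_right ?_)
    rcases Nat.eq_zero_or_pos n with rfl | hn
    · simp
    · have := (h ⟨0, hn⟩).nonneg
      positivity
  · let c : Fin n → ((Fin n → ℝ) →L[ℝ] ℂ) := fun j =>
      Complex.ofRealCLM.comp (ContinuousLinearMap.proj (R := ℝ) (φ := fun _ : Fin n => ℝ) j)
    have hc : ∀ j, ‖c j‖ ≤ 1 := fun j =>
      ContinuousLinearMap.opNorm_le_bound _ zero_le_one fun v => by
        change ‖((v j : ℝ) : ℂ)‖ ≤ 1 * ‖v‖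
        rw [Complex.norm_real, one_mul]
        exact norm_le_pi_norm v j
    let L : Fin n → (ℂ →L[ℝ] ((Fin n → ℝ) →L[ℝ] ℂ)) := fun j =>
      (ContinuousLinearMap.toSpanSingleton ℂ (c j)).restrictScalars ℝ
    have hL : ∀ j, ‖L j‖ ≤ 1 := fun j => by
      rw [ContinuousLinearMap.norm_restrictScalars, ContinuousLinearMap.norm_toSpanSingleton]
      exact hc j
    have hf : fderiv ℝ f.1 = fun x => ∑ j, (L j ∘ (partialFn j f).1) x := by
      funext x
      ext v
      rw [fderiv_apply_eq_sum]
      simp [L, c, mul_comm]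
    rw [← norm_iteratedFDeriv_fderiv, hf, iteratedFDeriv_fun_sum_apply (fun j _ =>
      ((L j).contDiff.comp (partialFn j f).2.1).contDiffAt.of_le (by exact_mod_cast le_top))]
    have h1 : ‖∑ j, iteratedFDeriv ℝ i (L j ∘ (partialFn j f).1) x‖ ≤ ∑ _j : Fin n, B' := by
      refine norm_sum_le_of_le _ fun j _ => ?_
      refine (ContinuousLinearMap.norm_iteratedFDeriv_comp_left _ (partialFn j f).2.1.contDiffAt
        (by exact_mod_cast le_top)).trans ?_
      have := h j i (by omega) x
      exact (mul_le_of_le_one_left (norm_nonneg _) (hL j)).trans this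
    refine h1.trans ?_
    simpa using h0.nonneg

theorem fderiv_equivariant {n : ℕ} {F : (Fin n → ℝ) → (Fin n → ℝ)}
    (h : ∀ k x, F (shift x k) = shift (F x) k) (k : Fin n → ℤ) (x : Fin n → ℝ) :
    fderiv ℝ F (shift x k) = fderiv ℝ F x := by
  have h1 : (fun y => F (y + shift 0 k)) = fun y => F y + shift 0 k := by
    funext y
    rw [← shift_eq, h, shift_eq]
  have h2 := fderiv_comp_add_right (𝕜 := ℝ) (f := F) (x := x) (shift 0 k)
  rw [h1, fderiv_add_const] at h2
  rw [h2, ← shift_eq]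

namespace TorusDiffeo

variable {n : ℕ} (χ : TorusDiffeo n)

theorem hasFDerivAt (x : Fin n → ℝ) : HasFDerivAt χ.toFun (fderiv ℝ χ.toFun x) x :=
  (χ.smooth.differentiable (by simp) x).hasFDerivAt

/-- The entry `∂ⱼχₗ` of the Jacobian matrix. -/
def entry (l j : Fin n) : TestFn n :=
  ⟨fun x => ((fderiv ℝ χ.toFun x (Pi.single j 1) l : ℝ) : ℂ), by
    constructor
    · exact Complex.ofRealCLM.contDiff.comp ((contDiff_apply ℝ ℝ l).comp
        ((χ.smooth.fderiv_right (m := ∞) (by simp)).clm_apply contDiff_const))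
    · intro k x
      simp only [fderiv_equivariant χ.map_shift]⟩

theorem entry_apply (l j : Fin n) (x : Fin n → ℝ) :
    (χ.entry l j).1 x = ((fderiv ℝ χ.toFun x (Pi.single j 1) l : ℝ) : ℂ) := rfl

/-- The Jacobian matrix. -/
def jacMatrix : Matrix (Fin n) (Fin n) (TestFn n) := Matrix.of χ.entry

/-- The Jacobian determinant. -/
def jac : TestFn n := χ.jacMatrix.det

theorem jac_apply (x : Fin n → ℝ) : χ.jac.1 x = ((fderiv ℝ χ.toFun x).det : ℂ) := by
  rw [← evalHom_apply, jac, RingHom.map_det, ContinuousLinearMap.det, ← LinearMap.det_toMatrix',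
    ← Complex.ofRealHom_eq_coe, RingHom.map_det]
  congr 1

theorem contDiff_det : ContDiff ℝ ∞ fun x => (fderiv ℝ χ.toFun x).det := by
  have h : (fun x => (fderiv ℝ χ.toFun x).det) = fun x => (χ.jac.1 x).re := by
    funext x
    rw [jac_apply, Complex.ofReal_re]
  rw [h]
  exact Complex.reCLM.contDiff.comp χ.jac.2.1

/-- The square root of the Jacobian determinant. -/
def rootJac : TestFn n :=
  ⟨fun x => ((Real.sqrt (fderiv ℝ χ.toFun x).det : ℝ) : ℂ),
    Complex.ofRealCLM.contDiff.comp (χ.contDiff_det.sqrt fun x => (χ.det_pos x).ne'),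
    fun k x => by simp only [fderiv_equivariant χ.map_shift]⟩

/-- The inverse of the square root of the Jacobian determinant. -/
def invRootJac : TestFn n :=
  ⟨fun x => (((Real.sqrt (fderiv ℝ χ.toFun x).det)⁻¹ : ℝ) : ℂ),
    Complex.ofRealCLM.contDiff.comp ((χ.contDiff_det.sqrt fun x => (χ.det_pos x).ne').inv
      fun x => (Real.sqrt_pos.mpr (χ.det_pos x)).ne'),
    fun k x => by simp only [fderiv_equivariant χ.map_shift]⟩

/-- The inverse of the Jacobian determinant. -/
def invJac : TestFn n := χ.invRootJac * χ.invRootJac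

theorem rootJac_mul_self : χ.rootJac * χ.rootJac = χ.jac := testFn_ext fun x => by
  rw [jac_apply]
  change ((Real.sqrt _ : ℝ) : ℂ) * ((Real.sqrt _ : ℝ) : ℂ) = _
  rw [← Complex.ofReal_mul, Real.mul_self_sqrt (χ.det_pos x).le]

theorem rootJac_mul_invRootJac : χ.rootJac * χ.invRootJac = 1 := testFn_ext fun x => by
  change ((Real.sqrt _ : ℝ) : ℂ) * (((Real.sqrt _)⁻¹ : ℝ) : ℂ) = 1
  rw [← Complex.ofReal_mul, mul_inv_cancel₀ (Real.sqrt_pos.mpr (χ.det_pos x)).ne',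
    Complex.ofReal_one]

theorem jac_mul_invJac : χ.jac * χ.invJac = 1 := by
  rw [← rootJac_mul_self, invJac, mul_mul_mul_comm, rootJac_mul_invRootJac, one_mul]

theorem invJac_apply (x : Fin n → ℝ) :
    χ.invJac.1 x = (((fderiv ℝ χ.toFun x).det)⁻¹ : ℝ) := by
  have h := congrArg (evalHom x) χ.jac_mul_invJac
  rw [map_mul, map_one, evalHom_apply, evalHom_apply, jac_apply] at h
  rw [Complex.ofReal_inv]
  exact eq_inv_of_mul_eq_one_right h

/-- The inverse diffeomorphism. -/
def symm : TorusDiffeo n where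
  toFun := χ.invFun
  invFun := χ.toFun
  smooth := χ.smooth_inv
  smooth_inv := χ.smooth
  left_inv := χ.right_inv
  right_inv := χ.left_inv
  map_shift := χ.inv_shift
  det_pos x := by
    have h1 : HasFDerivAt χ.invFun (fderiv ℝ χ.invFun x) x :=
      (χ.smooth_inv.differentiable (by simp) x).hasFDerivAt
    have h2 := (χ.hasFDerivAt (χ.invFun x)).comp x h1
    have h3 : χ.toFun ∘ χ.invFun = id := funext χ.right_inv
    rw [h3] at h2
    have h4 := congrArg ContinuousLinearMap.det (h2.unique (hasFDerivAt_id x))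
    have h5 : (fderiv ℝ χ.toFun (χ.invFun x)).det * (fderiv ℝ χ.invFun x).det = 1 := by
      simpa [ContinuousLinearMap.det] using h4
    exact pos_of_mul_pos_right (h5 ▸ one_pos) (χ.det_pos _).le

/-- Composition `f ↦ f ∘ χ`. -/
def compFn : TestFn n →ₗ[ℂ] TestFn n where
  toFun f := ⟨f.1 ∘ χ.toFun, f.2.1.comp χ.smooth, fun k x => by
    simp only [Function.comp, χ.map_shift, f.2.2]⟩
  map_add' _ _ := rfl
  map_smul' _ _ := rfl

theorem compFn_mul (f g : TestFn n) : χ.compFn (f * g) = χ.compFn f * χ.compFn g := rfl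

theorem compFn_symm_compFn (f : TestFn n) : χ.symm.compFn (χ.compFn f) = f :=
  testFn_ext fun x => congrArg f.1 (χ.right_inv x)

theorem compFn_compFn_symm (f : TestFn n) : χ.compFn (χ.symm.compFn f) = f :=
  testFn_ext fun x => congrArg f.1 (χ.left_inv x)

theorem partialFn_compFn (j : Fin n) (f : TestFn n) :
    partialFn j (χ.compFn f) = ∑ l, χ.entry l j * χ.compFn (partialFn l f) :=
  testFn_ext fun x => by
    have hf := (f.2.1.differentiable (by simp) (χ.toFun x)).hasFDerivAt
    rw [partialFn_apply]
    change fderiv ℝ (f.1 ∘ χ.toFun) x (Pi.single j 1) = _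
    rw [(hf.comp x (χ.hasFDerivAt x)).fderiv, ContinuousLinearMap.comp_apply, fderiv_apply_eq_sum,
      AddSubmonoidClass.coe_finsetSum, Finset.sum_apply]
    rfl

/-- Composition with a diffeomorphism is continuous on smooth functions. -/
theorem normLE_compFn (N : ℕ) :
    ∃ C : ℝ, 0 ≤ C ∧ ∀ (f : TestFn n) (B : ℝ), NormLE N f B → NormLE N (χ.compFn f) (C * B) := by
  induction N with
  | zero =>
    refine ⟨1, zero_le_one, fun f B h i hi x => ?_⟩
    obtain rfl : i = 0 := by omega
    simpa [compFn] using h.sup (χ.toFun x)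
  | succ N ih =>
    obtain ⟨C, hC0, hC⟩ := ih
    choose A hA0 hA using fun l j => exists_normLE N (χ.entry l j)
    refine ⟨1 + n * ∑ j, ∑ l, 2 ^ N * A l j * C, ?_, fun f B h => ?_⟩
    · have : 0 ≤ ∑ j, ∑ l, 2 ^ N * A l j * C := Finset.sum_nonneg fun j _ =>
        Finset.sum_nonneg fun l _ => by have := hA0 l j; positivity
      positivity
    have hB := h.nonneg
    have h1 : ∀ j, NormLE N (partialFn j (χ.compFn f)) ((∑ j, ∑ l, 2 ^ N * A l j * C) * B) :=
      fun j => by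
        rw [partialFn_compFn]
        refine (NormLE.sum _ fun l _ => (hA l j).mul (hC _ _ (h.partialFn l))).mono le_rfl ?_
        have h2 := Finset.single_le_sum (f := fun j => ∑ l, 2 ^ N * A l j * C)
          (fun j _ => Finset.sum_nonneg fun l _ => by have := hA0 l j; positivity)
          (Finset.mem_univ j)
        refine le_trans (le_of_eq ?_) (mul_le_mul_of_nonneg_right h2 hB)
        rw [Finset.sum_mul]
        exact Finset.sum_congr rfl fun l _ => by ring
    have h0 : NormLE 0 (χ.compFn f) B := fun i hi x => by
      obtain rfl : i = 0 := by omega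
      simpa [compFn] using h.sup (χ.toFun x)
    refine (normLE_succ_of_partialFn h0 h1).mono le_rfl (le_of_eq ?_)
    ring

/-! ### The action on half-densities -/

/-- The action `f ↦ J^{1/2} f ∘ χ` of a diffeomorphism on half-densities, which preserves the
bilinear form `∫ f g`. -/
def pull : TestFn n ≃ₗ[ℂ] TestFn n where
  toFun f := χ.rootJac * χ.compFn f
  invFun f := χ.symm.compFn (χ.invRootJac * f)
  map_add' f g := by rw [map_add, mul_add]
  map_smul' c f := by rw [map_smul, mul_smul_comm, RingHom.id_apply]
  left_inv f := by
    beta_reduce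
    rw [← mul_assoc, mul_comm χ.invRootJac, rootJac_mul_invRootJac, one_mul, compFn_symm_compFn]
  right_inv f := by
    beta_reduce
    rw [compFn_compFn_symm, ← mul_assoc, rootJac_mul_invRootJac, one_mul]

theorem pull_eq (f : TestFn n) : χ.pull f = χ.rootJac * χ.compFn f := rfl

theorem pull_symm_eq (f : TestFn n) : χ.pull.symm f = χ.symm.compFn (χ.invRootJac * f) := rfl

theorem torusIntegral_jac_mul (f : TestFn n) :
    torusIntegral (χ.jac * χ.compFn f) = torusIntegral f := by
  rw [torusIntegral_apply, torusIntegral_apply, ← χ.integral_comp f.1 f.2.2]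
  refine integral_congr_ae (Eventually.of_forall fun x => ?_)
  change χ.jac.1 x * _ = _
  rw [jac_apply]
  rfl

theorem torusIntegral_pull_mul_pull (f g : TestFn n) :
    torusIntegral (χ.pull f * χ.pull g) = torusIntegral (f * g) := by
  rw [pull_eq, pull_eq, mul_mul_mul_comm, rootJac_mul_self, ← compFn_mul, torusIntegral_jac_mul]

theorem normLE_pull (N : ℕ) :
    ∃ C : ℝ, ∀ (f : TestFn n) (B : ℝ), NormLE N f B → NormLE N (χ.pull f) (C * B) := by
  obtain ⟨C, -, hC⟩ := χ.normLE_compFn N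
  obtain ⟨A, -, hA⟩ := exists_normLE N χ.rootJac
  refine ⟨2 ^ N * A * C, fun f B h => (hA.mul (hC f B h)).mono le_rfl (le_of_eq ?_)⟩
  ring

theorem normLE_pull_symm (N : ℕ) :
    ∃ C : ℝ, ∀ (f : TestFn n) (B : ℝ), NormLE N f B → NormLE N (χ.pull.symm f) (C * B) := by
  obtain ⟨C, -, hC⟩ := χ.symm.normLE_compFn N
  obtain ⟨A, -, hA⟩ := exists_normLE N χ.invRootJac
  refine ⟨C * (2 ^ N * A), fun f B h => (hC _ _ (hA.mul h)).mono le_rfl (le_of_eq ?_)⟩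
  ring

/-- The transpose of the action on half-densities: on smooth functions it is the inverse of
`pull`. -/
def transpose : Distr n ≃ₗ[ℂ] Distr n where
  toFun u := ⟨u.1 ∘ₗ χ.pull.toLinearMap, by
    obtain ⟨C, N, h⟩ := u.2
    obtain ⟨A, hA⟩ := χ.normLE_pull N
    exact ⟨C * A, N, fun φ B hB => by rw [mul_assoc]; exact h _ _ (hA φ B hB)⟩⟩
  invFun u := ⟨u.1 ∘ₗ χ.pull.symm.toLinearMap, by
    obtain ⟨C, N, h⟩ := u.2
    obtain ⟨A, hA⟩ := χ.normLE_pull_symm N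
    exact ⟨C * A, N, fun φ B hB => by rw [mul_assoc]; exact h _ _ (hA φ B hB)⟩⟩
  map_add' _ _ := rfl
  map_smul' _ _ := rfl
  left_inv u := Subtype.ext (LinearMap.ext fun φ => congrArg u.1 (χ.pull.apply_symm_apply φ))
  right_inv u := Subtype.ext (LinearMap.ext fun φ => congrArg u.1 (χ.pull.symm_apply_apply φ))

theorem transpose_apply (u : Distr n) (φ : TestFn n) : (χ.transpose u).1 φ = u.1 (χ.pull φ) := rfl

theorem transpose_symm_apply (u : Distr n) (φ : TestFn n) :
    (χ.transpose.symm u).1 φ = u.1 (χ.pull.symm φ) := rfl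

theorem transpose_ofTestFn (f : TestFn n) :
    χ.transpose (ofTestFn f) = ofTestFn (χ.pull.symm f) :=
  Subtype.ext (LinearMap.ext fun φ => by
    rw [transpose_apply, ofTestFn_apply, ofTestFn_apply, ← torusIntegral_pull_mul_pull χ _ φ,
      LinearEquiv.apply_symm_apply])

theorem transpose_symm_ofTestFn (f : TestFn n) :
    χ.transpose.symm (ofTestFn f) = ofTestFn (χ.pull f) := by
  rw [LinearEquiv.symm_apply_eq, transpose_ofTestFn, LinearEquiv.symm_apply_apply]

/-! ### Commutation with derivatives and Sobolev bounds -/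

/-- The logarithmic derivative `∂ⱼJ / (2J)` of the square root of the Jacobian. -/
def logDeriv (j : Fin n) : TestFn n := (1 / 2 : ℂ) • (partialFn j χ.jac * χ.invJac)

theorem partialFn_rootJac (j : Fin n) : partialFn j χ.rootJac = χ.logDeriv j * χ.rootJac := by
  have h := congrArg (partialFn j) χ.rootJac_mul_self
  rw [partialFn_mul] at h
  rw [logDeriv, ← h, invJac, smul_mul_assoc]
  have h1 := χ.rootJac_mul_invRootJac
  have h2 : (partialFn j χ.rootJac * χ.rootJac + χ.rootJac * partialFn j χ.rootJac) *
      (χ.invRootJac * χ.invRootJac) * χ.rootJac = (2 : ℂ) • partialFn j χ.rootJac := by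
    rw [two_smul]
    linear_combination
      (2 * partialFn j χ.rootJac * (χ.rootJac * χ.invRootJac + 1)) * h1
  rw [h2, smul_smul]
  norm_num

theorem partialFn_pull (j : Fin n) (f : TestFn n) :
    partialFn j (χ.pull f)
      = ∑ l, χ.entry l j * χ.pull (partialFn l f) + χ.logDeriv j * χ.pull f := by
  simp only [pull_eq]
  rw [partialFn_mul, partialFn_rootJac, partialFn_compFn, mul_assoc, add_comm, Finset.mul_sum]
  congr 1
  exact Finset.sum_congr rfl fun l _ => mul_left_comm _ _ _

/-- The inverse of the Jacobian matrix. -/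
def invEntry (j l : Fin n) : TestFn n := χ.invJac * χ.jacMatrix.adjugate j l

theorem sum_entry_mul_invEntry (i l : Fin n) :
    ∑ j, χ.entry i j * χ.invEntry j l = if i = l then 1 else 0 := by
  have h := congrFun (congrFun χ.jacMatrix.mul_adjugate i) l
  rw [Matrix.mul_apply, Matrix.smul_apply, Matrix.one_apply] at h
  have h2 := congrArg (fun z => χ.invJac * z) h
  simp only [Finset.mul_sum] at h2
  simp only [invEntry]
  calc _ = ∑ j, χ.invJac * (χ.jacMatrix i j * χ.jacMatrix.adjugate j l) :=
        Finset.sum_congr rfl fun j _ => mul_left_comm _ _ _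
    _ = _ := by
      rw [h2, smul_eq_mul, ← mul_assoc, mul_comm χ.invJac]
      change χ.jac * χ.invJac * _ = _
      rw [jac_mul_invJac, one_mul]

theorem pull_partialFn (l : Fin n) (f : TestFn n) :
    χ.pull (partialFn l f)
      = ∑ j, χ.invEntry j l * (partialFn j (χ.pull f) + -χ.logDeriv j * χ.pull f) := by
  have h : ∀ j, partialFn j (χ.pull f) + -χ.logDeriv j * χ.pull f
      = ∑ i, χ.entry i j * χ.pull (partialFn i f) := fun j => by rw [partialFn_pull]; ring
  simp only [h, Finset.mul_sum]
  rw [Finset.sum_comm]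
  have h2 : ∀ i, ∑ j, χ.invEntry j l * (χ.entry i j * χ.pull (partialFn i f))
      = (if i = l then 1 else 0) * χ.pull (partialFn i f) := fun i => by
    rw [← sum_entry_mul_invEntry, Finset.sum_mul]
    exact Finset.sum_congr rfl fun j _ => by ring
  simp [h2]

theorem hsq_zero_pull (f : TestFn n) : hsq 0 (χ.pull f) = hsq 0 f := by
  rw [hsq_zero, hsq_zero]
  congr 2
  apply Complex.ofReal_injective
  rw [← integral_complex_ofReal, ← integral_complex_ofReal,
    ← χ.integral_comp (fun x => ((‖f.1 x‖ ^ 2 : ℝ) : ℂ)) fun k x => by simp only [f.2.2]]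
  refine integral_congr_ae (Eventually.of_forall fun x => ?_)
  change ((‖((Real.sqrt (fderiv ℝ χ.toFun x).det : ℝ) : ℂ) * f.1 (χ.toFun x)‖ ^ 2 : ℝ) : ℂ)
    = ((fderiv ℝ χ.toFun x).det : ℂ) * ((‖f.1 (χ.toFun x)‖ ^ 2 : ℝ) : ℂ)
  rw [norm_mul, mul_pow, Complex.norm_real, Real.norm_of_nonneg (Real.sqrt_nonneg _),
    Real.sq_sqrt (χ.det_pos x).le, Complex.ofReal_mul]

end TorusDiffeo

section Families

variable {n : ℕ} {ι : Type*} {χ : ι → TorusDiffeo n}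

theorem ub_logDeriv (hE : ∀ l j, UB fun p => (χ p).entry l j) (hI : UB fun p => (χ p).invJac)
    (j : Fin n) : UB fun p => (χ p).logDeriv j :=
  (((UB.det (M := fun p => (χ p).jacMatrix) hE).partialFn j).mul hI).smul _

theorem ub_invEntry (hE : ∀ l j, UB fun p => (χ p).entry l j) (hI : UB fun p => (χ p).invJac)
    (j l : Fin n) : UB fun p => (χ p).invEntry j l :=
  hI.mul (UB.adjugate (M := fun p => (χ p).jacMatrix) hE j l)

/-- The action on half-densities is bounded on every integer Sobolev space, uniformly in a family
of diffeomorphisms: it commutes with derivatives up to bounded coefficients. -/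
theorem dom_hsq_pull (hE : ∀ l j, UB fun p => (χ p).entry l j) (hI : UB fun p => (χ p).invJac)
    (N : ℕ) : Dom (fun a : ι × TestFn n => hsq N ((χ a.1).pull a.2)) (fun a => hsq N a.2) := by
  induction N with
  | zero => exact Dom.of_le fun a => ((χ a.1).hsq_zero_pull a.2).le
  | succ N ih =>
    simp only [hsq_succ N ((χ _).pull _), TorusDiffeo.partialFn_pull]
    have h0 : Dom (fun a : ι × TestFn n => hsq N ((χ a.1).pull a.2)) (fun a => hsq (N + 1) a.2) :=
      ih.trans (Dom.of_le fun a => hsq_mono (Nat.le_succ N) _)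
    refine Dom.add h0 (Dom.sum _ fun j => Dom.hsq_add (Dom.hsq_sum fun l => ?_) ?_)
    · refine ((dom_hsq_mul (hE l j) N).comp fun a : ι × TestFn n =>
        (a.1, (χ a.1).pull (partialFn l a.2))).trans ?_
      exact (ih.comp fun a : ι × TestFn n => (a.1, partialFn l a.2)).trans
        (Dom.of_le fun a => hsq_partialFn_le N l _)
    · exact ((dom_hsq_mul (ub_logDeriv hE hI j) N).comp fun a : ι × TestFn n =>
        (a.1, (χ a.1).pull a.2)).trans h0

theorem dom_hsq_pull_symm (hE : ∀ l j, UB fun p => (χ p).entry l j)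
    (hI : UB fun p => (χ p).invJac) (N : ℕ) :
    Dom (fun a : ι × TestFn n => hsq N ((χ a.1).pull.symm a.2)) (fun a => hsq N a.2) := by
  suffices h : Dom (fun a : ι × TestFn n => hsq N a.2) (fun a => hsq N ((χ a.1).pull a.2)) by
    simpa using h.comp fun a : ι × TestFn n => (a.1, (χ a.1).pull.symm a.2)
  induction N with
  | zero => exact Dom.of_le fun a => ((χ a.1).hsq_zero_pull a.2).ge
  | succ N ih =>
    simp only [hsq_succ N (Prod.snd _)]
    have h0 : Dom (fun a : ι × TestFn n => hsq N ((χ a.1).pull a.2))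
        (fun a => hsq (N + 1) ((χ a.1).pull a.2)) := Dom.of_le fun a => hsq_mono (Nat.le_succ N) _
    refine Dom.add (ih.trans h0) (Dom.sum _ fun l => ?_)
    refine (ih.comp fun a : ι × TestFn n => (a.1, partialFn l a.2)).trans ?_
    simp only [TorusDiffeo.pull_partialFn]
    refine Dom.hsq_sum fun j => ?_
    refine ((dom_hsq_mul (ub_invEntry hE hI j l) N).comp fun a : ι × TestFn n =>
      (a.1, partialFn j ((χ a.1).pull a.2) + -(χ a.1).logDeriv j * (χ a.1).pull a.2)).trans
      (Dom.hsq_add ?_ ?_)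
    · exact Dom.of_le fun a => hsq_partialFn_le N j _
    · exact ((dom_hsq_mul (ub_logDeriv hE hI j).neg N).comp fun a : ι × TestFn n =>
        (a.1, (χ a.1).pull a.2)).trans h0

/-- Uniform bounds on `H^σ` for the action on distributions; the constant depends on `⌈σ⌉` only. -/
theorem exists_sobolevSq_bound (hE : ∀ l j, UB fun p => (χ p).entry l j)
    (hI : UB fun p => (χ p).invJac) (N : ℕ) :
    ∃ K : ℝ≥0, ∀ p (σ : ℝ), 0 ≤ σ → σ ≤ N → ∀ u : Distr n,
      sobolevSq σ ((χ p).transpose u) ≤ K * sobolevSq σ u ∧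
      sobolevSq σ ((χ p).transpose.symm u) ≤ K * sobolevSq σ u := by
  obtain ⟨K, hK⟩ := dom_hsq_pull hE hI N
  obtain ⟨K', hK'⟩ := dom_hsq_pull_symm hE hI N
  have hle : ∀ a b : ℝ≥0, (a : ℝ≥0∞) ≤ ((1 + a + b : ℝ≥0) : ℝ≥0∞) := fun a b => by
    exact_mod_cast le_add_right le_add_self
  have hle' : ∀ a b : ℝ≥0, (b : ℝ≥0∞) ≤ ((1 + a + b : ℝ≥0) : ℝ≥0∞) := fun a b => by
    exact_mod_cast le_add_self
  have h1 : (1 : ℝ≥0∞) ≤ ((1 + K + K' : ℝ≥0) : ℝ≥0∞) := by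
    exact_mod_cast le_add_right le_self_add
  refine ⟨1 + K + K', fun p σ hσ hσN u => ⟨?_, ?_⟩⟩
  · refine sobolevSq_interpolate (T := (χ p).transpose.toLinearMap) (fun u => ?_) (fun u => ?_) h1
      ENNReal.coe_ne_top hσ hσN u
    · have := sobolevSq_le_of_hsq_le (T := (χ p).transpose) (fun _ _ => rfl)
        (χ p).transpose_ofTestFn (N := 0) (K := 1)
        (fun f => by
          have := (χ p).hsq_zero_pull ((χ p).pull.symm f)
          rw [LinearEquiv.apply_symm_apply] at this
          rw [one_mul, this]) u
      simp only [Nat.cast_zero] at this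
      exact this.trans (mul_le_mul_left h1 _)
    · exact (sobolevSq_le_of_hsq_le (T := (χ p).transpose) (fun _ _ => rfl)
        (χ p).transpose_ofTestFn (fun f => hK' (p, f)) u).trans (mul_le_mul_left (hle' K K') _)
  · refine sobolevSq_interpolate (T := (χ p).transpose.symm.toLinearMap) (fun u => ?_)
      (fun u => ?_) h1 ENNReal.coe_ne_top hσ hσN u
    · have := sobolevSq_le_of_hsq_le (T := (χ p).transpose.symm) (fun _ _ => rfl)
        (χ p).transpose_symm_ofTestFn (N := 0) (K := 1)
        (fun f => by rw [one_mul, (χ p).hsq_zero_pull]) u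
      simp only [Nat.cast_zero] at this
      exact this.trans (mul_le_mul_left h1 _)
    · exact (sobolevSq_le_of_hsq_le (T := (χ p).transpose.symm) (fun _ _ => rfl)
        (χ p).transpose_symm_ofTestFn (fun f => hK (p, f)) u).trans (mul_le_mul_left (hle K K') _)

end Families

theorem sobolevOpNorm_le {n : ℕ} {T : Distr n →ₗ[ℂ] Distr n} {σ : ℝ} {K : ℝ≥0}
    (h : ∀ u, sobolevSq σ (T u) ≤ K * sobolevSq σ u) :
    sobolevOpNorm σ T ≤ ENNReal.ofReal (Real.sqrt K) := by
  refine iSup₂_le fun u hu => ?_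
  rw [sobolevNorm_eq] at hu ⊢
  calc _ ≤ (K * (ENNReal.ofReal ((2 * Real.pi) ^ n) * sobolevSq σ u)) ^ (1 / 2 : ℝ) := by
        rw [mul_left_comm]
        gcongr
        exact h u
    _ = (K : ℝ≥0∞) ^ (1 / 2 : ℝ) *
          (ENNReal.ofReal ((2 * Real.pi) ^ n) * sobolevSq σ u) ^ (1 / 2 : ℝ) :=
        ENNReal.mul_rpow_of_nonneg _ _ (by norm_num)
    _ ≤ (K : ℝ≥0∞) ^ (1 / 2 : ℝ) * 1 := by gcongr
    _ = ENNReal.ofReal (Real.sqrt K) := by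
        rw [mul_one, Real.sqrt_eq_rpow,
          ← ENNReal.ofReal_rpow_of_nonneg (NNReal.coe_nonneg K) (by norm_num),
          ENNReal.ofReal_coe_nnreal]

/-! ### Smooth dependence on parameters -/

section Parameters

variable {E : Type} [NormedAddCommGroup E] [NormedSpace ℝ E]

theorem hasFDerivAt_parametric_integral [FiniteDimensional ℝ E] {G : Type}
    [NormedAddCommGroup G] [NormedSpace ℝ G]
    {F : E × ℝ → G} (hF : ContDiff ℝ ∞ F) (a b : ℝ) (x₀ : E) :
    HasFDerivAt (fun x => ∫ s in a..b, F (x, s))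
      (∫ s in a..b, (fderiv ℝ F (x₀, s)).comp (ContinuousLinearMap.inl ℝ E ℝ)) x₀ := by
  have hF' : Continuous fun p : E × ℝ =>
      (fderiv ℝ F p).comp (ContinuousLinearMap.inl ℝ E ℝ) :=
    (hF.continuous_fderiv (by simp)).clm_comp continuous_const
  have hs : ∀ x : E, Continuous fun s : ℝ => (x, s) := fun x => by fun_prop
  have : ProperSpace E := FiniteDimensional.proper ℝ E
  obtain ⟨B, hB⟩ := ((isCompact_closedBall x₀ 1).prod
    (isCompact_uIcc (a := a) (b := b))).exists_bound_of_continuousOn hF'.continuousOn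
  refine intervalIntegral.hasFDerivAt_integral_of_dominated_of_fderiv_le
    (F' := fun x s => (fderiv ℝ F (x, s)).comp (ContinuousLinearMap.inl ℝ E ℝ))
    (bound := fun _ => B) (Metric.closedBall_mem_nhds x₀ one_pos)
    (Eventually.of_forall fun x => (hF.continuous.comp (hs x)).aestronglyMeasurable)
    ((hF.continuous.comp (hs x₀)).intervalIntegrable _ _)
    (hF'.comp (hs x₀)).aestronglyMeasurable
    (Eventually.of_forall fun s hs x hx => hB (x, s) ⟨hx, uIoc_subset_uIcc hs⟩)
    (continuous_const.intervalIntegrable _ _)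
    (Eventually.of_forall fun s _ x _ => ?_)
  have h1 : HasFDerivAt (fun x : E => (x, s)) (ContinuousLinearMap.inl ℝ E ℝ) x :=
    hasFDerivAt_prodMk_left x s
  exact (hF.differentiable (by simp) (x, s)).hasFDerivAt.comp x h1

theorem contDiff_parametric_integral [FiniteDimensional ℝ E] {G : Type}
    [NormedAddCommGroup G] [NormedSpace ℝ G]
    {F : E × ℝ → G} (hF : ContDiff ℝ ∞ F) (a b : ℝ) :
    ContDiff ℝ ∞ fun x => ∫ s in a..b, F (x, s) := by
  rw [contDiff_infty]
  intro m
  induction m generalizing G with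
  | zero =>
    rw [Nat.cast_zero, contDiff_zero]
    exact continuous_iff_continuousAt.mpr fun x =>
      (hasFDerivAt_parametric_integral hF a b x).continuousAt
  | succ m ih =>
    rw [Nat.cast_succ, contDiff_succ_iff_hasFDerivAt]
    refine ⟨_, ?_, fun x => hasFDerivAt_parametric_integral hF a b x⟩
    exact ih ((hF.fderiv_right (m := ∞) (by simp)).clm_comp contDiff_const)

/-- The quotient `(F(h, x) - F(0, x)) / h`, extended smoothly to `h = 0`. -/
def hadamard {G : Type} [NormedAddCommGroup G] [NormedSpace ℝ G] (F : ℝ × E → G) (p : ℝ × E) : G :=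
  ∫ s in (0 : ℝ)..1, fderiv ℝ F (s * p.1, p.2) (1, 0)

variable {G : Type} [NormedAddCommGroup G] [NormedSpace ℝ G] {F : ℝ × E → G}

theorem contDiff_hadamard [FiniteDimensional ℝ E] (hF : ContDiff ℝ ∞ F) :
    ContDiff ℝ ∞ (hadamard F) := by
  have h1 : ContDiff ℝ ∞ fun q : (ℝ × E) × ℝ => (q.2 * q.1.1, q.1.2) := by fun_prop
  have h2 : ContDiff ℝ ∞ fun q : (ℝ × E) × ℝ =>
      fderiv ℝ F (q.2 * q.1.1, q.1.2) ((1, 0) : ℝ × E) :=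
    ((hF.fderiv_right (m := ∞) (by simp)).comp h1).clm_apply contDiff_const
  exact contDiff_parametric_integral h2 0 1

theorem hasDerivAt_fst (hF : ContDiff ℝ ∞ F) (h : ℝ) (x : E) :
    HasDerivAt (fun s => F (s, x)) (fderiv ℝ F (h, x) (1, 0)) h := by
  have h1 : HasDerivAt (fun s : ℝ => (s, x)) ((1 : ℝ), (0 : E)) h :=
    (hasDerivAt_id h).prodMk (hasDerivAt_const h x)
  exact (hF.differentiable (by simp) (h, x)).hasFDerivAt.comp_hasDerivAt h h1

theorem smul_hadamard [CompleteSpace G] (hF : ContDiff ℝ ∞ F) (h : ℝ) (x : E) :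
    h • hadamard F (h, x) = F (h, x) - F (0, x) := by
  have h1 : ∀ s ∈ uIcc (0 : ℝ) 1, HasDerivAt (fun s => F (s * h, x))
      (h • fderiv ℝ F (s * h, x) (1, 0)) s := fun s _ => by
    have := (hasDerivAt_fst hF (s * h) x).scomp s (hasDerivAt_mul_const h)
    exact this
  have h2 : Continuous fun s : ℝ => h • fderiv ℝ F (s * h, x) ((1, 0) : ℝ × E) := by
    have h3 : Continuous fun s : ℝ => (s * h, x) := by fun_prop
    exact (((hF.continuous_fderiv (by simp)).comp h3).clm_apply continuous_const).const_smul h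
  have h4 := intervalIntegral.integral_eq_sub_of_hasDerivAt h1 (h2.intervalIntegrable _ _)
  simp only [one_mul, zero_mul] at h4
  rw [← h4, hadamard, intervalIntegral.integral_smul]

theorem hadamard_zero [CompleteSpace G] (x : E) :
    hadamard F (0, x) = fderiv ℝ F (0, x) (1, 0) := by
  simp [hadamard]

theorem hadamard_add (τ : E) (hF : ∀ h x, F (h, x + τ) = F (h, x)) (h : ℝ) (x : E) :
    hadamard F (h, x + τ) = hadamard F (h, x) := by
  have h1 : ∀ p, fderiv ℝ F (p + (0, τ)) = fderiv ℝ F p := fun p => by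
    rw [← fderiv_comp_add_right]
    congr 1
    funext q
    rw [← Prod.mk.eta (p := q), Prod.mk_add_mk, add_zero, hF]
  simp only [hadamard]
  refine intervalIntegral.integral_congr fun s _ => ?_
  have := h1 (s * h, x)
  rw [Prod.mk_add_mk, add_zero] at this
  simp only [this]

theorem iteratedFDeriv_add_period {G' E' : Type*} [NormedAddCommGroup G'] [NormedSpace ℝ G']
    [NormedAddCommGroup E'] [NormedSpace ℝ E'] {f : E' → G'} {τ : E'} (h : ∀ x, f (x + τ) = f x)
    (i : ℕ) (x : E') : iteratedFDeriv ℝ i f (x + τ) = iteratedFDeriv ℝ i f x := by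
  have h1 := iteratedFDeriv_comp_add_right (𝕜 := ℝ) (f := f) i τ x
  rw [← h1]
  simp only [h]

/-- Compactness bounds for the derivatives of the members of a smooth family. -/
theorem exists_bound_slice {P E' G' : Type*} [NormedAddCommGroup P] [NormedSpace ℝ P]
    [NormedAddCommGroup E'] [NormedSpace ℝ E'] [NormedAddCommGroup G'] [NormedSpace ℝ G']
    {F : P × E' → G'} (hF : ContDiff ℝ ∞ F) {K : Set P} (hK : IsCompact K) {C : Set E'}
    (hC : IsCompact C) (i : ℕ) :
    ∃ B, ∀ p ∈ K, ∀ x ∈ C, ‖iteratedFDeriv ℝ i (fun y => F (p, y)) x‖ ≤ B := by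
  obtain ⟨B, hB⟩ := (hK.prod hC).exists_bound_of_continuousOn
    (hF.continuous_iteratedFDeriv (m := i) (by exact_mod_cast le_top)).continuousOn
  refine ⟨B, fun p hp x hx => le_trans ?_ (hB (p, x) ⟨hp, hx⟩)⟩
  have h1 : (fun y => F (p, y))
      = (fun q => F (q + (p, 0))) ∘ ContinuousLinearMap.inr ℝ P E' := by
    funext y
    simp
  have h2 : ContDiff ℝ ∞ fun q => F (q + (p, 0)) := hF.comp (contDiff_id.add contDiff_const)
  rw [h1, ContinuousLinearMap.iteratedFDeriv_comp_right _ h2 x (i := i) (by exact_mod_cast le_top),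
    iteratedFDeriv_comp_add_right]
  refine (ContinuousMultilinearMap.norm_compContinuousLinearMap_le _ _).trans ?_
  have h3 : (ContinuousLinearMap.inr ℝ P E') x + (p, 0) = (p, x) := by simp
  rw [h3]
  refine mul_le_of_le_one_right (norm_nonneg _) ?_
  exact Finset.prod_le_one (fun _ _ => norm_nonneg _) fun _ _ =>
    ContinuousLinearMap.norm_inr_le_one ℝ P E'

end Parameters

theorem exists_shift_mem_cube {n : ℕ} (x : Fin n → ℝ) : ∃ k, shift x k ∈ cube n := by
  have hp : (0 : ℝ) < 2 * Real.pi := by positivity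
  refine ⟨fun j => -toIcoDiv hp 0 (x j), ?_⟩
  have hj : ∀ j, shift x (fun j => -toIcoDiv hp 0 (x j)) j = toIcoMod hp 0 (x j) := fun j => by
    simp only [shift, toIcoMod, zsmul_eq_mul]
    push_cast
    ring
  refine ⟨fun j => ?_, fun j => ?_⟩
  · rw [hj]
    exact (toIcoMod_mem_Ico hp 0 (x j)).1
  · rw [hj]
    simpa using (toIcoMod_mem_Ico hp 0 (x j)).2.le

/-- The member at the parameter `p` of a smooth family of functions on the torus. -/
def slice {P : Type*} [NormedAddCommGroup P] [NormedSpace ℝ P] {n : ℕ}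
    (F : P × (Fin n → ℝ) → ℂ) (hF : ContDiff ℝ ∞ F)
    (hp : ∀ p k x, F (p, shift x k) = F (p, x)) (p : P) : TestFn n :=
  ⟨fun x => F (p, x), hF.comp (contDiff_const.prodMk contDiff_id), hp p⟩

theorem exists_normLE_slice {P : Type*} [NormedAddCommGroup P] [NormedSpace ℝ P] {n : ℕ}
    {F : P × (Fin n → ℝ) → ℂ} (hF : ContDiff ℝ ∞ F) (hp : ∀ p k x, F (p, shift x k) = F (p, x))
    {K : Set P} (hK : IsCompact K) (N : ℕ) : ∃ A, ∀ p ∈ K, NormLE N (slice F hF hp p) A := by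
  choose B hB using fun i : ℕ => exists_bound_slice hF hK (C := cube n) isCompact_Icc i
  refine ⟨∑ i ∈ Finset.range (N + 1), |B i|, fun p hpK i hi x => ?_⟩
  obtain ⟨k, hk⟩ := exists_shift_mem_cube x
  have h1 : iteratedFDeriv ℝ i (slice F hF hp p).1 (shift x k)
      = iteratedFDeriv ℝ i (slice F hF hp p).1 x := by
    rw [shift_eq]
    refine iteratedFDeriv_add_period (fun y => ?_) i x
    rw [← shift_eq]
    exact hp p k y
  rw [← h1]
  exact ((hB i p hpK _ hk).trans (le_abs_self _)).trans
    (Finset.single_le_sum (f := fun i => |B i|) (fun _ _ => abs_nonneg _)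
      (Finset.mem_range.mpr (by omega)))

/-! ### Uniform boundedness and the product rule -/

/-- A sequence of smooth functions with `C^N` norm of the `N`-th one at most `1` is bounded in every
`C^i`, so its `ℓ¹` combinations converge in `C^∞`. -/
theorem exists_lOne_combination {n : ℕ} (ψ : ℕ → TestFn n) (hψ : ∀ N, NormLE N (ψ N) 1) :
    ∃ L : lp (fun _ : ℕ => ℂ) 1 →ₗ[ℂ] TestFn n,
      (∀ N, L (lp.single 1 N 1) = ψ N) ∧ ∀ i, ∃ D, ∀ b, NormLE i (L b) (D * ‖b‖) := by
  have hD : ∀ i, ∃ D : ℝ, 0 ≤ D ∧ ∀ N, NormLE i (ψ N) D := fun i => by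
    choose A hA0 hA using fun N => exists_normLE i (ψ N)
    refine ⟨1 + ∑ N ∈ Finset.range i, A N,
      add_nonneg zero_le_one (Finset.sum_nonneg fun N _ => hA0 N), fun N => ?_⟩
    by_cases h : i ≤ N
    · exact (hψ N).mono h (le_add_of_nonneg_right (Finset.sum_nonneg fun N _ => hA0 N))
    · refine (hA N).mono le_rfl ?_
      have := Finset.single_le_sum (f := A) (fun N _ => hA0 N)
        (Finset.mem_range.mpr (not_le.mp h))
      linarith
  choose D hD0 hD using hD
  have hb : ∀ b : lp (fun _ : ℕ => ℂ) 1, HasSum (fun N => ‖b N‖) ‖b‖ := fun b => by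
    simpa using lp.hasSum_norm (p := 1) (by simp) b
  have hbound : ∀ (b : lp (fun _ : ℕ => ℂ) 1) (i N : ℕ) (x : Fin n → ℝ),
      ‖iteratedFDeriv ℝ i (b N • ψ N : TestFn n).1 x‖ ≤ ‖b N‖ * D i := fun b i N x =>
    (hD i N).smul (b N) i le_rfl x
  have hsum : ∀ (b : lp (fun _ : ℕ => ℂ) 1) (i : ℕ), HasSum (fun N => ‖b N‖ * D i) (D i * ‖b‖) :=
    fun b i => by simpa [mul_comm] using (hb b).mul_right (D i)
  have hpt : ∀ (b : lp (fun _ : ℕ => ℂ) 1) (x : Fin n → ℝ),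
      Summable fun N => (b N • ψ N : TestFn n).1 x := fun b x =>
    Summable.of_norm_bounded (hsum b 0).summable fun N => by simpa using hbound b 0 N x
  let L : lp (fun _ : ℕ => ℂ) 1 →ₗ[ℂ] TestFn n :=
    { toFun := fun b => ⟨fun x => ∑' N, (b N • ψ N : TestFn n).1 x,
        contDiff_tsum (N := ⊤) (v := fun i N => ‖b N‖ * D i) (fun N => (b N • ψ N : TestFn n).2.1)
          (fun i _ => (hsum b i).summable) (fun i N x _ => hbound b i N x),
        fun k x => by simp only [(_ : TestFn n).2.2 k x]⟩
      map_add' := fun b c => testFn_ext fun x => by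
        have := (hpt b x).tsum_add (hpt c x)
        refine Eq.trans (tsum_congr fun N => ?_) this
        exact add_mul (b N) (c N) ((ψ N).1 x)
      map_smul' := fun a b => testFn_ext fun x => by
        refine Eq.trans (tsum_congr fun N => ?_) (tsum_mul_left (a := a))
        exact mul_assoc a (b N) ((ψ N).1 x) }
  refine ⟨L, fun N => testFn_ext fun x => ?_, fun i => ⟨∑ j ∈ Finset.range (i + 1), D j,
    fun b j hj x => ?_⟩⟩
  · change ∑' M, (lp.single 1 N (1 : ℂ) : lp (fun _ : ℕ => ℂ) 1) M * (ψ M).1 x = (ψ N).1 x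
    rw [tsum_eq_single N fun M hM => by rw [lp.single_apply_ne _ _ _ hM, zero_mul]]
    simp
  · have h1 : iteratedFDeriv ℝ j (L b).1 x = ∑' N, iteratedFDeriv ℝ j (b N • ψ N : TestFn n).1 x :=
      iteratedFDeriv_tsum_apply (N := ⊤) (v := fun i N => ‖b N‖ * D i)
        (fun N => (b N • ψ N : TestFn n).2.1)
        (fun i _ => (hsum b i).summable) (fun i N x _ => hbound b i N x) le_top x
    rw [h1]
    refine (tsum_of_norm_bounded (hsum b j) fun N => hbound b j N x).trans ?_
    refine mul_le_mul_of_nonneg_right ?_ (norm_nonneg b)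
    exact Finset.single_le_sum (f := D) (fun j _ => hD0 j) (Finset.mem_range.mpr (by omega))

/-- Uniform boundedness on the Fréchet space `C^∞`: a pointwise bounded family of distributions is
bounded by a single `C^N` norm. Otherwise there are `ψ_N` of `C^N` norm at most `1` on which the
family exceeds `N`, and the Banach-Steinhaus theorem fails on the space of their `ℓ¹`
combinations. -/
theorem distr_uniform_bound {n : ℕ} {ι : Type*} (u : ι → Distr n)
    (h : ∀ φ, ∃ C, ∀ s, ‖(u s).1 φ‖ ≤ C) :
    ∃ (C : ℝ) (N : ℕ), ∀ s φ B, NormLE N φ B → ‖(u s).1 φ‖ ≤ C * B := by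
  by_contra! hcon
  have hψ : ∀ N : ℕ, ∃ s, ∃ ψ : TestFn n, NormLE N ψ 1 ∧ (N : ℝ) < ‖(u s).1 ψ‖ := fun N => by
    obtain ⟨s, φ, B, hB, hlt⟩ := hcon N N
    rcases hB.nonneg.eq_or_lt with rfl | hpos
    · have : φ = 0 := testFn_ext fun x => norm_le_zero_iff.mp (hB.sup x)
      rw [this, map_zero] at hlt
      simp at hlt
    · refine ⟨s, ((B⁻¹ : ℝ) : ℂ) • φ, (hB.smul _).mono le_rfl ?_, ?_⟩
      · rw [Complex.norm_real, Real.norm_of_nonneg (by positivity), inv_mul_cancel₀ hpos.ne']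
      · rw [map_smul, smul_eq_mul, norm_mul, Complex.norm_real, Real.norm_of_nonneg (by positivity),
          lt_inv_mul_iff₀ hpos, mul_comm]
        exact hlt
  choose s ψ hψ1 hψ2 using hψ
  obtain ⟨L, hL, hLb⟩ := exists_lOne_combination ψ hψ1
  have hT : ∀ i, ∃ T : lp (fun _ : ℕ => ℂ) 1 →L[ℂ] ℂ, ∀ b, T b = (u i).1 (L b) := fun i => by
    obtain ⟨C, N, hC⟩ := (u i).2
    obtain ⟨D, hD⟩ := hLb N
    exact ⟨((u i).1 ∘ₗ L).mkContinuous (C * D) fun b => by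
      rw [mul_assoc]; exact hC _ _ (hD b), fun b => rfl⟩
  choose T hT using hT
  obtain ⟨C', hC'⟩ := banach_steinhaus (g := T) fun b => by
    obtain ⟨C, hC⟩ := h (L b)
    exact ⟨C, fun i => by rw [hT]; exact hC i⟩
  obtain ⟨N, hN⟩ := exists_nat_gt C'
  have h1 := (T (s N)).le_of_opNorm_le (hC' (s N)) (lp.single 1 N 1)
  rw [hT, hL] at h1
  have h2 : ‖(lp.single 1 N (1 : ℂ) : lp (fun _ : ℕ => ℂ) 1)‖ = 1 := by
    rw [lp.norm_single (by simp)]; simp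
  rw [h2, mul_one] at h1
  linarith [hψ2 N]

/-- The product rule for the pairing of a differentiable curve of distributions with a smooth
family of test functions. The second order Taylor remainder of the family is bounded in every `C^N`
and the curve is locally equicontinuous, so the remainder does not contribute. -/
theorem hasDerivAt_pairing {n : ℕ} {u w : ℝ → Distr n} (hu : HasTimeDeriv u w)
    {F : ℝ × (Fin n → ℝ) → ℂ} (hF : ContDiff ℝ ∞ F) (hp : ∀ p k x, F (p, shift x k) = F (p, x))
    (t : ℝ) (ψ' : TestFn n) (hψ' : ∀ x, ψ'.1 x = fderiv ℝ F (t, x) (1, 0)) :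
    HasDerivAt (fun s => (u s).1 (slice F hF hp s))
      ((w t).1 (slice F hF hp t) + (u t).1 ψ') t := by
  let G : ℝ × (Fin n → ℝ) → ℂ := fun p => F (p.1 + t, p.2)
  have hG : ContDiff ℝ ∞ G :=
    hF.comp ((contDiff_fst.add contDiff_const).prodMk contDiff_snd)
  have hGp : ∀ k h x, G (h, x + shift 0 k) = G (h, x) := fun k h x => by
    rw [← shift_eq]; exact hp _ k x
  have hR1 := contDiff_hadamard hG
  have hR1p : ∀ k h x, hadamard G (h, x + shift 0 k) = hadamard G (h, x) := fun k =>
    hadamard_add _ (hGp k)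
  have hR2 := contDiff_hadamard hR1
  have hR2p : ∀ h k x, hadamard (hadamard G) (h, shift x k) = hadamard (hadamard G) (h, x) :=
    fun h k x => by rw [shift_eq]; exact hadamard_add _ (hR1p k) h x
  let R : ℝ → TestFn n := slice (hadamard (hadamard G)) hR2 hR2p
  have hexp : ∀ h, slice F hF hp (h + t)
      = slice F hF hp t + (h : ℂ) • ψ' + ((h : ℂ) ^ 2) • R h := fun h => testFn_ext fun x => by
    have h1 := smul_hadamard hG h x
    have h2 := smul_hadamard hR1 h x
    have h3 : hadamard G (0, x) = ψ'.1 x := by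
      rw [hadamard_zero, hψ']
      have h4 := hasDerivAt_fst hG 0 x
      have h5 : HasDerivAt (fun s => F (s + t, x)) (fderiv ℝ F (0 + t, x) (1, 0)) 0 := by
        have := hasDerivAt_fst hF (0 + t) x
        exact this.comp_add_const 0 t
      rw [h4.unique h5, zero_add]
    change F (h + t, x) = F (t, x) + (h : ℂ) * ψ'.1 x + (h : ℂ) ^ 2 * hadamard (hadamard G) (h, x)
    rw [← h3]
    simp only [Complex.real_smul] at h1 h2
    have h6 : G (0, x) = F (t, x) := by simp [G]
    rw [h6] at h1
    change _ = F (h + t, x) - _ at h1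
    linear_combination -h1 - (h : ℂ) * h2
  choose A hA using exists_normLE_slice hR2 hR2p (isCompact_Icc (a := (-1 : ℝ)) (b := 1))
  obtain ⟨C, N, hC⟩ := distr_uniform_bound (fun h : Icc (-1 : ℝ) 1 => u (h + t)) fun φ => by
    have hc : Continuous fun s => (u s).1 φ :=
      continuous_iff_continuousAt.mpr fun s => (hu φ s).continuousAt
    obtain ⟨B, hB⟩ := (isCompact_Icc (a := (-1 : ℝ)) (b := 1)).exists_bound_of_continuousOn
      (f := fun h : ℝ => (u (h + t)).1 φ)
      (hc.comp (continuous_id.add continuous_const)).continuousOn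
    exact ⟨B, fun h => hB h h.2⟩
  have hrem : HasDerivAt (fun h : ℝ => ((h : ℂ) ^ 2) * (u (h + t)).1 (R h)) 0 0 := by
    have h1 : (fun h : ℝ => ((h : ℂ) ^ 2) * (u (h + t)).1 (R h))
        =O[𝓝 0] fun h : ℝ => ‖h - 0‖ ^ 2 := by
      refine Asymptotics.IsBigO.of_bound (C * A N) ?_
      filter_upwards [Icc_mem_nhds (by norm_num : (-1 : ℝ) < 0) one_pos] with h hh
      have h2 := hC ⟨h, hh⟩ (R h) (A N) (hA N h hh)
      rw [norm_mul, norm_pow, Complex.norm_real, norm_pow, norm_norm, sub_zero, mul_comm]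
      gcongr
    have := (h1.hasFDerivAt one_lt_two).hasDerivAt
    simpa using this
  have hu' : ∀ φ, HasDerivAt (fun h => (u (h + t)).1 φ) ((w t).1 φ) 0 := fun φ => by
    have h1 := hu φ (0 + t)
    rw [zero_add] at h1
    exact HasDerivAt.comp_add_const 0 t (by simpa using h1)
  have hid : HasDerivAt (fun h : ℝ => (h : ℂ)) 1 0 := Complex.ofRealCLM.hasDerivAt
  have hmain := ((hu' (slice F hF hp t)).add (hid.mul (hu' ψ'))).add hrem
  have hfun : ∀ h : ℝ, (u (h + t)).1 (slice F hF hp (h + t))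
      = (u (h + t)).1 (slice F hF hp t) + (h : ℂ) * (u (h + t)).1 ψ'
        + (h : ℂ) ^ 2 * (u (h + t)).1 (R h) := fun h => by
    rw [hexp, map_add, map_add, map_smul, map_smul, smul_eq_mul, smul_eq_mul]
  have hfin : HasDerivAt (fun h : ℝ => (u (h + t)).1 (slice F hF hp (h + t)))
      ((w t).1 (slice F hF hp t) + (u t).1 ψ') 0 := by
    refine (hmain.congr_of_eventuallyEq (Eventually.of_forall hfun)).congr_deriv ?_
    simp
  have h7 := HasDerivAt.comp_sub_const t t (f := fun h : ℝ =>
    (u (h + t)).1 (slice F hF hp (h + t))) (by rw [sub_self]; exact hfin)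
  simpa using h7

/-! ### First order operators of vector fields -/

/-- The operator `u ↦ Y(t,·)·∇u + ½ div(Y(t,·)) u` on distributions. -/
def fieldOp {n : ℕ} (Y : TorusField n) (t : ℝ) (u : Distr n) : Distr n :=
  (∑ j, mulDistr (Y.component t j) (partialDistr j u)) + (1 / 2 : ℂ) • mulDistr (Y.div t) u

/-- The transpose `φ ↦ -(Y(t,·)·∇φ + ½ div(Y(t,·)) φ)` of `fieldOp`. -/
def fieldDual {n : ℕ} (Y : TorusField n) (t : ℝ) (φ : TestFn n) : TestFn n :=
  -((∑ j, Y.component t j * partialFn j φ) + (1 / 2 : ℂ) • (Y.div t * φ))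

theorem mulDistr_apply {n : ℕ} (a : TestFn n) (u : Distr n) (φ : TestFn n) :
    (mulDistr a u).1 φ = u.1 (a * φ) := rfl

theorem partialDistr_apply {n : ℕ} (j : Fin n) (u : Distr n) (φ : TestFn n) :
    (partialDistr j u).1 φ = -u.1 (partialFn j φ) := rfl

theorem distr_sum_apply {n : ℕ} {ι : Type*} (s : Finset ι) (u : ι → Distr n) (φ : TestFn n) :
    (∑ i ∈ s, u i).1 φ = ∑ i ∈ s, (u i).1 φ := by
  rw [AddSubmonoidClass.coe_finsetSum, LinearMap.sum_apply]

theorem fieldOp_apply {n : ℕ} (Y : TorusField n) (t : ℝ) (u : Distr n) (φ : TestFn n) :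
    (fieldOp Y t u).1 φ = u.1 (fieldDual Y t φ) := by
  change (∑ j, mulDistr (Y.component t j) (partialDistr j u)).1 φ + (1 / 2 : ℂ) * u.1 (Y.div t * φ)
    = _
  rw [distr_sum_apply]
  simp only [mulDistr_apply, partialDistr_apply, partialFn_mul, map_add, fieldDual, map_neg,
    map_sum, map_smul, smul_eq_mul]
  simp only [TorusField.div, Finset.sum_mul, map_sum, neg_add, Finset.sum_add_distrib,
    Finset.sum_neg_distrib]
  ring

/-- The field `ν + ε V`. -/
def perturbedField {n : ℕ} (ν : Fin n → ℕ) (V : TorusField n) (ε : ℝ) : TorusField n where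
  toFun p := (fun j => (ν j : ℝ)) + ε • V.toFun p
  smooth := contDiff_const.add (V.smooth.const_smul ε)
  periodic l k t x := by rw [V.periodic]

theorem perturbedField_component {n : ℕ} (ν : Fin n → ℕ) (V : TorusField n) (ε t : ℝ) (j : Fin n) :
    (perturbedField ν V ε).component t j
      = algebraMap ℂ (TestFn n) (ν j) + (ε : ℂ) • V.component t j := testFn_ext fun x => by
  change (((ν j : ℝ) + ε * V.toFun (t, x) j : ℝ) : ℂ) = (ν j : ℂ) + (ε : ℂ) * (V.toFun (t, x) j : ℂ)
  push_cast
  rfl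

theorem partialFn_algebraMap {n : ℕ} (j : Fin n) (c : ℂ) :
    partialFn j (algebraMap ℂ (TestFn n) c) = 0 := testFn_ext fun x => by
  change fderiv ℝ (fun _ : Fin n → ℝ => c) x _ = 0
  simp

theorem perturbedField_div {n : ℕ} (ν : Fin n → ℕ) (V : TorusField n) (ε t : ℝ) :
    (perturbedField ν V ε).div t = (ε : ℂ) • V.div t := by
  simp only [TorusField.div, perturbedField_component, map_add, partialFn_algebraMap, map_smul,
    zero_add, Finset.smul_sum]

theorem transportOp_eq_fieldOp {n : ℕ} (ν : Fin n → ℕ) (V : TorusField n) (ε t : ℝ) (u : Distr n) :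
    transportOp ν V ε t u = fieldOp (perturbedField ν V ε) t u := by
  apply Subtype.ext
  refine LinearMap.ext fun φ => ?_
  have h1 : (transportOp ν V ε t u).1 φ
      = (∑ j, ((ν j : ℂ) • partialDistr j u
          + (ε : ℂ) • mulDistr (V.component t j) (partialDistr j u))).1 φ
        + ((ε : ℂ) / 2) * u.1 (V.div t * φ) := rfl
  have h2 : (fieldOp (perturbedField ν V ε) t u).1 φ
      = (∑ j, mulDistr ((perturbedField ν V ε).component t j) (partialDistr j u)).1 φ
        + (1 / 2 : ℂ) * u.1 ((perturbedField ν V ε).div t * φ) := rfl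
  rw [h1, h2, distr_sum_apply, distr_sum_apply, perturbedField_div, smul_mul_assoc, map_smul,
    smul_eq_mul]
  congr 1
  · refine Finset.sum_congr rfl fun j _ => ?_
    rw [mulDistr_apply, perturbedField_component, add_mul, map_add, smul_mul_assoc, map_smul,
      ← Algebra.smul_def, map_smul]
    rfl
  · ring

/-- The operator of a vector field is the Weyl quantization of its symbol. -/
theorem isWeylOp_fieldOp {n : ℕ} (Y : TorusField n) (t : ℝ) (u : Distr n) :
    IsWeylOp (fieldSymbol fun x => Y.toFun (t, x)) u (fieldOp Y t u) := by
  intro m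
  have hsymb : ∀ (l : Fin n → ℤ) (ξ : Fin n → ℝ),
      symbolFourier (fieldSymbol fun x => Y.toFun (t, x)) l ξ
        = Complex.I * ∑ j, (ξ j : ℂ) * coeff l (Y.component t j) := fun l ξ => by
    have h1 : Complex.I * ∑ j, (ξ j : ℂ) * coeff l (Y.component t j)
        = coeff l (Complex.I • ∑ j, (ξ j : ℂ) • Y.component t j) := by
      simp only [map_smul, map_sum, smul_eq_mul]
    rw [h1, coeff_apply, torusIntegral_apply, symbolFourier]
    congr 1
    refine integral_congr_ae (Eventually.of_forall fun x => ?_)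
    have h2 : (Complex.I • ∑ j, (ξ j : ℂ) • Y.component t j : TestFn n).1 x
        = fieldSymbol (fun x => Y.toFun (t, x)) x ξ := by
      change Complex.I * (∑ j, (ξ j : ℂ) • Y.component t j : TestFn n).1 x = Complex.I * _
      rw [AddSubmonoidClass.coe_finsetSum, Finset.sum_apply]
      push_cast
      rfl
    change _ = (character (-l)).1 x * (Complex.I • ∑ j, (ξ j : ℂ) • Y.component t j : TestFn n).1 x
    rw [h2, mul_comm, character_apply]
    simp
  have h := ((hasSum_distr u (fieldDual Y t (character (-m)))).mul_left
    ((2 * Real.pi : ℝ) ^ n : ℂ)⁻¹)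
  rw [← fieldOp_apply] at h
  have h2 := (Equiv.neg (Fin n → ℤ)).hasSum_iff.mpr h
  refine h2.congr_fun fun k => ?_
  simp only [Function.comp, Equiv.neg_apply]
  rw [character_pairing, neg_neg, mul_left_comm, inv_mul_cancel_left₀ (two_pi_pow_ne_zero n), hsymb]
  congr 1
  have hmul : ∀ (a : TestFn n) (l : Fin n → ℤ),
      coeff l (a * character (-m)) = coeff (l + m) a := fun a l => by
    rw [coeff_apply, coeff_apply, neg_add, character_add]
    congr 2
    ring
  simp only [fieldDual, map_neg, map_add, map_sum, map_smul, partialFn_character, mul_smul_comm,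
    hmul, smul_eq_mul, TorusField.div, coeff_partialFn]
  have hk : -k + m = m - k := by abel
  rw [hk, Finset.mul_sum, Finset.mul_sum, ← Finset.sum_add_distrib, ← Finset.sum_neg_distrib]
  refine Finset.sum_congr rfl fun j _ => ?_
  simp only [Pi.neg_apply, Pi.sub_apply]
  push_cast
  ring

/-! ### Jacobi's formula and Liouville's identity -/

theorem apply_space_eq_sum {n : ℕ} (L : ℝ × (Fin n → ℝ) →L[ℝ] (Fin n → ℝ)) (w : Fin n → ℝ)
    (l : Fin n) : L (0, w) l = ∑ i, L (0, Pi.single i 1) l * w i := by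
  have h1 : ((0 : ℝ), w) = ∑ i, w i • ((0 : ℝ), (Pi.single i 1 : Fin n → ℝ)) := by
    refine Prod.ext ?_ ?_
    · simp [Prod.fst_sum]
    · rw [Prod.snd_sum]
      simpa using pi_eq_sum_univ' w
  rw [h1, map_sum, Finset.sum_apply]
  refine Finset.sum_congr rfl fun i _ => ?_
  rw [map_smul, Pi.smul_apply, smul_eq_mul, mul_comm]

/-- Jacobi's formula, read off column by column from Cramer's rule. -/
theorem hasDerivAt_det {n : ℕ} {M : ℝ → Matrix (Fin n) (Fin n) ℝ} {M' : Matrix (Fin n) (Fin n) ℝ}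
    {s : ℝ} (h : ∀ i j, HasDerivAt (fun s => M s i j) (M' i j) s) :
    HasDerivAt (fun s => (M s).det) ((M s).adjugate * M').trace s := by
  have h1 : HasDerivAt (fun s => (M s).det) (∑ σ : Equiv.Perm (Fin n),
      ((Equiv.Perm.sign σ : ℤ) : ℝ) *
        ∑ i, (∏ j ∈ Finset.univ.erase i, M s (σ j) j) • M' (σ i) i) s := by
    simp only [Matrix.det_apply']
    exact HasDerivAt.fun_sum fun σ _ =>
      (HasDerivAt.fun_finsetProd fun i _ => h (σ i) i).const_mul _
  refine h1.congr_deriv ?_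
  simp only [Matrix.trace, Matrix.diag, Matrix.mul_apply, Finset.mul_sum]
  rw [Finset.sum_comm]
  refine Finset.sum_congr rfl fun i _ => ?_
  have h2 := congrFun (Matrix.cramer_eq_adjugate_mulVec (M s) (fun k => M' k i)) i
  rw [Matrix.cramer_apply, Matrix.mulVec, dotProduct] at h2
  rw [← h2, Matrix.det_apply']
  refine Finset.sum_congr rfl fun σ _ => ?_
  congr 1
  rw [← Finset.mul_prod_erase _ _ (Finset.mem_univ i), Matrix.updateCol_self, smul_eq_mul, mul_comm]
  congr 1
  refine Finset.prod_congr rfl fun j hj => ?_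
  rw [Matrix.updateCol_ne (Finset.ne_of_mem_erase hj)]

/-- A smooth curve `t ↦ χ_t` of diffeomorphisms of the torus, lifted to `ℝⁿ`, with the inverses
`χ_t⁻¹` jointly smooth in `(t, x)`. -/
structure TorusFlow (n : ℕ) where
  map : ℝ × (Fin n → ℝ) → (Fin n → ℝ)
  inv : ℝ × (Fin n → ℝ) → (Fin n → ℝ)
  smooth : ContDiff ℝ ∞ map
  smooth_inv : ContDiff ℝ ∞ inv
  left_inv : ∀ t x, inv (t, map (t, x)) = x
  right_inv : ∀ t x, map (t, inv (t, x)) = x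
  map_shift : ∀ t k x, map (t, shift x k) = shift (map (t, x)) k
  det_pos : ∀ t x, 0 < (Matrix.of fun l m => fderiv ℝ map (t, x) (0, Pi.single m 1) l).det

namespace TorusFlow

variable {n : ℕ} (χ : TorusFlow n)

theorem hasFDerivAt (p : ℝ × (Fin n → ℝ)) : HasFDerivAt χ.map (fderiv ℝ χ.map p) p :=
  (χ.smooth.differentiable (by simp) p).hasFDerivAt

theorem hasFDerivAt_snd (t : ℝ) (x : Fin n → ℝ) :
    HasFDerivAt (fun y => χ.map (t, y))
      ((fderiv ℝ χ.map (t, x)).comp (ContinuousLinearMap.inr ℝ ℝ (Fin n → ℝ))) x :=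
  (χ.hasFDerivAt (t, x)).comp x (hasFDerivAt_prodMk_right t x)

/-- The Jacobian matrix of `χ_t` in the space variables, at `p = (t, x)`. -/
def jacMat (p : ℝ × (Fin n → ℝ)) : Matrix (Fin n) (Fin n) ℝ :=
  Matrix.of fun l m => fderiv ℝ χ.map p (0, Pi.single m 1) l

theorem det_fderiv_snd (t : ℝ) (x : Fin n → ℝ) :
    (fderiv ℝ (fun y => χ.map (t, y)) x).det = (χ.jacMat (t, x)).det := by
  rw [(χ.hasFDerivAt_snd t x).fderiv, ContinuousLinearMap.det, ← LinearMap.det_toMatrix']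
  congr 1

/-- The diffeomorphism at time `t`. -/
def diffeo (t : ℝ) : TorusDiffeo n where
  toFun x := χ.map (t, x)
  invFun x := χ.inv (t, x)
  smooth := χ.smooth.comp (contDiff_const.prodMk contDiff_id)
  smooth_inv := χ.smooth_inv.comp (contDiff_const.prodMk contDiff_id)
  left_inv := χ.left_inv t
  right_inv := χ.right_inv t
  map_shift := χ.map_shift t
  det_pos x := by rw [det_fderiv_snd]; exact χ.det_pos t x

theorem contDiff_jacMat (l m : Fin n) : ContDiff ℝ ∞ fun p => χ.jacMat p l m :=
  (contDiff_apply ℝ ℝ l).comp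
    ((χ.smooth.fderiv_right (m := ∞) (by simp)).clm_apply contDiff_const)

theorem contDiff_det_jacMat : ContDiff ℝ ∞ fun p => (χ.jacMat p).det := by
  simp only [Matrix.det_apply']
  exact ContDiff.sum fun σ _ => contDiff_const.mul (contDiff_prod fun i _ => χ.contDiff_jacMat _ _)

theorem jac_diffeo (t : ℝ) (x : Fin n → ℝ) :
    (χ.diffeo t).jac.1 x = ((χ.jacMat (t, x)).det : ℂ) := by
  rw [TorusDiffeo.jac_apply, ← det_fderiv_snd]
  rfl

theorem entry_diffeo (t : ℝ) (l j : Fin n) (x : Fin n → ℝ) :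
    ((χ.diffeo t).entry l j).1 x = (χ.jacMat (t, x) l j : ℂ) := by
  rw [TorusDiffeo.entry_apply]
  change ((fderiv ℝ (fun y => χ.map (t, y)) x (Pi.single j 1) l : ℝ) : ℂ) = _
  rw [(χ.hasFDerivAt_snd t x).fderiv]
  rfl

/-- The entrywise derivative of the Jacobian matrix in the direction `v`. -/
def jacMatDeriv (p v : ℝ × (Fin n → ℝ)) : Matrix (Fin n) (Fin n) ℝ :=
  Matrix.of fun l m => fderiv ℝ (fderiv ℝ χ.map) p v (0, Pi.single m 1) l

theorem hasDerivAt_jacMat (p v : ℝ × (Fin n → ℝ)) (l m : Fin n) :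
    HasDerivAt (fun s : ℝ => χ.jacMat (p + s • v) l m) (χ.jacMatDeriv p v l m) 0 := by
  have h1 : HasFDerivAt (fderiv ℝ χ.map) (fderiv ℝ (fderiv ℝ χ.map) p) (p + (0 : ℝ) • v) := by
    rw [zero_smul, add_zero]
    exact ((χ.smooth.fderiv_right (m := ∞) (by simp)).differentiable (by simp) p).hasFDerivAt
  have h2 : HasDerivAt (fun s : ℝ => p + s • v) v 0 := by
    simpa using ((hasDerivAt_id (0 : ℝ)).smul_const v).const_add p
  have h3 := h1.comp_hasDerivAt (0 : ℝ) h2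
  have h4 := h3.clm_apply (hasDerivAt_const (0 : ℝ) ((0, Pi.single m 1) : ℝ × (Fin n → ℝ)))
  refine (hasDerivAt_pi.mp h4 l).congr_deriv ?_
  simp [jacMatDeriv]

theorem fderiv_det_jacMat (p v : ℝ × (Fin n → ℝ)) :
    fderiv ℝ (fun p => (χ.jacMat p).det) p v
      = ((χ.jacMat p).adjugate * χ.jacMatDeriv p v).trace := by
  have h1 := hasDerivAt_det (M := fun s : ℝ => χ.jacMat (p + s • v)) (s := 0)
    fun l m => χ.hasDerivAt_jacMat p v l m
  have h2 : HasDerivAt (fun s : ℝ => p + s • v) v 0 := by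
    simpa using ((hasDerivAt_id (0 : ℝ)).smul_const v).const_add p
  have h3 : HasFDerivAt (fun p => (χ.jacMat p).det) (fderiv ℝ (fun p => (χ.jacMat p).det) p)
      (p + (0 : ℝ) • v) := by
    rw [zero_smul, add_zero]
    exact (χ.contDiff_det_jacMat.differentiable (by simp) p).hasFDerivAt
  have h4 : HasDerivAt (fun s : ℝ => (χ.jacMat (p + s • v)).det)
      (fderiv ℝ (fun p => (χ.jacMat p).det) p v) 0 :=
    HasFDerivAt.comp_hasDerivAt (l := fun p => (χ.jacMat p).det) (f := fun s : ℝ => p + s • v)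
      (0 : ℝ) h3 h2
  have h5 := h4.unique h1
  simpa using h5

/-- The matrix `∂ₘYₗ` of the space derivatives of a field. -/
def fieldDeriv (Y : TorusField n) (t : ℝ) (x : Fin n → ℝ) : Matrix (Fin n) (Fin n) ℝ :=
  Matrix.of fun l m => fderiv ℝ Y.toFun (t, x) (0, Pi.single m 1) l

theorem div_apply (Y : TorusField n) (t : ℝ) (x : Fin n → ℝ) :
    (Y.div t).1 x = ((fieldDeriv Y t x).trace : ℂ) := by
  rw [TorusField.div, AddSubmonoidClass.coe_finsetSum, Finset.sum_apply, Matrix.trace]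
  push_cast
  refine Finset.sum_congr rfl fun j _ => ?_
  have h1 : HasFDerivAt (fun y => Y.toFun (t, y))
      ((fderiv ℝ Y.toFun (t, x)).comp (ContinuousLinearMap.inr ℝ ℝ (Fin n → ℝ))) x :=
    ((Y.smooth.differentiable (by simp) (t, x)).hasFDerivAt).comp x (hasFDerivAt_prodMk_right t x)
  have h2 := Complex.ofRealCLM.hasFDerivAt.comp x (hasFDerivAt_pi'.mp h1 j)
  rw [partialFn_apply]
  change fderiv ℝ (Complex.ofRealCLM ∘ fun y => Y.toFun (t, y) j) x (Pi.single j 1) = _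
  rw [h2.fderiv]
  rfl

/-- `χ` conjugates the field `b` to the field `Y`: `Dχ Y = ∂ₜχ + b(t, χ)`. -/
def Conjugates (b Y : TorusField n) : Prop :=
  ∀ t x, fderiv ℝ χ.map (t, x) (0, Y.toFun (t, x))
    = fderiv ℝ χ.map (t, x) (1, 0) + b.toFun (t, χ.map (t, x))

variable {χ} {b Y : TorusField n}

/-- The space derivative of `Dχ Y = ∂ₜχ + b(t, χ)`, with the symmetry of second derivatives. -/
theorem Conjugates.jacMatDeriv_time (h : χ.Conjugates b Y) (t : ℝ) (x : Fin n → ℝ) :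
    χ.jacMatDeriv (t, x) (1, 0)
      = ∑ j, Y.toFun (t, x) j • χ.jacMatDeriv (t, x) (0, Pi.single j 1)
        + χ.jacMat (t, x) * fieldDeriv Y t x
        - fieldDeriv b t (χ.map (t, x)) * χ.jacMat (t, x) := by
  have hsymm : ∀ v w : ℝ × (Fin n → ℝ),
      fderiv ℝ (fderiv ℝ χ.map) (t, x) v w = fderiv ℝ (fderiv ℝ χ.map) (t, x) w v :=
    fun v w => (χ.smooth.contDiffAt.isSymmSndFDerivAt (by simpa using ENat.LEInfty.out)).eq v w
  have hD : HasFDerivAt (fun y => fderiv ℝ χ.map (t, y))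
      ((fderiv ℝ (fderiv ℝ χ.map) (t, x)).comp (ContinuousLinearMap.inr ℝ ℝ (Fin n → ℝ))) x :=
    (((χ.smooth.fderiv_right (m := ∞) (by simp)).differentiable (by simp) (t, x)).hasFDerivAt).comp
      x (hasFDerivAt_prodMk_right t x)
  have hY : HasFDerivAt (fun y => ((0 : ℝ), Y.toFun (t, y)))
      ((ContinuousLinearMap.inr ℝ ℝ (Fin n → ℝ)).comp
        ((fderiv ℝ Y.toFun (t, x)).comp (ContinuousLinearMap.inr ℝ ℝ (Fin n → ℝ)))) x :=
    (ContinuousLinearMap.inr ℝ ℝ (Fin n → ℝ)).hasFDerivAt.comp x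
      (((Y.smooth.differentiable (by simp) (t, x)).hasFDerivAt).comp x
        (hasFDerivAt_prodMk_right t x))
  have hb : HasFDerivAt (fun y => b.toFun (t, χ.map (t, y)))
      ((fderiv ℝ b.toFun (t, χ.map (t, x))).comp
        ((ContinuousLinearMap.inr ℝ ℝ (Fin n → ℝ)).comp
        ((fderiv ℝ χ.map (t, x)).comp (ContinuousLinearMap.inr ℝ ℝ (Fin n → ℝ))))) x := by
    have h1 : HasFDerivAt (fun y => (t, χ.map (t, y)))
        ((ContinuousLinearMap.inr ℝ ℝ (Fin n → ℝ)).comp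
        ((fderiv ℝ χ.map (t, x)).comp (ContinuousLinearMap.inr ℝ ℝ (Fin n → ℝ)))) x :=
      (hasFDerivAt_prodMk_right t (χ.map (t, x))).comp x (χ.hasFDerivAt_snd t x)
    exact ((b.smooth.differentiable (by simp) (t, χ.map (t, x))).hasFDerivAt).comp x h1
  have hl := hD.clm_apply hY
  have hr := (hD.clm_apply (hasFDerivAt_const ((1, 0) : ℝ × (Fin n → ℝ)) x)).add hb
  have hfun : (fun y => fderiv ℝ χ.map (t, y) (0, Y.toFun (t, y)))
      = fun y => fderiv ℝ χ.map (t, y) (1, 0) + b.toFun (t, χ.map (t, y)) := funext (h t)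
  rw [hfun] at hl
  have heq := hl.unique hr
  ext l m
  have h2 := congrFun (DFunLike.congr_fun heq (Pi.single m 1)) l
  simp only [ContinuousLinearMap.flip_apply, ContinuousLinearMap.comp_apply, add_apply,
    ContinuousLinearMap.inr_apply, Pi.add_apply, zero_apply, map_zero, Pi.zero_apply] at h2
  rw [apply_space_eq_sum _ (fderiv ℝ Y.toFun (t, x) _), apply_space_eq_sum _ (Y.toFun (t, x)),
    apply_space_eq_sum _ (fderiv ℝ χ.map (t, x) (0, Pi.single m 1)),
    hsymm (0, Pi.single m 1) (1, 0)] at h2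
  have h3 : ∑ i, fderiv ℝ (fderiv ℝ χ.map) (t, x) (0, Pi.single m 1) (0, Pi.single i 1) l *
        Y.toFun (t, x) i
      = ∑ i, Y.toFun (t, x) i *
        fderiv ℝ (fderiv ℝ χ.map) (t, x) (0, Pi.single i 1) (0, Pi.single m 1) l :=
    Finset.sum_congr rfl fun i _ => by rw [hsymm, mul_comm]
  rw [h3] at h2
  simp only [Matrix.sub_apply, Matrix.add_apply, Matrix.sum_apply, Matrix.smul_apply,
    Matrix.mul_apply, jacMatDeriv, jacMat, fieldDeriv, Matrix.of_apply, smul_eq_mul]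
  linarith

/-- Liouville's identity `∂ₜJ = Y·∇J + J div Y - J (div b)(χ)` for the Jacobian. -/
theorem Conjugates.liouville (h : χ.Conjugates b Y) (t : ℝ) (x : Fin n → ℝ) :
    fderiv ℝ (fun p => (χ.jacMat p).det) (t, x) (1, 0)
      = ∑ j, Y.toFun (t, x) j * fderiv ℝ (fun p => (χ.jacMat p).det) (t, x) (0, Pi.single j 1)
        + (χ.jacMat (t, x)).det * (fieldDeriv Y t x).trace
        - (χ.jacMat (t, x)).det * (fieldDeriv b t (χ.map (t, x))).trace := by
  simp only [fderiv_det_jacMat]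
  rw [h.jacMatDeriv_time, mul_sub, mul_add, Matrix.trace_sub, Matrix.trace_add, Finset.mul_sum,
    Matrix.trace_sum, ← mul_assoc, Matrix.adjugate_mul, ← mul_assoc,
    Matrix.trace_mul_comm _ (χ.jacMat _),
    ← mul_assoc, Matrix.mul_adjugate]
  simp

end TorusFlow

/-! ### Conjugation of transport equations -/

namespace TorusFlow

variable {n : ℕ} (χ : TorusFlow n)

theorem inv_shift (t : ℝ) (k : Fin n → ℤ) (x : Fin n → ℝ) :
    χ.inv (t, shift x k) = shift (χ.inv (t, x)) k := (χ.diffeo t).inv_shift k x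

theorem jacMat_shift (t : ℝ) (k : Fin n → ℤ) (x : Fin n → ℝ) :
    (χ.jacMat (t, shift x k)).det = (χ.jacMat (t, x)).det :=
  Complex.ofReal_injective (by rw [← jac_diffeo, ← jac_diffeo, (χ.diffeo t).jac.2.2])

/-- The value at `(t, x)` of `(χ.diffeo t).pull.symm φ`. -/
def pushed (φ : TestFn n) (p : ℝ × (Fin n → ℝ)) : ℂ :=
  (((Real.sqrt (χ.jacMat (p.1, χ.inv p)).det)⁻¹ : ℝ) : ℂ) * φ.1 (χ.inv p)

theorem det_jacMat_pos (p : ℝ × (Fin n → ℝ)) : 0 < (χ.jacMat p).det := χ.det_pos p.1 p.2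

theorem contDiff_invRoot : ContDiff ℝ ∞ fun p => (Real.sqrt (χ.jacMat p).det)⁻¹ :=
  (χ.contDiff_det_jacMat.sqrt fun p => (χ.det_jacMat_pos p).ne').inv
    fun p => (Real.sqrt_pos.mpr (χ.det_jacMat_pos p)).ne'

theorem contDiff_pushed (φ : TestFn n) : ContDiff ℝ ∞ (χ.pushed φ) :=
  (Complex.ofRealCLM.contDiff.comp (χ.contDiff_invRoot.comp
    (contDiff_fst.prodMk χ.smooth_inv))).mul (φ.2.1.comp χ.smooth_inv)

theorem pushed_shift (φ : TestFn n) (t : ℝ) (k : Fin n → ℤ) (x : Fin n → ℝ) :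
    χ.pushed φ (t, shift x k) = χ.pushed φ (t, x) := by
  simp only [pushed, inv_shift, jacMat_shift, φ.2.2]

theorem slice_pushed (φ : TestFn n) (t : ℝ) :
    slice (χ.pushed φ) (χ.contDiff_pushed φ) (χ.pushed_shift φ) t = (χ.diffeo t).pull.symm φ :=
  testFn_ext fun x => by
    rw [TorusDiffeo.pull_symm_eq]
    change _ = (((Real.sqrt (fderiv ℝ (fun y => χ.map (t, y)) (χ.inv (t, x))).det)⁻¹ : ℝ) : ℂ)
      * φ.1 (χ.inv (t, x))
    rw [det_fderiv_snd]
    rfl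

theorem partialFn_jac_diffeo (t : ℝ) (j : Fin n) (x : Fin n → ℝ) :
    (partialFn j (χ.diffeo t).jac).1 x
      = (fderiv ℝ (fun p => (χ.jacMat p).det) (t, x) (0, Pi.single j 1) : ℝ) := by
  have h1 : HasFDerivAt (fun y => (χ.jacMat (t, y)).det)
      ((fderiv ℝ (fun p => (χ.jacMat p).det) (t, x)).comp
        (ContinuousLinearMap.inr ℝ ℝ (Fin n → ℝ))) x :=
    HasFDerivAt.comp (g := fun p => (χ.jacMat p).det) x
      (χ.contDiff_det_jacMat.differentiable (by simp) (t, x)).hasFDerivAt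
      (hasFDerivAt_prodMk_right t x)
  have h2 := Complex.ofRealCLM.hasFDerivAt.comp x h1
  have h3 : (χ.diffeo t).jac.1 = Complex.ofRealCLM ∘ fun y => (χ.jacMat (t, y)).det :=
    funext fun y => χ.jac_diffeo t y
  rw [partialFn_apply, h3, h2.fderiv]
  rfl

/-- The time derivative of `(χ.diffeo t).pull.symm φ`, from differentiating
`s ↦ pushed φ (s, χ.map (s, y))` at fixed `y`. -/
theorem fderiv_pushed (φ : TestFn n) (t : ℝ) (y : Fin n → ℝ) :
    fderiv ℝ (χ.pushed φ) (t, χ.map (t, y)) (1, 0)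
      = -((fderiv ℝ (fun p => (χ.jacMat p).det) (t, y) (1, 0) : ℝ) : ℂ)
          / (2 * ((χ.jacMat (t, y)).det : ℂ)) * χ.pushed φ (t, χ.map (t, y))
        - ∑ l, ((fderiv ℝ χ.map (t, y) (1, 0) l : ℝ) : ℂ)
          * (partialFn l ((χ.diffeo t).pull.symm φ)).1 (χ.map (t, y)) := by
  set J := fun p => (χ.jacMat p).det with hJ
  set T := fderiv ℝ χ.map (t, y) (1, 0) with hT
  have hP := (χ.contDiff_pushed φ).differentiable (by simp) (t, χ.map (t, y))
  have hcurve : HasDerivAt (fun s => (s, χ.map (s, y))) ((1 : ℝ), T) t :=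
    (hasDerivAt_id t).prodMk (hasDerivAt_fst χ.smooth t y)
  have h1 := HasFDerivAt.comp_hasDerivAt (l := χ.pushed φ) (f := fun s => (s, χ.map (s, y))) t
    hP.hasFDerivAt hcurve
  have hfun : (χ.pushed φ ∘ fun s => (s, χ.map (s, y)))
      = fun s => (((Real.sqrt (J (s, y)))⁻¹ : ℝ) : ℂ) * φ.1 y := funext fun s => by
    simp only [Function.comp, pushed, χ.left_inv, hJ]
  have hpos : 0 < J (t, y) := χ.det_jacMat_pos _
  have h2 : HasDerivAt (fun s => (Real.sqrt (J (s, y)))⁻¹) _ t :=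
    ((hasDerivAt_fst χ.contDiff_det_jacMat t y).sqrt hpos.ne').inv (Real.sqrt_pos.mpr hpos).ne'
  have h3 := (h2.ofReal_comp).mul_const (φ.1 y)
  rw [hfun] at h1
  have h4 := h1.unique h3
  have h5 : ((1 : ℝ), T) = (1, 0) + (0, T) := by simp
  have h6 : fderiv ℝ (χ.pushed φ) (t, χ.map (t, y)) (0, T)
      = ∑ l, ((T l : ℝ) : ℂ) * (partialFn l ((χ.diffeo t).pull.symm φ)).1 (χ.map (t, y)) := by
    rw [← fderiv_apply_eq_sum, ← slice_pushed]
    have h7 : HasFDerivAt (fun z => χ.pushed φ (t, z)) _ (χ.map (t, y)) :=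
      hP.hasFDerivAt.comp _ (hasFDerivAt_prodMk_right t _)
    change _ = fderiv ℝ (fun z => χ.pushed φ (t, z)) _ _
    rw [h7.fderiv]
    rfl
  rw [h5, map_add, h6] at h4
  rw [← eq_sub_iff_add_eq] at h4
  rw [h4]
  congr 1
  have h8 : χ.pushed φ (t, χ.map (t, y)) = (((Real.sqrt (J (t, y)))⁻¹ : ℝ) : ℂ) * φ.1 y :=
    congrFun hfun t
  rw [h8, ← mul_assoc]
  congr 1
  rw [← Complex.ofReal_neg, ← Complex.ofReal_ofNat, ← Complex.ofReal_mul, ← Complex.ofReal_div,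
    ← Complex.ofReal_mul]
  congr 1
  have h9 := Real.sq_sqrt hpos.le
  have h10 := (Real.sqrt_pos.mpr hpos).ne'
  change -(fderiv ℝ J (t, y) (1, 0) / (2 * Real.sqrt (J (t, y)))) / Real.sqrt (J (t, y)) ^ 2
    = -fderiv ℝ J (t, y) (1, 0) / (2 * J (t, y)) * (Real.sqrt (J (t, y)))⁻¹
  rw [h9]
  field_simp

theorem pull_symm_mul (t : ℝ) (a f : TestFn n) (y : Fin n → ℝ) :
    ((χ.diffeo t).pull.symm (a * f)).1 (χ.map (t, y))
      = a.1 y * ((χ.diffeo t).pull.symm f).1 (χ.map (t, y)) := by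
  rw [TorusDiffeo.pull_symm_eq, TorusDiffeo.pull_symm_eq]
  change (χ.diffeo t).invRootJac.1 (χ.inv (t, χ.map (t, y))) *
    (a.1 (χ.inv (t, χ.map (t, y))) * f.1 (χ.inv (t, χ.map (t, y)))) = a.1 y *
    ((χ.diffeo t).invRootJac.1 (χ.inv (t, χ.map (t, y))) * f.1 (χ.inv (t, χ.map (t, y))))
  rw [χ.left_inv]
  ring

theorem pull_symm_partialFn (t : ℝ) (φ : TestFn n) (j : Fin n) (y : Fin n → ℝ) :
    ((χ.diffeo t).pull.symm (partialFn j φ)).1 (χ.map (t, y))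
      = ∑ l, (χ.jacMat (t, y) l j : ℂ) *
          (partialFn l ((χ.diffeo t).pull.symm φ)).1 (χ.map (t, y))
        + (1 / 2 : ℂ) * ((fderiv ℝ (fun p => (χ.jacMat p).det) (t, y) (0, Pi.single j 1) : ℝ)
          * ((χ.jacMat (t, y)).det : ℂ)⁻¹) * ((χ.diffeo t).pull.symm φ).1 (χ.map (t, y)) := by
  have h := (χ.diffeo t).partialFn_pull j ((χ.diffeo t).pull.symm φ)
  rw [LinearEquiv.apply_symm_apply] at h
  rw [h, map_add, map_sum]
  have hsum : ∀ (f g : TestFn n) (x : Fin n → ℝ), (f + g).1 x = f.1 x + g.1 x := fun _ _ _ => rfl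
  rw [hsum, AddSubmonoidClass.coe_finsetSum, Finset.sum_apply]
  congr 1
  · refine Finset.sum_congr rfl fun l _ => ?_
    rw [pull_symm_mul, LinearEquiv.symm_apply_apply, entry_diffeo]
  · rw [pull_symm_mul]
    congr 1
    change (1 / 2 : ℂ) * ((partialFn j (χ.diffeo t).jac).1 y * (χ.diffeo t).invJac.1 y) = _
    rw [partialFn_jac_diffeo, TorusDiffeo.invJac_apply, Complex.ofReal_inv]
    change _ * (_ * ((fderiv ℝ (fun x => χ.map (t, x)) y).det : ℂ)⁻¹) = _
    rw [det_fderiv_snd]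

variable {χ} {b Y : TorusField n}

/-- With `A` the half-density action of `χ_t`, the time derivative of `ψ = A⁻¹ φ` is
`A⁻¹ Yᵗ φ - bᵗ ψ`, where `Yᵗ` and `bᵗ` are the transposed field operators: the first order terms
match because `Dχ Y = ∂ₜχ + b(t, χ)`, those of order zero by Liouville's identity. -/
theorem Conjugates.fderiv_pushed_eq (h : χ.Conjugates b Y) (φ : TestFn n) (t : ℝ)
    (x : Fin n → ℝ) :
    ((χ.diffeo t).pull.symm (fieldDual Y t φ) - fieldDual b t ((χ.diffeo t).pull.symm φ)).1 x
      = fderiv ℝ (χ.pushed φ) (t, x) (1, 0) := by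
  obtain ⟨y, rfl⟩ : ∃ y, χ.map (t, y) = x := ⟨_, χ.right_inv t x⟩
  rw [fderiv_pushed]
  set ψ := (χ.diffeo t).pull.symm φ with hψ
  set x := χ.map (t, y) with hx
  have hψx : χ.pushed φ (t, x) = ψ.1 x := by rw [hψ, ← slice_pushed]; rfl
  have hJ : ((χ.jacMat (t, y)).det : ℂ) ≠ 0 := Complex.ofReal_ne_zero.mpr (χ.det_jacMat_pos _).ne'
  have hsub : ∀ f g : TestFn n, (f - g).1 x = f.1 x - g.1 x := fun _ _ => rfl
  have hadd : ∀ f g : TestFn n, (f + g).1 x = f.1 x + g.1 x := fun _ _ => rfl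
  have hneg : ∀ f : TestFn n, (-f).1 x = -f.1 x := fun _ => rfl
  have hmul : ∀ f g : TestFn n, (f * g).1 x = f.1 x * g.1 x := fun _ _ => rfl
  have hsmul : ∀ (c : ℂ) (f : TestFn n), (c • f).1 x = c * f.1 x := fun _ _ => rfl
  have hsum : ∀ f : Fin n → TestFn n, (∑ j, f j).1 x = ∑ j, (f j).1 x := fun f => by
    rw [AddSubmonoidClass.coe_finsetSum, Finset.sum_apply]
  have hcomp : ∀ (Z : TorusField n) (j : Fin n) (z : Fin n → ℝ),
      (Z.component t j).1 z = ((Z.toFun (t, z) j : ℝ) : ℂ) := fun _ _ _ => rfl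
  have hY : ((χ.diffeo t).pull.symm (fieldDual Y t φ)).1 x
      = -((∑ j, (Y.toFun (t, y) j : ℂ) * (∑ l, (χ.jacMat (t, y) l j : ℂ) * (partialFn l ψ).1 x
          + (1 / 2 : ℂ) * ((fderiv ℝ (fun p => (χ.jacMat p).det) (t, y) (0, Pi.single j 1) : ℝ)
          * ((χ.jacMat (t, y)).det : ℂ)⁻¹) * ψ.1 x))
        + (1 / 2 : ℂ) * (((fieldDeriv Y t y).trace : ℂ) * ψ.1 x)) := by
    rw [fieldDual, map_neg, map_add, map_sum, map_smul, hneg, hadd, hsum, hsmul, pull_symm_mul,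
      div_apply]
    simp only [pull_symm_mul, hcomp, pull_symm_partialFn, hx, hψ]
  have hb : (fieldDual b t ψ).1 x
      = -((∑ l, (b.toFun (t, x) l : ℂ) * (partialFn l ψ).1 x)
        + (1 / 2 : ℂ) * (((fieldDeriv b t x).trace : ℂ) * ψ.1 x)) := by
    rw [fieldDual, hneg, hadd, hsum, hsmul, hmul, div_apply]
    simp only [hmul, hcomp]
  have hconj : ∀ l, ∑ j, χ.jacMat (t, y) l j * Y.toFun (t, y) j
      = fderiv ℝ χ.map (t, y) (1, 0) l + b.toFun (t, x) l := fun l => by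
    have h1 := congrFun (h t y) l
    rw [Pi.add_apply] at h1
    rw [← h1]
    rw [apply_space_eq_sum]
    rfl
  have hfirst : ∑ j, (Y.toFun (t, y) j : ℂ) * ∑ l, (χ.jacMat (t, y) l j : ℂ) * (partialFn l ψ).1 x
      = ∑ l, ((fderiv ℝ χ.map (t, y) (1, 0) l : ℝ) : ℂ) * (partialFn l ψ).1 x
        + ∑ l, (b.toFun (t, x) l : ℂ) * (partialFn l ψ).1 x := by
    simp only [Finset.mul_sum]
    rw [Finset.sum_comm, ← Finset.sum_add_distrib]
    refine Finset.sum_congr rfl fun l _ => ?_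
    rw [← add_mul, ← Complex.ofReal_add, ← hconj]
    push_cast
    rw [Finset.sum_mul]
    exact Finset.sum_congr rfl fun j _ => by ring
  have hsecond : ∑ j, (Y.toFun (t, y) j : ℂ) *
        ((1 / 2 : ℂ) * ((fderiv ℝ (fun p => (χ.jacMat p).det) (t, y) (0, Pi.single j 1) : ℝ)
          * ((χ.jacMat (t, y)).det : ℂ)⁻¹) * ψ.1 x)
      = (∑ j, (Y.toFun (t, y) j : ℂ) *
          (fderiv ℝ (fun p => (χ.jacMat p).det) (t, y) (0, Pi.single j 1) : ℝ))
        * (1 / 2 * ((χ.jacMat (t, y)).det : ℂ)⁻¹ * ψ.1 x) := by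
    rw [Finset.sum_mul]
    exact Finset.sum_congr rfl fun j _ => by ring
  have hliou := congrArg (fun r : ℝ => (r : ℂ)) (h.liouville t y)
  push_cast at hliou
  rw [hsub, hY, hb, hψx]
  simp only [mul_add, Finset.sum_add_distrib]
  rw [hfirst, hsecond, hliou]
  field_simp
  ring

/-- If `Dχ Y = ∂ₜχ + b(t, χ)`, the action of `χ` on distributions turns solutions of the transport
equation of `b` into solutions of the one of `Y`. -/
theorem Conjugates.hasTimeDeriv (h : χ.Conjugates b Y) {u : ℝ → Distr n}
    (hu : HasTimeDeriv u fun t => fieldOp b t (u t)) :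
    HasTimeDeriv (fun t => (χ.diffeo t).transpose.symm (u t))
      fun t => fieldOp Y t ((χ.diffeo t).transpose.symm (u t)) := by
  intro φ t
  have h1 := hasDerivAt_pairing hu (χ.contDiff_pushed φ) (χ.pushed_shift φ) t _
    (h.fderiv_pushed_eq φ t)
  simp only [slice_pushed] at h1
  refine h1.congr_deriv ?_
  rw [fieldOp_apply, fieldOp_apply, TorusDiffeo.transpose_symm_apply, map_sub, add_sub_cancel]

end TorusFlow

/-! ### The averaged field and the corrector -/

section Fields

variable {n : ℕ}

theorem TorusField.shift_space (Y : TorusField n) (k : Fin n → ℤ) (t : ℝ) (x : Fin n → ℝ) :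
    Y.toFun (t, shift x k) = Y.toFun (t, x) := by
  simpa using Y.periodic 0 k t x

theorem TorusField.add_time (Y : TorusField n) (t : ℝ) (x : Fin n → ℝ) :
    Y.toFun (t + 2 * Real.pi, x) = Y.toFun (t, x) := by
  have h : shift x 0 = x := funext fun j => by simp [shift]
  simpa [h] using Y.periodic 1 0 t x

/-- A field that is `2π`-periodic in time and in each space variable. -/
def TorusField.mk' (Y : ℝ × (Fin n → ℝ) → (Fin n → ℝ)) (hY : ContDiff ℝ ∞ Y)
    (hx : ∀ k t x, Y (t, shift x k) = Y (t, x))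
    (ht : ∀ t x, Y (t + 2 * Real.pi, x) = Y (t, x)) : TorusField n where
  toFun := Y
  smooth := hY
  periodic l k t x := by
    have h : Function.Periodic (fun s => Y (s, x)) (2 * Real.pi) := fun s => ht s x
    have h2 := h.int_mul l t
    rw [hx, mul_comm]
    exact h2

variable (ν : Fin n → ℕ) (V : TorusField n)

/-- The constant field `ν`, as a vector of `ℝⁿ`. -/
def drift : Fin n → ℝ := fun j => (ν j : ℝ)

theorem shift_sub_smul_drift (t : ℝ) (x : Fin n → ℝ) (k : Fin n → ℤ) :
    shift x k - t • drift ν = shift (x - t • drift ν) k := by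
  funext j
  simp only [shift, Pi.sub_apply]
  ring

theorem sub_two_pi_smul_drift (t : ℝ) (x : Fin n → ℝ) :
    x - (t + 2 * Real.pi) • drift ν = shift (x - t • drift ν) fun j => -(ν j : ℤ) := by
  funext j
  simp only [shift, drift, Pi.sub_apply, Pi.smul_apply, smul_eq_mul]
  push_cast
  ring

/-- The field `V` in the frame moving with the flow of `ν`: `V(t, x - tν)`. -/
def comovingField : TorusField n :=
  TorusField.mk' (fun p => V.toFun (p.1, p.2 - p.1 • drift ν))
    (V.smooth.comp (contDiff_fst.prodMk (contDiff_snd.sub (contDiff_fst.smul contDiff_const))))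
    (fun k t x => by simp only [shift_sub_smul_drift, V.shift_space])
    (fun t x => by simp only [sub_two_pi_smul_drift, V.shift_space, V.add_time])

theorem resonantAverage_eq (x : Fin n → ℝ) (j : Fin n) : resonantAverage ν V x j
    = (2 * Real.pi)⁻¹ * ∫ τ in (0 : ℝ)..(2 * Real.pi), (comovingField ν V).toFun (τ, x) j := rfl

/-- The resonant average, as a field independent of time. -/
def averagedField : TorusField n :=
  TorusField.mk' (fun p => resonantAverage ν V p.2)
    (contDiff_pi.mpr fun j => by
      have h1 : ContDiff ℝ ∞ fun q : (Fin n → ℝ) × ℝ => (comovingField ν V).toFun (q.2, q.1) j :=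
        (contDiff_apply ℝ ℝ j).comp
          ((comovingField ν V).smooth.comp (contDiff_snd.prodMk contDiff_fst))
      simp only [resonantAverage_eq]
      exact contDiff_const.mul ((contDiff_parametric_integral h1 _ _).comp contDiff_snd))
    (fun k t x => by
      funext j
      simp only [resonantAverage_eq, TorusField.shift_space])
    (fun t x => rfl)

/-- The defect `⟨V⟩_ν(x) - V(t, x - tν)`, which has zero mean in time. -/
def defectField (p : ℝ × (Fin n → ℝ)) : Fin n → ℝ :=
  (averagedField ν V).toFun p - (comovingField ν V).toFun p

theorem contDiff_defectField : ContDiff ℝ ∞ (defectField ν V) :=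
  (averagedField ν V).smooth.sub (comovingField ν V).smooth

theorem continuous_defectField_time (x : Fin n → ℝ) :
    Continuous fun τ => defectField ν V (τ, x) :=
  (contDiff_defectField ν V).continuous.comp (by fun_prop)

theorem integral_defectField (x : Fin n → ℝ) :
    ∫ τ in (0 : ℝ)..(2 * Real.pi), defectField ν V (τ, x) = 0 := by
  have hc := continuous_defectField_time ν V x
  funext j
  have h1 : (∫ τ in (0 : ℝ)..(2 * Real.pi), defectField ν V (τ, x)) j
      = ∫ τ in (0 : ℝ)..(2 * Real.pi), defectField ν V (τ, x) j :=
    ((ContinuousLinearMap.proj (R := ℝ) (φ := fun _ : Fin n => ℝ) j).intervalIntegral_comp_comm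
      (hc.intervalIntegrable _ _)).symm
  have h2 : Continuous fun τ => (comovingField ν V).toFun (τ, x) j :=
    (continuous_apply j).comp ((comovingField ν V).smooth.continuous.comp (by fun_prop))
  have h3 : ∀ τ, defectField ν V (τ, x) j
      = resonantAverage ν V x j - (comovingField ν V).toFun (τ, x) j := fun _ => rfl
  rw [h1]
  simp only [h3]
  rw [intervalIntegral.integral_sub (continuous_const.intervalIntegrable _ _)
    (h2.intervalIntegrable _ _), intervalIntegral.integral_const, resonantAverage_eq, smul_eq_mul,
    sub_zero, mul_inv_cancel_left₀ Real.two_pi_pos.ne', sub_self]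
  rfl

theorem integral_defectField_eq (t : ℝ) (x : Fin n → ℝ) :
    ∫ τ in (0 : ℝ)..t, defectField ν V (τ, x)
      = t • ∫ s in (0 : ℝ)..1, defectField ν V (t * s, x) := by
  rw [intervalIntegral.smul_integral_comp_mul_left (fun τ => defectField ν V (τ, x)), mul_zero,
    mul_one]

theorem defectField_shift (k : Fin n → ℤ) (t : ℝ) (x : Fin n → ℝ) :
    defectField ν V (t, shift x k) = defectField ν V (t, x) := by
  simp only [defectField, TorusField.shift_space]

/-- The periodic primitive in time of `⟨V⟩_ν - V(t, x - tν)`. -/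
def corrector : TorusField n :=
  TorusField.mk' (fun p => ∫ τ in (0 : ℝ)..p.1, defectField ν V (τ, p.2))
    (by
      have h1 : ContDiff ℝ ∞ fun q : (ℝ × (Fin n → ℝ)) × ℝ =>
          defectField ν V (q.1.1 * q.2, q.1.2) :=
        (contDiff_defectField ν V).comp (by fun_prop)
      have h2 : (fun p : ℝ × (Fin n → ℝ) => ∫ τ in (0 : ℝ)..p.1, defectField ν V (τ, p.2))
          = fun p => p.1 • ∫ s in (0 : ℝ)..1, defectField ν V (p.1 * s, p.2) :=
        funext fun p => integral_defectField_eq ν V p.1 p.2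
      rw [h2]
      exact contDiff_fst.smul (contDiff_parametric_integral h1 0 1))
    (fun k t x => by simp only [defectField_shift])
    (fun t x => by
      have hi : ∀ a b, IntervalIntegrable (fun τ => defectField ν V (τ, x)) volume a b :=
        fun a b => (continuous_defectField_time ν V x).intervalIntegrable a b
      have hper : Function.Periodic (fun τ => defectField ν V (τ, x)) (2 * Real.pi) := fun τ => by
        simp only [defectField, TorusField.add_time]
      rw [← intervalIntegral.integral_add_adjacent_intervals (hi 0 t) (hi t (t + 2 * Real.pi)),
        hper.intervalIntegral_add_eq t 0, zero_add, integral_defectField, add_zero])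

theorem fderiv_corrector (t : ℝ) (x : Fin n → ℝ) :
    fderiv ℝ (corrector ν V).toFun (t, x) (1, 0)
      = resonantAverage ν V x - (comovingField ν V).toFun (t, x) := by
  have h1 := hasDerivAt_fst (corrector ν V).smooth t x
  have h2 := ((continuous_defectField_time ν V x).integral_hasStrictDerivAt 0 t).hasDerivAt
  exact h1.unique h2

end Fields

/-! ### Uniform bounds by periodicity -/

section Bounds

variable {n : ℕ}

/-- The derivatives of a smooth family of functions on `𝕋 × 𝕋ⁿ` are bounded uniformly over a compact
set of parameters. -/
theorem exists_bound_iteratedFDeriv_periodic {P G : Type*} [NormedAddCommGroup P] [NormedSpace ℝ P]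
    [NormedAddCommGroup G] [NormedSpace ℝ G] {F : P × (ℝ × (Fin n → ℝ)) → G}
    (hF : ContDiff ℝ ∞ F) (hx : ∀ p k t x, F (p, (t, shift x k)) = F (p, (t, x)))
    (ht : ∀ p t x, F (p, (t + 2 * Real.pi, x)) = F (p, (t, x))) {K : Set P} (hK : IsCompact K)
    (m : ℕ) :
    ∃ B, ∀ p ∈ K, ∀ q, ‖iteratedFDeriv ℝ m (fun q => F (p, q)) q‖ ≤ B := by
  obtain ⟨B, hB⟩ := exists_bound_slice hF hK
    (C := Icc (0 : ℝ) (2 * Real.pi) ×ˢ cube n) (isCompact_Icc.prod isCompact_Icc) m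
  refine ⟨B, fun p hp ⟨t, x⟩ => ?_⟩
  obtain ⟨k, hk⟩ := exists_shift_mem_cube x
  have h1 : ∀ s, iteratedFDeriv ℝ m (fun q => F (p, q)) (s, x)
      = iteratedFDeriv ℝ m (fun q => F (p, q)) (s, shift x k) := fun s => by
    have := iteratedFDeriv_add_period (f := fun q => F (p, q))
      (τ := ((0 : ℝ), shift (0 : Fin n → ℝ) k)) (fun q => by
        have h2 := hx p k q.1 q.2
        rw [shift_eq] at h2
        simpa [Prod.add_def] using h2) m (s, x)
    rw [← this, Prod.mk_add_mk, add_zero, ← shift_eq]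
  have h2 : Function.Periodic (fun s => iteratedFDeriv ℝ m (fun q => F (p, q)) (s, shift x k))
      (2 * Real.pi) := fun s => by
    have := iteratedFDeriv_add_period (f := fun q => F (p, q))
      (τ := ((2 * Real.pi : ℝ), (0 : Fin n → ℝ))) (fun q => by
        have h2 := ht p q.1 q.2
        simpa [Prod.add_def] using h2) m (s, shift x k)
    beta_reduce
    rw [← this, Prod.mk_add_mk, add_zero]
  obtain ⟨s, hs, hts⟩ := h2.exists_mem_Ico₀ Real.two_pi_pos t
  rw [h1 t]
  refine (congrArg norm hts).trans_le ?_
  exact hB p hp (s, shift x k) ⟨⟨hs.1, hs.2.le⟩, hk⟩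

theorem TorusField.exists_bound_fderiv (Y : TorusField n) :
    ∃ c : ℝ, 0 < c ∧ ∀ p, ‖fderiv ℝ Y.toFun p‖ ≤ c := by
  obtain ⟨B, hB⟩ := exists_bound_iteratedFDeriv_periodic (P := ℝ)
    (F := fun q => Y.toFun q.2) (Y.smooth.comp contDiff_snd) (fun _ k t x => Y.shift_space k t x)
    (fun _ t x => Y.add_time t x) (isCompact_singleton (x := (0 : ℝ))) 1
  refine ⟨|B| + 1, by positivity, fun p => ?_⟩
  have h := hB 0 rfl p
  rw [norm_iteratedFDeriv_one] at h
  linarith [le_abs_self B]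

end Bounds

/-! ### The near-identity flow -/

/-- The determinant does not vanish on the segment from `1` to `1 + A`, where it starts from `1`. -/
theorem det_one_add_pos {n : ℕ} {A : (Fin n → ℝ) →L[ℝ] (Fin n → ℝ)} (hA : ‖A‖ < 1) :
    0 < (1 + A).det := by
  have hc : Continuous fun s : ℝ => (1 + s • A).det := by
    have : Continuous fun B : (Fin n → ℝ) →L[ℝ] (Fin n → ℝ) => B.det :=
      ContinuousLinearMap.continuous_det
    exact this.comp (by fun_prop)
  have hne : ∀ s ∈ Icc (0 : ℝ) 1, (1 + s • A).det ≠ 0 := fun s hs => by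
    have h1 : ‖-(s • A)‖ < 1 := by
      rw [norm_neg, norm_smul, Real.norm_of_nonneg hs.1]
      exact (mul_le_of_le_one_left (norm_nonneg A) hs.2).trans_lt hA
    have h2 : IsUnit (1 + s • A) := by
      have := (Units.oneSub _ h1).isUnit
      rwa [Units.val_oneSub, sub_neg_eq_add] at this
    obtain ⟨B, hB⟩ := h2.exists_right_inv
    have h3 := congrArg ContinuousLinearMap.det hB
    have h4 : (1 + s • A).det * B.det = 1 := by
      simpa [ContinuousLinearMap.det, ContinuousLinearMap.toLinearMap_mul] using h3
    exact left_ne_zero_of_mul_eq_one h4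
  by_contra hcon
  have h0 : (1 + (0 : ℝ) • A).det = 1 := by simp [ContinuousLinearMap.det]
  have h1 : (1 + (1 : ℝ) • A).det ≤ 0 := by simpa using hcon
  obtain ⟨s, hs, hs0⟩ := intermediate_value_Icc' zero_le_one hc.continuousOn
    ⟨h1, by rw [h0]; exact zero_le_one⟩
  exact hne s hs hs0

section NearIdentity

variable {n : ℕ} (g : TorusField n)

/-- The spatial derivative `1 + h ∂ₓg` of `x ↦ x + h g(t, x)`. -/
def nearIdDeriv (h : ℝ) (p : ℝ × (Fin n → ℝ)) : (Fin n → ℝ) →L[ℝ] (Fin n → ℝ) :=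
  1 + h • (fderiv ℝ g.toFun p).comp (ContinuousLinearMap.inr ℝ ℝ (Fin n → ℝ))

theorem nearIdDeriv_apply (h : ℝ) (p : ℝ × (Fin n → ℝ)) (v : Fin n → ℝ) :
    nearIdDeriv g h p v = v + h • fderiv ℝ g.toFun p (0, v) := rfl

theorem contDiff_nearIdDeriv :
    ContDiff ℝ ∞ fun q : ℝ × (ℝ × (Fin n → ℝ)) => nearIdDeriv g q.1 q.2 :=
  contDiff_const.add (contDiff_fst.smul
    (((g.smooth.fderiv_right (m := ∞) (by simp)).comp contDiff_snd).clm_comp contDiff_const))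

theorem fderiv_field_shift (Y : TorusField n) (k : Fin n → ℤ) (t : ℝ) (x : Fin n → ℝ) :
    fderiv ℝ Y.toFun (t, shift x k) = fderiv ℝ Y.toFun (t, x) := by
  have h1 : (fun q => Y.toFun (q + ((0 : ℝ), shift 0 k))) = Y.toFun := funext fun q => by
    have := Y.shift_space k q.1 q.2
    rw [shift_eq] at this
    simpa [Prod.add_def] using this
  have h2 := fderiv_comp_add_right (𝕜 := ℝ) (f := Y.toFun) (x := (t, x)) ((0 : ℝ), shift 0 k)
  rw [h1, Prod.mk_add_mk, add_zero, ← shift_eq] at h2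
  exact h2.symm

theorem fderiv_field_add_time (Y : TorusField n) (t : ℝ) (x : Fin n → ℝ) :
    fderiv ℝ Y.toFun (t + 2 * Real.pi, x) = fderiv ℝ Y.toFun (t, x) := by
  have h1 : (fun q => Y.toFun (q + ((2 * Real.pi : ℝ), (0 : Fin n → ℝ)))) = Y.toFun :=
    funext fun q => by
      have := Y.add_time q.1 q.2
      simpa [Prod.add_def] using this
  have h2 := fderiv_comp_add_right (𝕜 := ℝ) (f := Y.toFun) (x := (t, x))
    ((2 * Real.pi : ℝ), (0 : Fin n → ℝ))
  rw [h1, Prod.mk_add_mk, add_zero] at h2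
  exact h2.symm

variable {g} {c h : ℝ}

theorem norm_smul_fderiv_le (hc : ∀ p, ‖fderiv ℝ g.toFun p‖ ≤ c) (hh : |h| * c ≤ 1 / 2)
    (p : ℝ × (Fin n → ℝ)) : ‖h • fderiv ℝ g.toFun p‖ ≤ 1 / 2 := by
  rw [norm_smul]
  exact (mul_le_mul_of_nonneg_left (hc p) (abs_nonneg h)).trans hh

theorem norm_smul_fderiv_inr_lt (hc : ∀ p, ‖fderiv ℝ g.toFun p‖ ≤ c) (hh : |h| * c ≤ 1 / 2)
    (p : ℝ × (Fin n → ℝ)) :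
    ‖h • (fderiv ℝ g.toFun p).comp (ContinuousLinearMap.inr ℝ ℝ (Fin n → ℝ))‖ < 1 := by
  rw [← ContinuousLinearMap.smul_comp]
  refine ((ContinuousLinearMap.opNorm_comp_le _ _).trans (mul_le_mul
    (norm_smul_fderiv_le hc hh p) (ContinuousLinearMap.norm_inr_le_one ℝ ℝ (Fin n → ℝ))
    (norm_nonneg _) (by norm_num))).trans_lt (by norm_num)

theorem det_nearIdDeriv_pos (hc : ∀ p, ‖fderiv ℝ g.toFun p‖ ≤ c) (hh : |h| * c ≤ 1 / 2)
    (p : ℝ × (Fin n → ℝ)) : 0 < (nearIdDeriv g h p).det :=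
  det_one_add_pos (norm_smul_fderiv_inr_lt hc hh p)

theorem isUnit_nearIdDeriv (hc : ∀ p, ‖fderiv ℝ g.toFun p‖ ≤ c) (hh : |h| * c ≤ 1 / 2)
    (p : ℝ × (Fin n → ℝ)) : IsUnit (nearIdDeriv g h p) := by
  have h1 := norm_smul_fderiv_inr_lt hc hh p
  rw [← norm_neg] at h1
  have := (Units.oneSub _ h1).isUnit
  rwa [Units.val_oneSub, sub_neg_eq_add] at this

/-- The map `(t, x) ↦ (t, x + h g(t, x))` of space-time. -/
def nearId (g : TorusField n) (h : ℝ) (p : ℝ × (Fin n → ℝ)) : ℝ × (Fin n → ℝ) :=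
  p + ((0 : ℝ), h • g.toFun p)

theorem contDiff_nearId : ContDiff ℝ ∞ (nearId g h) :=
  contDiff_id.add (contDiff_const.prodMk (g.smooth.const_smul h))

theorem hasFDerivAt_nearId (p : ℝ × (Fin n → ℝ)) :
    HasFDerivAt (nearId g h) (1 + (ContinuousLinearMap.inr ℝ ℝ (Fin n → ℝ)).comp
      (h • fderiv ℝ g.toFun p)) p :=
  (hasFDerivAt_id p).add ((ContinuousLinearMap.inr ℝ ℝ (Fin n → ℝ)).hasFDerivAt.comp p
    ((g.smooth.differentiable (by simp) p).hasFDerivAt.const_smul h))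

/-- A perturbation of the identity by a map of Lipschitz constant `1/2` has a smooth inverse. -/
theorem exists_nearId_inverse (hc : ∀ p, ‖fderiv ℝ g.toFun p‖ ≤ c) (hh : |h| * c ≤ 1 / 2) :
    ∃ e : (ℝ × (Fin n → ℝ)) ≃ (ℝ × (Fin n → ℝ)), (∀ p, e p = nearId g h p) ∧
      ContDiff ℝ ∞ e.symm := by
  have hg : LipschitzWith (1 / 2) fun p => h • g.toFun p :=
    lipschitzWith_of_nnnorm_fderiv_le (𝕜 := ℝ)
      ((g.smooth.const_smul h).differentiable (by simp)) fun p => by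
        rw [fderiv_fun_const_smul (g.smooth.differentiable (by simp) p)]
        exact_mod_cast norm_smul_fderiv_le hc hh p
  have happ : ApproximatesLinearOn (nearId g h)
      ((ContinuousLinearEquiv.refl ℝ (ℝ × (Fin n → ℝ)) :
        (ℝ × (Fin n → ℝ)) ≃L[ℝ] (ℝ × (Fin n → ℝ))) : _ →L[ℝ] _) univ (1 / 2) := by
    rw [ApproximatesLinearOn.approximatesLinearOn_iff_lipschitzOnWith, lipschitzOnWith_univ]
    refine LipschitzWith.of_dist_le_mul fun p q => ?_
    have h1 : ∀ p, (nearId g h - ⇑((ContinuousLinearEquiv.refl ℝ (ℝ × (Fin n → ℝ)) :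
        (ℝ × (Fin n → ℝ)) ≃L[ℝ] (ℝ × (Fin n → ℝ))) :
          (ℝ × (Fin n → ℝ)) →L[ℝ] (ℝ × (Fin n → ℝ)))) p = ((0 : ℝ), h • g.toFun p) := fun p =>
      add_sub_cancel_left p _
    rw [h1, h1, dist_prod_same_left]
    exact hg.dist_le_mul p q
  have hlt : Subsingleton (ℝ × (Fin n → ℝ)) ∨
      (1 / 2 : ℝ≥0) < ‖((ContinuousLinearEquiv.refl ℝ (ℝ × (Fin n → ℝ))).symm :
        (ℝ × (Fin n → ℝ)) →L[ℝ] (ℝ × (Fin n → ℝ)))‖₊⁻¹ := by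
    right
    have : ‖((ContinuousLinearEquiv.refl ℝ (ℝ × (Fin n → ℝ))).symm :
        (ℝ × (Fin n → ℝ)) →L[ℝ] (ℝ × (Fin n → ℝ)))‖₊ = 1 :=
      NNReal.eq ContinuousLinearMap.norm_id
    rw [this, inv_one]
    exact NNReal.half_lt_self one_ne_zero
  let e := happ.toHomeomorph (nearId g h) hlt
  have hunit : ∀ p : ℝ × (Fin n → ℝ), ∃ L : (ℝ × (Fin n → ℝ)) ≃L[ℝ] (ℝ × (Fin n → ℝ)),
      HasFDerivAt e (L : (ℝ × (Fin n → ℝ)) →L[ℝ] (ℝ × (Fin n → ℝ))) p := fun p => by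
    have h1 : ‖-((ContinuousLinearMap.inr ℝ ℝ (Fin n → ℝ)).comp (h • fderiv ℝ g.toFun p))‖ < 1 := by
      rw [norm_neg]
      exact ((ContinuousLinearMap.opNorm_comp_le _ _).trans (mul_le_mul
        (ContinuousLinearMap.norm_inr_le_one ℝ ℝ (Fin n → ℝ)) (norm_smul_fderiv_le hc hh p)
        (norm_nonneg _) zero_le_one)).trans_lt (by norm_num)
    refine ⟨ContinuousLinearEquiv.unitsEquiv ℝ _ (Units.oneSub _ h1), ?_⟩
    refine (hasFDerivAt_nearId (g := g) (h := h) p).congr_fderiv ?_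
    change _ = ((Units.oneSub _ h1 : _ˣ) : (ℝ × (Fin n → ℝ)) →L[ℝ] (ℝ × (Fin n → ℝ)))
    rw [Units.val_oneSub, sub_neg_eq_add]
  choose L hL using hunit
  exact ⟨e.toEquiv, fun p => rfl, e.contDiff_symm hL contDiff_nearId⟩

/-- The bijection `nearId`, with its smooth inverse. -/
def nearIdEquiv (hc : ∀ p, ‖fderiv ℝ g.toFun p‖ ≤ c) (hh : |h| * c ≤ 1 / 2) :
    (ℝ × (Fin n → ℝ)) ≃ (ℝ × (Fin n → ℝ)) := (exists_nearId_inverse hc hh).choose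

theorem nearIdEquiv_apply (hc : ∀ p, ‖fderiv ℝ g.toFun p‖ ≤ c) (hh : |h| * c ≤ 1 / 2)
    (t : ℝ) (x : Fin n → ℝ) : nearIdEquiv hc hh (t, x) = (t, x + h • g.toFun (t, x)) := by
  rw [nearIdEquiv, (exists_nearId_inverse hc hh).choose_spec.1]
  simp [nearId]

theorem contDiff_nearIdEquiv_symm (hc : ∀ p, ‖fderiv ℝ g.toFun p‖ ≤ c) (hh : |h| * c ≤ 1 / 2) :
    ContDiff ℝ ∞ (nearIdEquiv hc hh).symm := (exists_nearId_inverse hc hh).choose_spec.2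

theorem hasFDerivAt_driftedMap (g : TorusField n) (h : ℝ) (ν : Fin n → ℕ)
    (p : ℝ × (Fin n → ℝ)) :
    HasFDerivAt (fun p : ℝ × (Fin n → ℝ) => p.2 - p.1 • drift ν + h • g.toFun p)
      (ContinuousLinearMap.snd ℝ ℝ (Fin n → ℝ)
        - (ContinuousLinearMap.fst ℝ ℝ (Fin n → ℝ)).smulRight (drift ν)
        + h • fderiv ℝ g.toFun p) p :=
  (hasFDerivAt_snd.sub (hasFDerivAt_fst.smul_const (drift ν))).add
    ((g.smooth.differentiable (by simp) p).hasFDerivAt.const_smul h)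

/-- The curve of diffeomorphisms `x ↦ x - tν + h g(t, x)`. -/
def nearIdFlow (hc : ∀ p, ‖fderiv ℝ g.toFun p‖ ≤ c) (hh : |h| * c ≤ 1 / 2) (ν : Fin n → ℕ) :
    TorusFlow n where
  map p := p.2 - p.1 • drift ν + h • g.toFun p
  inv p := ((nearIdEquiv hc hh).symm (p.1, p.2 + p.1 • drift ν)).2
  smooth := (contDiff_snd.sub (contDiff_fst.smul contDiff_const)).add (g.smooth.const_smul h)
  smooth_inv := contDiff_snd.comp ((contDiff_nearIdEquiv_symm hc hh).comp
    (contDiff_fst.prodMk (contDiff_snd.add (contDiff_fst.smul contDiff_const))))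
  left_inv t x := by
    have h1 : (t, x - t • drift ν + h • g.toFun (t, x) + t • drift ν)
        = nearIdEquiv hc hh (t, x) := by
      rw [nearIdEquiv_apply]
      congr 1
      abel
    simp only [h1, Equiv.symm_apply_apply]
  right_inv t x := by
    obtain ⟨⟨s, y⟩, hq⟩ := (nearIdEquiv hc hh).surjective (t, x + t • drift ν)
    have h1 := hq
    rw [nearIdEquiv_apply, Prod.mk.injEq] at h1
    obtain ⟨rfl, h2⟩ := h1
    simp only [← hq, Equiv.symm_apply_apply]
    rw [sub_add_eq_add_sub, h2, add_sub_cancel_right]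
  map_shift t k x := by
    simp only [g.shift_space, shift_sub_smul_drift]
    rw [shift_eq, shift_eq (_ + _)]
    abel
  det_pos t x := by
    have h1 := det_nearIdDeriv_pos hc hh (t, x)
    rw [ContinuousLinearMap.det, ← LinearMap.det_toMatrix'] at h1
    convert h1 using 2
    ext l m
    rw [(hasFDerivAt_driftedMap g h ν (t, x)).fderiv]
    simp [LinearMap.toMatrix'_apply, nearIdDeriv_apply]

theorem nearIdFlow_map (hc : ∀ p, ‖fderiv ℝ g.toFun p‖ ≤ c) (hh : |h| * c ≤ 1 / 2)
    (ν : Fin n → ℕ) (t : ℝ) (x : Fin n → ℝ) :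
    (nearIdFlow hc hh ν).map (t, x) = x - t • drift ν + h • g.toFun (t, x) := rfl

theorem fderiv_nearIdFlow_space (hc : ∀ p, ‖fderiv ℝ g.toFun p‖ ≤ c) (hh : |h| * c ≤ 1 / 2)
    (ν : Fin n → ℕ) (p : ℝ × (Fin n → ℝ)) (v : Fin n → ℝ) :
    fderiv ℝ (nearIdFlow hc hh ν).map p (0, v) = nearIdDeriv g h p v := by
  change fderiv ℝ (fun p : ℝ × (Fin n → ℝ) => p.2 - p.1 • drift ν + h • g.toFun p) p (0, v) = _
  rw [(hasFDerivAt_driftedMap g h ν p).fderiv, nearIdDeriv_apply]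
  simp

theorem fderiv_nearIdFlow_time (hc : ∀ p, ‖fderiv ℝ g.toFun p‖ ≤ c) (hh : |h| * c ≤ 1 / 2)
    (ν : Fin n → ℕ) (p : ℝ × (Fin n → ℝ)) :
    fderiv ℝ (nearIdFlow hc hh ν).map p (1, 0)
      = -drift ν + h • fderiv ℝ g.toFun p (1, 0) := by
  change fderiv ℝ (fun p : ℝ × (Fin n → ℝ) => p.2 - p.1 • drift ν + h • g.toFun p) p (1, 0) = _
  rw [(hasFDerivAt_driftedMap g h ν p).fderiv]
  simp

theorem jacMat_nearIdFlow (hc : ∀ p, ‖fderiv ℝ g.toFun p‖ ≤ c) (hh : |h| * c ≤ 1 / 2)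
    (ν : Fin n → ℕ) (p : ℝ × (Fin n → ℝ)) (l m : Fin n) :
    (nearIdFlow hc hh ν).jacMat p l m = nearIdDeriv g h p (Pi.single m 1) l := by
  rw [← fderiv_nearIdFlow_space hc hh ν]
  rfl

end NearIdentity

/-! ### The normal form -/

/-- A smooth bounded function that is the identity near zero: it makes the dependence on the small
parameter global. -/
theorem exists_cutoff {δ : ℝ} (hδ : 0 < δ) :
    ∃ η : ℝ → ℝ, ContDiff ℝ ∞ η ∧ (∀ s ∈ Icc 0 δ, η s = s) ∧ ∀ s, |η s| ≤ 2 * δ := by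
  let f : ContDiffBump (0 : ℝ) := ⟨δ, 2 * δ, hδ, by linarith⟩
  refine ⟨fun s => s * f s, contDiff_id.mul f.contDiff, fun s hs => ?_, fun s => ?_⟩
  · have h1 : f s = 1 := f.one_of_mem_closedBall (by
      rw [mem_closedBall_zero_iff, Real.norm_of_nonneg hs.1]; exact hs.2)
    simp only [h1, mul_one]
  · by_cases hs : |s| < 2 * δ
    · rw [abs_mul, abs_of_nonneg f.nonneg]
      exact (mul_le_of_le_one_right (abs_nonneg s) f.le_one).trans hs.le
    · have h1 : f s = 0 := f.zero_of_le_dist (by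
        rw [Real.dist_eq, sub_zero]; exact not_lt.mp hs)
      beta_reduce
      rw [h1, mul_zero, abs_zero]
      positivity

/-- Diffeomorphisms of `ℝⁿ` that differ by a translation in `2πℤⁿ` are the same on the torus. -/
theorem TorusDiffeo.transpose_eq_of_shift {n : ℕ} {χ χ' : TorusDiffeo n} {k : Fin n → ℤ}
    (h : ∀ x, χ'.toFun x = shift (χ.toFun x) k) : χ'.transpose = χ.transpose := by
  have h1 : ∀ f, χ'.pull f = χ.pull f := fun f => testFn_ext fun x => by
    have h2 : χ'.toFun = fun x => χ.toFun x + shift 0 k := funext fun x => by rw [h, shift_eq]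
    change ((Real.sqrt (fderiv ℝ χ'.toFun x).det : ℝ) : ℂ) * f.1 (χ'.toFun x)
      = ((Real.sqrt (fderiv ℝ χ.toFun x).det : ℝ) : ℂ) * f.1 (χ.toFun x)
    rw [h x, f.2.2, h2, fderiv_add_const]
  refine LinearEquiv.ext fun u => Subtype.ext (LinearMap.ext fun φ => ?_)
  rw [transpose_apply, transpose_apply, h1]

section NormalForm

variable {n : ℕ} (ν : Fin n → ℕ) (V : TorusField n)

/-- The comoving field along the perturbed trajectories, `(h, t, x) ↦ V(t, x - tν + h g(t, x))` with
`g` the corrector. -/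
def displacedField (q : ℝ × (ℝ × (Fin n → ℝ))) : Fin n → ℝ :=
  (comovingField ν V).toFun (q.2.1, q.2.2 + q.1 • (corrector ν V).toFun q.2)

theorem contDiff_displacedField : ContDiff ℝ ∞ (displacedField ν V) := by
  have h1 : ContDiff ℝ ∞ fun q : ℝ × (ℝ × (Fin n → ℝ)) => (corrector ν V).toFun q.2 :=
    (corrector ν V).smooth.comp contDiff_snd
  exact (comovingField ν V).smooth.comp ((contDiff_fst.comp contDiff_snd).prodMk
    ((contDiff_snd.comp contDiff_snd).add (contDiff_fst.smul h1)))

theorem displacedField_shift (h : ℝ) (k : Fin n → ℤ) (t : ℝ) (x : Fin n → ℝ) :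
    displacedField ν V (h, (t, shift x k)) = displacedField ν V (h, (t, x)) := by
  simp only [displacedField, TorusField.shift_space]
  rw [shift_eq, add_right_comm, ← shift_eq, TorusField.shift_space]

theorem displacedField_add_time (h t : ℝ) (x : Fin n → ℝ) :
    displacedField ν V (h, (t + 2 * Real.pi, x)) = displacedField ν V (h, (t, x)) := by
  simp only [displacedField, TorusField.add_time]

/-- The field `W` of the normal form `h ⟨V⟩ + h² W`, solving
`(1 + h ∂ₓg)(⟨V⟩ + h W) = ⟨V⟩ - V(t, x - tν) + V(t, x - tν + h g)`. -/
def normalRemainder (q : ℝ × (ℝ × (Fin n → ℝ))) : Fin n → ℝ :=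
  Ring.inverse (nearIdDeriv (corrector ν V) q.1 q.2)
    (hadamard (displacedField ν V) q
      - fderiv ℝ (corrector ν V).toFun q.2 (0, (averagedField ν V).toFun q.2))

theorem normalRemainder_shift (h : ℝ) (k : Fin n → ℤ) (t : ℝ) (x : Fin n → ℝ) :
    normalRemainder ν V (h, (t, shift x k)) = normalRemainder ν V (h, (t, x)) := by
  have h1 := hadamard_add (F := displacedField ν V) ((0 : ℝ), shift (0 : Fin n → ℝ) k)
    (fun h p => by
      have := displacedField_shift ν V h k p.1 p.2
      rw [shift_eq] at this
      simpa [Prod.add_def] using this) h (t, x)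
  rw [Prod.mk_add_mk, add_zero, ← shift_eq] at h1
  simp only [normalRemainder, nearIdDeriv, fderiv_field_shift, TorusField.shift_space, h1]

theorem normalRemainder_add_time (h t : ℝ) (x : Fin n → ℝ) :
    normalRemainder ν V (h, (t + 2 * Real.pi, x)) = normalRemainder ν V (h, (t, x)) := by
  have h1 := hadamard_add (F := displacedField ν V) ((2 * Real.pi : ℝ), (0 : Fin n → ℝ))
    (fun h p => by
      have := displacedField_add_time ν V h p.1 p.2
      simpa [Prod.add_def] using this) h (t, x)
  rw [Prod.mk_add_mk, add_zero] at h1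
  simp only [normalRemainder, nearIdDeriv, fderiv_field_add_time, TorusField.add_time, h1]

variable {ν V} {c : ℝ} {η : ℝ → ℝ}

theorem contDiff_normalRemainder (hc : ∀ p, ‖fderiv ℝ (corrector ν V).toFun p‖ ≤ c)
    (hη : ContDiff ℝ ∞ η) (hh : ∀ s, |η s| * c ≤ 1 / 2) :
    ContDiff ℝ ∞ fun q : ℝ × (ℝ × (Fin n → ℝ)) => normalRemainder ν V (η q.1, q.2) := by
  have hm : ContDiff ℝ ∞ fun q : ℝ × (ℝ × (Fin n → ℝ)) => (η q.1, q.2) :=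
    (hη.comp contDiff_fst).prodMk contDiff_snd
  have h1 : ContDiff ℝ ∞ fun q : ℝ × (ℝ × (Fin n → ℝ)) =>
      Ring.inverse (nearIdDeriv (corrector ν V) (η q.1) q.2) := by
    rw [contDiff_iff_contDiffAt]
    intro q
    obtain ⟨a, ha⟩ := isUnit_nearIdDeriv hc (hh q.1) q.2
    have h2 := contDiffAt_ringInverse ℝ (n := ∞) a
    rw [ha] at h2
    exact h2.comp q ((contDiff_nearIdDeriv (corrector ν V)).comp hm).contDiffAt
  have h3 : ContDiff ℝ ∞ fun q : ℝ × (ℝ × (Fin n → ℝ)) =>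
      fderiv ℝ (corrector ν V).toFun q.2 (0, (averagedField ν V).toFun q.2) :=
    (((corrector ν V).smooth.fderiv_right (m := ∞) (by simp)).comp contDiff_snd).clm_apply
      (contDiff_const.prodMk ((averagedField ν V).smooth.comp contDiff_snd))
  exact h1.clm_apply (((contDiff_hadamard (contDiff_displacedField ν V)).comp hm).sub h3)

/-- The remainder of the normal form at the cut off value `η ε` of the parameter. -/
def remainderField (hc : ∀ p, ‖fderiv ℝ (corrector ν V).toFun p‖ ≤ c) (hη : ContDiff ℝ ∞ η)
    (hh : ∀ s, |η s| * c ≤ 1 / 2) (ε : ℝ) : TorusField n :=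
  TorusField.mk' (fun p => normalRemainder ν V (η ε, p))
    ((contDiff_normalRemainder hc hη hh).comp (contDiff_const.prodMk contDiff_id))
    (normalRemainder_shift ν V (η ε)) (normalRemainder_add_time ν V (η ε))

/-- The field `ε ⟨V⟩ + ε² W` of the normal form. -/
def normalField (V W : TorusField n) (ν : Fin n → ℕ) (ε : ℝ) : TorusField n :=
  TorusField.mk' (fun p => ε • resonantAverage ν V p.2 + ε ^ 2 • W.toFun p)
    (((averagedField ν V).smooth.const_smul ε).add (W.smooth.const_smul (ε ^ 2)))
    (fun k t x => by
      have := (averagedField ν V).shift_space k t x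
      change resonantAverage ν V (shift x k) = resonantAverage ν V x at this
      rw [W.shift_space, this])
    (fun t x => by rw [W.add_time])

/-- The near-identity flow generated by the corrector conjugates `ν + ε V` to the normal form. -/
theorem conjugates_nearIdFlow (hc : ∀ p, ‖fderiv ℝ (corrector ν V).toFun p‖ ≤ c)
    (hη : ContDiff ℝ ∞ η) (hh : ∀ s, |η s| * c ≤ 1 / 2) {ε : ℝ} (hε : η ε = ε) :
    (nearIdFlow hc (hh ε) ν).Conjugates (perturbedField ν V ε)
      (normalField V (remainderField hc hη hh ε) ν ε) := by
  intro t x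
  rw [fderiv_nearIdFlow_space, fderiv_nearIdFlow_time, fderiv_corrector, nearIdFlow_map, hε]
  have h1 : (perturbedField ν V ε).toFun (t, x - t • drift ν + ε • (corrector ν V).toFun (t, x))
      = drift ν + ε • displacedField ν V (ε, (t, x)) := by
    change drift ν + ε • V.toFun _ = drift ν + ε • V.toFun _
    simp only [sub_add_eq_add_sub]
  have h2 : (normalField V (remainderField hc hη hh ε) ν ε).toFun (t, x)
      = ε • resonantAverage ν V x + ε ^ 2 • normalRemainder ν V (ε, (t, x)) := by
    change _ + ε ^ 2 • normalRemainder ν V (η ε, (t, x)) = _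
    rw [hε]
  have hu := isUnit_nearIdDeriv hc (hh ε) (t, x)
  rw [hε] at hu
  have h3 : nearIdDeriv (corrector ν V) ε (t, x) (normalRemainder ν V (ε, (t, x)))
      = hadamard (displacedField ν V) (ε, (t, x))
        - fderiv ℝ (corrector ν V).toFun (t, x) (0, resonantAverage ν V x) := by
    have := DFunLike.congr_fun (Ring.mul_inverse_cancel _ hu)
      (hadamard (displacedField ν V) (ε, (t, x))
        - fderiv ℝ (corrector ν V).toFun (t, x) (0, resonantAverage ν V x))
    exact this
  have h4 := smul_hadamard (contDiff_displacedField ν V) ε (t, x)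
  have h5 : displacedField ν V (0, (t, x)) = (comovingField ν V).toFun (t, x) := by
    simp [displacedField]
  rw [h1, h2, map_add, map_smul, map_smul, h3, nearIdDeriv_apply, smul_sub, pow_two, mul_smul ε ε,
    h4, h5]
  module

theorem transpose_nearIdFlow_periodic {g : TorusField n} {h : ℝ}
    (hc : ∀ p, ‖fderiv ℝ g.toFun p‖ ≤ c) (hh : |h| * c ≤ 1 / 2) (ν : Fin n → ℕ) (t : ℝ) :
    ((nearIdFlow hc hh ν).diffeo (t + 2 * Real.pi)).transpose
      = ((nearIdFlow hc hh ν).diffeo t).transpose :=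
  TorusDiffeo.transpose_eq_of_shift (k := fun j => -(ν j : ℤ)) fun x => by
    change (nearIdFlow hc hh ν).map _ = shift ((nearIdFlow hc hh ν).map _) _
    rw [nearIdFlow_map, nearIdFlow_map, g.add_time, sub_two_pi_smul_drift, shift_eq,
      shift_eq (_ + _)]
    abel

/-- Uniform Sobolev bounds for the action of the near-identity flows. -/
theorem exists_sobolevSq_bound_nearIdFlow {g : TorusField n}
    (hc : ∀ p, ‖fderiv ℝ g.toFun p‖ ≤ c) (hη : ContDiff ℝ ∞ η)
    (hh : ∀ s, |η s| * c ≤ 1 / 2) (ν : Fin n → ℕ) (ε₀ : ℝ) (N : ℕ) :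
    ∃ K : ℝ≥0, ∀ ε ∈ Icc 0 ε₀, ∀ (t σ : ℝ), 0 ≤ σ → σ ≤ N → ∀ u : Distr n,
      sobolevSq σ (((nearIdFlow hc (hh ε) ν).diffeo t).transpose u) ≤ K * sobolevSq σ u ∧
      sobolevSq σ (((nearIdFlow hc (hh ε) ν).diffeo t).transpose.symm u)
        ≤ K * sobolevSq σ u := by
  -- The Jacobian matrix, as a function of `((ε, t), x)`.
  let A : (ℝ × ℝ) × (Fin n → ℝ) → Matrix (Fin n) (Fin n) ℝ := fun q =>
    Matrix.of fun l m => nearIdDeriv g (η q.1.1) (q.1.2, q.2) (Pi.single m 1) l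
  have hA : ∀ l m, ContDiff ℝ ∞ fun q => A q l m := fun l m => by
    have h1 : ContDiff ℝ ∞ fun q : (ℝ × ℝ) × (Fin n → ℝ) => (η q.1.1, (q.1.2, q.2)) :=
      (hη.comp (contDiff_fst.comp contDiff_fst)).prodMk
        ((contDiff_snd.comp contDiff_fst).prodMk contDiff_snd)
    exact (contDiff_apply ℝ ℝ l).comp
      (((contDiff_nearIdDeriv g).comp h1).clm_apply contDiff_const)
  have hAp : ∀ p k x, A (p, shift x k) = A (p, x) := fun p k x => by
    simp only [A, nearIdDeriv, fderiv_field_shift]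
  have hAJ : ∀ ε t x, A ((ε, t), x) = (nearIdFlow hc (hh ε) ν).jacMat (t, x) := fun ε t x => by
    ext l m
    rw [jacMat_nearIdFlow]
    rfl
  have hdet : ContDiff ℝ ∞ fun q => (A q).det := by
    simp only [Matrix.det_apply']
    exact ContDiff.sum fun σ _ => contDiff_const.mul (contDiff_prod fun i _ => hA _ _)
  have hpos : ∀ q, (A q).det ≠ 0 := fun q => by
    rw [hAJ q.1.1 q.1.2 q.2]
    exact (TorusFlow.det_jacMat_pos _ _).ne'
  let ι := {p : ℝ × ℝ // p ∈ Icc 0 ε₀ ×ˢ Icc 0 (2 * Real.pi)}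
  have hK : IsCompact (Icc 0 ε₀ ×ˢ Icc 0 (2 * Real.pi)) := isCompact_Icc.prod isCompact_Icc
  let χ : ι → TorusDiffeo n := fun p => (nearIdFlow hc (hh p.1.1) ν).diffeo p.1.2
  have hE : ∀ l j, UB fun p => (χ p).entry l j := fun l j N => by
    obtain ⟨B, hB⟩ := exists_normLE_slice (F := fun q => ((A q l j : ℝ) : ℂ))
      (Complex.ofRealCLM.contDiff.comp (hA l j)) (fun p k x => by simp only [hAp]) hK N
    refine ⟨B, fun p => ?_⟩
    have : (χ p).entry l j = slice (fun q => ((A q l j : ℝ) : ℂ))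
        (Complex.ofRealCLM.contDiff.comp (hA l j)) (fun p k x => by simp only [hAp]) p.1 :=
      testFn_ext fun x => by
        rw [TorusFlow.entry_diffeo, ← hAJ]
        rfl
    beta_reduce
    rw [this]
    exact hB p.1 p.2
  have hI : UB fun p => (χ p).invJac := fun N => by
    have hs : ContDiff ℝ ∞ fun q => ((((A q).det)⁻¹ : ℝ) : ℂ) :=
      Complex.ofRealCLM.contDiff.comp (hdet.inv hpos)
    obtain ⟨B, hB⟩ := exists_normLE_slice hs (fun p k x => by simp only [hAp]) hK N
    refine ⟨B, fun p => ?_⟩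
    have : (χ p).invJac = slice (fun q => ((((A q).det)⁻¹ : ℝ) : ℂ)) hs
        (fun p k x => by simp only [hAp]) p.1 :=
      testFn_ext fun x => by
        rw [TorusDiffeo.invJac_apply]
        change (((fderiv ℝ (fun y => (nearIdFlow hc (hh p.1.1) ν).map (p.1.2, y)) x).det⁻¹ : ℝ) : ℂ)
          = (((A ((p.1.1, p.1.2), x)).det⁻¹ : ℝ) : ℂ)
        rw [TorusFlow.det_fderiv_snd, hAJ]
    beta_reduce
    rw [this]
    exact hB p.1 p.2
  obtain ⟨K, hK⟩ := exists_sobolevSq_bound hE hI N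
  refine ⟨K, fun ε hε t σ hσ hσN u => ?_⟩
  -- Times in one period suffice, and there the parameters lie in a compact set.
  have hper : Function.Periodic (fun t => ((nearIdFlow hc (hh ε) ν).diffeo t).transpose)
      (2 * Real.pi) := transpose_nearIdFlow_periodic hc (hh ε) ν
  obtain ⟨s, hs, hts⟩ := hper.exists_mem_Ico₀ Real.two_pi_pos t
  rw [hts]
  exact hK ⟨(ε, s), hε, hs.1, hs.2.le⟩ σ hσ hσN u

end NormalForm

end TorusTransport

end

open TorusTransport in
theorem proposition5 (n : ℕ) (hn : 1 ≤ n) (ν : Fin n → ℕ) (V : TorusField n) :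
    ∃ ε₀ : ℝ, 0 < ε₀ ∧
    ∃ (Φ : ℝ → ℝ → (Distr n ≃ₗ[ℂ] Distr n)) (W : ℝ → TorusField n) (C : ℝ → ℝ),
      -- all seminorms of `W ε` are bounded uniformly in `ε`
      (∀ m : ℕ, ∃ B : ℝ, ∀ ε ∈ Set.Icc 0 ε₀, ∀ p : ℝ × (Fin n → ℝ),
        ‖iteratedFDeriv ℝ m (W ε).toFun p‖ ≤ B) ∧
      -- `Φ ε` is `2π`-periodic in time
      (∀ ε ∈ Set.Icc 0 ε₀, ∀ t : ℝ, Φ ε (t + 2 * Real.pi) = Φ ε t) ∧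
      -- bounds on `H^σ`, uniform in `ε` and `t`
      (∀ σ : ℝ, 0 ≤ σ → 0 < C σ ∧ ∀ ε ∈ Set.Icc 0 ε₀, ∀ t : ℝ,
        sobolevOpNorm σ (Φ ε t).toLinearMap + sobolevOpNorm σ (Φ ε t).symm.toLinearMap
          ≤ ENNReal.ofReal (C σ)) ∧
      -- the constant is bounded for `σ` in a compact interval
      (∀ a b : ℝ, 0 ≤ a → a ≤ b → BddAbove (C '' Set.Icc a b)) ∧
      -- solutions are conjugated to solutions of the normal form
      (∀ ε ∈ Set.Icc 0 ε₀, ∀ u v : ℝ → Distr n, IsTransportSolution ν V ε u →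
        (∀ t, u t = Φ ε t (v t)) → IsNormalFormSolution ν V (W ε) ε v) := by
  obtain ⟨c, hc0, hc⟩ := (corrector ν V).exists_bound_fderiv
  -- The cutoff at `δ = 1 / (4c)` is bounded by `2δ`, which makes `h g` of Lipschitz constant `1/2`.
  have hδ : 0 < (4 * c)⁻¹ := by positivity
  obtain ⟨η, hη, hηid, hηle⟩ := exists_cutoff hδ
  have hh : ∀ s, |η s| * c ≤ 1 / 2 := fun s => by
    calc |η s| * c ≤ 2 * (4 * c)⁻¹ * c := by
          have := hηle s
          gcongr
      _ = 1 / 2 := by field_simp; norm_num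
  choose K hK using exists_sobolevSq_bound_nearIdFlow hc hη hh ν (4 * c)⁻¹
  refine ⟨(4 * c)⁻¹, hδ, fun ε t => ((nearIdFlow hc (hh ε) ν).diffeo t).transpose,
    remainderField hc hη hh, fun σ => 2 * Real.sqrt (K ⌈σ⌉₊) + 1, fun m => ?_, fun ε _ t => ?_,
    fun σ hσ => ⟨by positivity, fun ε hε t => ?_⟩, fun a b ha hab => ?_,
    fun ε hε u v hu huv => ?_⟩
  · exact exists_bound_iteratedFDeriv_periodic (contDiff_normalRemainder hc hη hh)
      (fun ε => normalRemainder_shift ν V (η ε)) (fun ε => normalRemainder_add_time ν V (η ε))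
      isCompact_Icc m
  · exact transpose_nearIdFlow_periodic hc (hh ε) ν t
  · have h := hK ⌈σ⌉₊ ε hε t σ hσ (Nat.le_ceil σ)
    refine (add_le_add (sobolevOpNorm_le fun u => (h u).1)
      (sobolevOpNorm_le fun u => (h u).2)).trans ?_
    rw [← ENNReal.ofReal_add (Real.sqrt_nonneg _) (Real.sqrt_nonneg _)]
    exact ENNReal.ofReal_le_ofReal (by linarith)
  · refine ⟨2 * ∑ i ∈ Finset.range (⌈b⌉₊ + 1), Real.sqrt (K i) + 1, ?_⟩
    rintro _ ⟨σ, hσ, rfl⟩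
    have h := Finset.single_le_sum (f := fun i => Real.sqrt (K i))
      (fun i _ => Real.sqrt_nonneg _) (Finset.mem_range.mpr
        (Nat.lt_succ_of_le (Nat.ceil_le_ceil hσ.2)))
    beta_reduce at h ⊢
    linarith
  · have hconj := conjugates_nearIdFlow hc hη hh (hηid ε hε)
    have hv : v = fun t => ((nearIdFlow hc (hh ε) ν).diffeo t).transpose.symm (u t) :=
      funext fun t => by rw [huv t, LinearEquiv.symm_apply_apply]
    have hu' : HasTimeDeriv u fun t => fieldOp (perturbedField ν V ε) t (u t) := by
      simpa only [IsTransportSolution, transportOp_eq_fieldOp] using hu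
    refine ⟨fun t => fieldOp (normalField V (remainderField hc hη hh ε) ν ε) t (v t),
      fun t => isWeylOp_fieldOp (normalField V (remainderField hc hη hh ε) ν ε) t (v t), ?_⟩
    rw [hv]
    exact hconj.hasTimeDeriv hu'
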